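/- Let $\alpha,\beta\in\mathbb C$, let $c=\sqrt{-\beta}$ be either square root of $-\beta$, and consider the Ince-XXIII system $$\frac{dx}{dt}=\frac{\partial H}{\partial y}=xy+c,\qquad \frac{dy}{dt}=-\frac{\partial H}{\partial x}=\tfrac32x^2-\tfrac12y^2+\tfrac{\alpha}{2},\qquad H=\tfrac12xy^2-\tfrac12x^3-\tfrac{\alpha}{2}x+cy .$$ Put $$\begin{aligned} 0)\ &x_0=x,\quad y_0=y,\\ 1)\ &x_1=\tfrac1x,\quad y_1=-\Big((y-x)x-\tfrac{\alpha-2c}{2}\Big)x,\\ 2)\ &x_2=\tfrac1x,\quad y_2=-\Big((y+x)x+\tfrac{\alpha+2c}{2}\Big)x,\\ 3)\ &x_3=-(xy+2c)y,\quad y_3=\tfrac1y . \end{aligned}$$ **(A) Phase space.** The maps $(x,y)\mapsto(x_j,y_j)$ are birational and symplectic ($\mathbb C(x_j,y_j)=\mathbb C(x,y)$ and $dx_j\wedge dy_j=dx\wedge dy$). Let $S$ be the rational surface obtained from $\mathbb P^2\supset\mathbb C^2\ni(x,y)$ by blowing up successively nine points, three (infinitely near) over each of the points $y=x$, $y=-x$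 and $x=0$ of the line at infinity, namely * $(0,1)$ in the coordinates $(\frac1x,\frac yx)$, then $(0,0)$ in $(\frac1x,\,y-x)$, then $(0,\frac{\alpha-2c}{2})$ in $(\frac1x,\,(y-x)x)$; * $(0,-1)$ in $(\frac1x,\frac yx)$, then $(0,0)$ in $(\frac1x,\,y+x)$, then $(0,-\frac{\alpha+2c}{2})$ in $(\frac1x,\,(y+x)x)$; * $(0,0)$ in $(\frac1y,\frac xy)$, then $(0,0)$ in $(\frac1y,\,x)$, then $(0,-2c)$ in $(\frac1y,\,xy)$. Each of these is a point of the surface constructed before it. The surface $S$ is of type $E_6^{(1)}$: the strict transforms on $S$ of the line at infinity and of the exceptional curves of the first two blow-ups over each of the three points are seven smooth rational curves $D_0,\dots,D_6$ of self-intersection $-2$, which meet transversally, in at most one point each, according to the affine Dynkin diagram $E_6^{(1)}$ (with the line at infinity as its centre), and the divisor of the $2$-form $dx\wedge dy$ on $S$ is $-\sum_i m_iD_i$, where $m_i$ are the coefficients of the null root of $E_6^{(1)}$ ($3$ at the centre, then $2$ and $1$ along each arm). The phase space $\mathcal X$ of the system is obtained by gluing the four copies $U_j\cong\mathbb C^2\ni(x_j,y_j)$,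 $j=0,1,2,3$ (times the $t$-line $\mathbb C$, which is carried along unchanged), via these birational maps: the glued surface is $\mathcal X=S\setminus\bigcup_iD_i$. That it is the phase space of the system means the following. In each chart the system is the Hamiltonian system of $H$ written as a polynomial in $(x_j,y_j)$; $\mathcal X$ is exactly the set of points of $S$ at which the vector field $v$ of the system is holomorphic; with $D=\sum_i D_i$, one has $v\in H^0(S,\Theta_S(-\log D)(D))$, and $v$ has no accessible singularity on $D$ (a smooth point $P$ of $D$ is an accessible singularity if, in local coordinates $(\xi_1,\xi_2)$ at $P$ with $D=\{\xi_1=0\}$, the function $\xi_1\,v(\xi_2)$ vanishes at $P$). Moreover every meromorphic solution $(x(t),y(t))$ becomes holomorphic in $\mathcal X$: if $x,y$ are meromorphic at $t_0\in\mathbb C$ and solve the system on a punctured neighbourhood of $t_0$, then for some $j$ the functions $x_j(t),y_j(t)$ are defined near $t_0$ for $t\ne t_0$ and extend holomorphically to $t_0$. **(B) Symmetries.** The system is invariant under the birational transformations $$\begin{aligned} s_0:(x,y;\alpha,\beta)\to&\Big(x-\tfrac{(\alpha-2c)/2}{y-x},\,y-\tfrac{(\alpha-2c)/2}{y-x};\,\tfrac{-\alpha+6c}{2},\,\tfrac{-\alpha^2-4\alpha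 c+4\beta}{16}\Big),\\ s_1:(x,y;\alpha,\beta)\to&\Big(x+\tfrac{(\alpha+2c)/2}{y+x},\,y-\tfrac{(\alpha+2c)/2}{y+x};\,\tfrac{-\alpha-6c}{2},\,\tfrac{-\alpha^2+4\alpha c+4\beta}{16}\Big),\\ s_2:(x,y;\alpha,\beta)\to&\Big(x,\,y+\tfrac{2c}{x};\,\alpha,\,\beta\Big), \end{aligned}$$ where the square root $\sqrt{-\beta}=c$ is transformed to the square root $\frac{\alpha+2c}{4}$, $\frac{-\alpha+2c}{4}$, $-c$, respectively, of minus the new $\beta$: each $s_i$ carries every solution of the system on an open set of $t\in\mathbb C$ on which its denominator ($y-x$, $y+x$, $x$ respectively) does not vanish to a solution of the system with the transformed parameters. -/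

import Mathlib

open Topology Filter

noncomputable section

namespace Ince

/-! ## The field of rational functions, points and curves

All surfaces below are rational surfaces over `ℂ` with function field `K = ℂ(x, y)`. They are
described in the classical way of Zariski: a surface is the set of the local rings of its (closed)
points, inside its function field. Gluing charts by birational maps means forming the union of
their sets of local rings: a point of one chart and a point of another are identified exactly when
the birational map relating the two charts is a local isomorphism carrying one to the other. -/

/-- The field `ℂ(x, y)`. -/
abbrev K : Type := FractionRing (MvPolynomial (Fin 2) ℂ)

/-- The coordinate function `x`. -/
def x : K := algebraMap (MvPolynomial (Fin 2) ℂ) K (MvPolynomial.X 0)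

/-- The coordinate function `y`. -/
def y : K := algebraMap (MvPolynomial (Fin 2) ℂ) K (MvPolynomial.X 1)

/-- The local ring of the point with coordinates `(a, b)` of the affine plane with coordinate
functions `(u, v)`: all quotients `p(u, v) / q(u, v)` with `q(a, b) ≠ 0`. -/
def planePoint (u v : K) (a b : ℂ) : Subalgebra ℂ K where
  carrier := {f | ∃ p q : MvPolynomial (Fin 2) ℂ, MvPolynomial.eval ![a, b] q ≠ 0 ∧
    f * MvPolynomial.aeval ![u, v] q = MvPolynomial.aeval ![u, v] p}
  mul_mem' := by
    rintro f g ⟨p, q, hq, h⟩ ⟨p', q', hq', h'⟩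
    exact ⟨p * p', q * q', by simpa using ⟨hq, hq'⟩, by rw [map_mul, map_mul, ← h, ← h']; ring⟩
  add_mem' := by
    rintro f g ⟨p, q, hq, h⟩ ⟨p', q', hq', h'⟩
    exact ⟨p * q' + p' * q, q * q', by simpa using ⟨hq, hq'⟩, by
      rw [map_mul, map_add, map_mul, map_mul, ← h, ← h']; ring⟩
  algebraMap_mem' r := ⟨MvPolynomial.C r, 1, by simp, by simp⟩

/-- The affine plane `ℂ²` with coordinate functions `(u, v)`, as a set of points. -/
def affinePlane (u v : K) : Set (Subalgebra ℂ K) :=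
  {R | ∃ a b : ℂ, R = planePoint u v a b}

/-- The (generic) local ring of the irreducible curve `u = 0` of the affine plane with coordinate
functions `(u, v)`: all quotients `p(u, v) / q(u, v)` where the polynomial `q` is not divisible by
its first variable. A curve on a surface is described by this ring, which is the same for all
surfaces on which the curve and its strict transforms live. -/
def planeCurve (u v : K) : Subalgebra ℂ K where
  carrier := {f | ∃ p q : MvPolynomial (Fin 2) ℂ, ¬ MvPolynomial.X 0 ∣ q ∧
    f * MvPolynomial.aeval ![u, v] q = MvPolynomial.aeval ![u, v] p}
  mul_mem' := by
    rintro f g ⟨p, q, hq, h⟩ ⟨p', q', hq', h'⟩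
    refine ⟨p * p', q * q', fun hd => ?_, by rw [map_mul, map_mul, ← h, ← h']; ring⟩
    exact ((MvPolynomial.X_prime (i := (0 : Fin 2)) (R := ℂ)).dvd_or_dvd hd).elim hq hq'
  add_mem' := by
    rintro f g ⟨p, q, hq, h⟩ ⟨p', q', hq', h'⟩
    refine ⟨p * q' + p' * q, q * q', fun hd => ?_, by
      rw [map_mul, map_add, map_mul, map_mul, ← h, ← h']; ring⟩
    exact ((MvPolynomial.X_prime (i := (0 : Fin 2)) (R := ℂ)).dvd_or_dvd hd).elim hq hq'
  algebraMap_mem' r := ⟨MvPolynomial.C r, 1,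
    fun h => (MvPolynomial.X_prime (i := (0 : Fin 2)) (R := ℂ)).not_unit (isUnit_of_dvd_one h),
    by simp⟩

/-- The non-units of a subring `R` of `K`: the maximal ideal, when `R` is local. -/
def maxIdeal (R : Subalgebra ℂ K) : Set K := {f | f ∈ R ∧ (f = 0 ∨ f⁻¹ ∉ R)}

/-- The projective plane with affine coordinates `(x, y)`. -/
def projectivePlane : Set (Subalgebra ℂ K) :=
  affinePlane x y ∪ affinePlane (1 / x) (y / x) ∪ affinePlane (x / y) (1 / y)

/-! ## Blowing up a point -/

/-- The affine blow-up algebra `R[𝔪 / a]`, for `a` in the maximal ideal `𝔪` of `R`. -/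
def blowUpAlgebra (R : Subalgebra ℂ K) (a : K) : Subalgebra ℂ K :=
  Algebra.adjoin ℂ ((R : Set K) ∪ {f | ∃ b ∈ maxIdeal R, f = b / a})

/-- The local ring of the `ℂ`-point `φ` of the affine variety with coordinate ring `A`. -/
def localRingAt (A : Subalgebra ℂ K) (φ : A →ₐ[ℂ] ℂ) : Subalgebra ℂ K where
  carrier := {f | ∃ p q : A, φ q ≠ 0 ∧ f * (q : K) = p}
  mul_mem' := by
    rintro f g ⟨p, q, hq, h⟩ ⟨p', q', hq', h'⟩
    exact ⟨p * p', q * q', by simpa using ⟨hq, hq'⟩, by push_cast; rw [← h, ← h']; ring⟩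
  add_mem' := by
    rintro f g ⟨p, q, hq, h⟩ ⟨p', q', hq', h'⟩
    exact ⟨p * q' + p' * q, q * q', by simpa using ⟨hq, hq'⟩, by
      push_cast; rw [← h, ← h']; ring⟩
  algebraMap_mem' r := ⟨algebraMap ℂ A r, 1, by simp, by simp⟩

/-- The blow-up of the surface `S` at its point `R`: the point `R` is replaced by the points of the
charts `Spec R[𝔪 / a]`, `0 ≠ a ∈ 𝔪`, of the blow-up of `Spec R` at its closed point. (Since `R` is
local with residue field `ℂ`, every `ℂ`-point of `R[𝔪 / a]` lies over the closed point.) -/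
def blowUp (S : Set (Subalgebra ℂ K)) (R : Subalgebra ℂ K) : Set (Subalgebra ℂ K) :=
  (S \ {R}) ∪
    {T | ∃ a ∈ maxIdeal R, a ≠ 0 ∧ ∃ φ : blowUpAlgebra R a →ₐ[ℂ] ℂ,
      T = localRingAt (blowUpAlgebra R a) φ}

/-- The surface obtained from `S` by blowing up successively the points of a list. -/
def blowUps (S : Set (Subalgebra ℂ K)) (l : List (Subalgebra ℂ K)) : Set (Subalgebra ℂ K) :=
  l.foldl blowUp S

/-! ## Curves on surfaces. A point `R` lies on a curve `V` exactly when `R ≤ V`. -/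

/-- `f` and `g` generate the maximal ideal of the local ring `R`: they are local coordinates
centred at the point `R` of a smooth surface. -/
def IsCoordinates (R : Subalgebra ℂ K) (f g : K) : Prop :=
  f ∈ R ∧ g ∈ R ∧ ∀ h, h ∈ maxIdeal R ↔ ∃ a ∈ R, ∃ b ∈ R, h = a * f + b * g

/-- `f = 0` is a local equation of the curve `V` at the point `R`. -/
def IsLocalEquation (V R : Subalgebra ℂ K) (f : K) : Prop :=
  f ∈ R ∧ ∀ h ∈ R, h ∈ maxIdeal V ↔ ∃ a ∈ R, h = a * f

/-- The intersection multiplicity `dim R / (f, g)` at `R` of the curves `f = 0` and `g = 0`. -/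
def localMultiplicity (R : Subalgebra ℂ K) (f g : R) : ℕ :=
  Module.finrank ℂ (R ⧸ Ideal.span {f, g})

/-- `n` is the order of vanishing at the point `R` of the restriction to the curve `V` of the
rational function `h`, which has neither a zero nor a pole along `V`; here `g = 0` is a local
equation of `V` at `R`. -/
def IsOrderOfRestriction (V R : Subalgebra ℂ K) (g : R) (h : K) (n : ℤ) : Prop :=
  ∃ p q : R, (p : K) ∉ maxIdeal V ∧ (q : K) ∉ maxIdeal V ∧ h * (q : K) = p ∧
    n = (localMultiplicity R g p : ℤ) - (localMultiplicity R g q : ℤ)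

/-- The self-intersection number of the curve `V` on the projective surface `S` is `n`, i.e. its
conormal bundle `𝒪(-V)|_V` has degree `-n`. The degree is the number of zeros minus poles of the
rational section given by a rational function `f` vanishing to first order along `V`: in terms
of a local equation `g` of `V`, which trivialises the bundle, this section is the restriction of
`f / g` to `V`. -/
def HasSelfIntersection (S : Set (Subalgebra ℂ K)) (V : Subalgebra ℂ K) (n : ℤ) : Prop :=
  ∃ f : K, f ≠ 0 ∧ (∀ h, h ∈ maxIdeal V ↔ ∃ a ∈ V, h = a * f) ∧
    ∃ ord : Subalgebra ℂ K →₀ ℤ,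
      (∀ R, ¬ (R ∈ S ∧ R ≤ V) → ord R = 0) ∧
      (∀ R ∈ S, R ≤ V → ∃ g : R, IsLocalEquation V R g ∧
        IsOrderOfRestriction V R g (f / g) (ord R)) ∧
      (ord.sum fun _ k => k) = -n

/-- `V` is a smooth rational curve on the surface `S`. -/
def IsSmoothRationalCurve (S : Set (Subalgebra ℂ K)) (V : Subalgebra ℂ K) : Prop :=
  (∃ π : V →ₐ[ℂ] RatFunc ℂ, Function.Surjective π ∧ ∀ h, π h = 0 ↔ (h : K) ∈ maxIdeal V) ∧
    (∃ R ∈ S, R ≤ V) ∧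
    ∀ R ∈ S, R ≤ V → ∃ f g : K, IsLocalEquation V R f ∧ IsCoordinates R f g

/-- The curves `V` and `W` meet in exactly one point of `S`, and transversally there. -/
def MeetOnceTransversally (S : Set (Subalgebra ℂ K)) (V W : Subalgebra ℂ K) : Prop :=
  ∃ R ∈ S, R ≤ V ∧ R ≤ W ∧ (∀ R' ∈ S, R' ≤ V → R' ≤ W → R' = R) ∧
    ∃ f g : K, IsLocalEquation V R f ∧ IsLocalEquation W R g ∧ IsCoordinates R f g

/-- `f` is a family of local equations at `R` of the members of the family `D` of curves (equal to
`1` for the curves which do not pass through `R`). -/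
def AreLocalEquations {ι : Type*} (D : ι → Subalgebra ℂ K) (R : Subalgebra ℂ K) (f : ι → K) :
    Prop :=
  ∀ i, (R ≤ D i → IsLocalEquation (D i) R (f i)) ∧ (¬ R ≤ D i → f i = 1)

/-! ## Differential forms -/

/-- The rational `2`-form `du ∧ dv`. -/
def wedge (u v : K) : ExteriorAlgebra K (Ω[K⁄ℂ]) :=
  ExteriorAlgebra.ι K (KaehlerDifferential.D ℂ K u) *
    ExteriorAlgebra.ι K (KaehlerDifferential.D ℂ K v)

/-- The divisor of the rational `2`-form `dx ∧ dy` on the surface `S` is `- ∑ m i • D i`: near every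
point, `dx ∧ dy` is `(∏ f i ^ m i)⁻¹ du ∧ dv` up to a unit, for local coordinates `u, v`. So
`∑ m i • D i` is an anticanonical divisor of `S`. -/
def IsAnticanonical {ι : Type*} [Fintype ι] (S : Set (Subalgebra ℂ K))
    (D : ι → Subalgebra ℂ K) (m : ι → ℕ) : Prop :=
  ∀ R ∈ S, ∃ f : ι → K, AreLocalEquations D R f ∧ ∃ u v : K, IsCoordinates R u v ∧
    ∃ w : K, w ≠ 0 ∧ w ∈ R ∧ w⁻¹ ∈ R ∧ (∏ i, f i ^ m i) • wedge x y = w • wedge u v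

/-! ## Surfaces of type `E₆⁽¹⁾` -/

/-- The affine Dynkin diagram `E₆⁽¹⁾`: three arms `1 - 2`, `3 - 4`, `5 - 6` attached to the centre
`0` through `1`, `3`, `5`. -/
def affineE6 : SimpleGraph (Fin 7) :=
  SimpleGraph.fromEdgeSet {s(0, 1), s(1, 2), s(0, 3), s(3, 4), s(0, 5), s(5, 6)}

/-- The coefficients of the null root of `E₆⁽¹⁾`. -/
def affineE6Mult : Fin 7 → ℕ := ![3, 2, 1, 2, 1, 2, 1]

/-- The surface `S` with the curves `D 0, …, D 6` is of type `E₆⁽¹⁾`: these are smooth rational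
curves of self-intersection `-2`, meeting according to the diagram `E₆⁽¹⁾`, and the anticanonical
divisor of `S` given by the poles of `dx ∧ dy` is the null root combination of them. -/
structure IsTypeE6 (S : Set (Subalgebra ℂ K)) (D : Fin 7 → Subalgebra ℂ K) : Prop where
  smooth_rational : ∀ i, IsSmoothRationalCurve S (D i)
  self_intersection : ∀ i, HasSelfIntersection S (D i) (-2)
  meet : ∀ i j, affineE6.Adj i j → MeetOnceTransversally S (D i) (D j)
  disjoint : ∀ i j, i ≠ j → ¬ affineE6.Adj i j → ∀ R ∈ S, ¬ (R ≤ D i ∧ R ≤ D j)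
  anticanonical : IsAnticanonical S D affineE6Mult

/-! ## Vector fields -/

/-- The vector field `δ` is holomorphic at the point `R`. -/
def IsRegularAt (δ : Derivation ℂ K K) (R : Subalgebra ℂ K) : Prop := ∀ r ∈ R, δ r ∈ R

/-- `δ ∈ H⁰(S, Θ(-log D)(D))` for the reduced divisor `D = ∑ D i`: at every point, with
`h = ∏ f i` a local equation of `D`, the vector field `h δ` is holomorphic and preserves the
ideals of the components of `D`. -/
def HasLogPoles {ι : Type*} [Fintype ι] (δ : Derivation ℂ K K) (S : Set (Subalgebra ℂ K))
    (D : ι → Subalgebra ℂ K) : Prop :=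
  ∀ R ∈ S, ∃ f : ι → K, AreLocalEquations D R f ∧
    (∀ r ∈ R, (∏ i, f i) * δ r ∈ R) ∧
    ∀ i, R ≤ D i → ∃ s ∈ R, (∏ i, f i) * δ (f i) = s * f i

/-- The smooth point `R` of the divisor `∑ D i` of `S` is an accessible singularity of `δ`: in local
coordinates `x₁, x₂` at `R` such that `x₁ = 0` is the divisor, `x₂' = g₂ / x₁` with `g₂(R) = 0`. -/
def IsAccessible {ι : Type*} (δ : Derivation ℂ K K) (S : Set (Subalgebra ℂ K))
    (D : ι → Subalgebra ℂ K) (R : Subalgebra ℂ K) : Prop :=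
  R ∈ S ∧ ∃ i, R ≤ D i ∧ (∀ j, R ≤ D j → j = i) ∧
    ∃ x₁ x₂ : K, IsLocalEquation (D i) R x₁ ∧ IsCoordinates R x₁ x₂ ∧
      x₁ * δ x₂ ∈ maxIdeal R

/-! ## The Ince-XXIII system; throughout `c` stands for `√(-β)` -/

/-- `(X, Y)` solves `x' = x y + √(-β)`, `y' = (3/2) x² - (1/2) y² + α/2` at the time `t`. -/
def SolvesAt (α c : ℂ) (X Y : ℂ → ℂ) (t : ℂ) : Prop :=
  HasDerivAt X (X t * Y t + c) t ∧
    HasDerivAt Y (3 / 2 * X t ^ 2 - 1 / 2 * Y t ^ 2 + α / 2) t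

/-- The Hamiltonian. -/
def hamiltonian (α c : ℂ) : K :=
  1 / 2 * x * y ^ 2 - 1 / 2 * x ^ 3 - algebraMap ℂ K (α / 2) * x + algebraMap ℂ K c * y

/-- The vector field of the system on the surface. -/
def IsInceField (α c : ℂ) (δ : Derivation ℂ K K) : Prop :=
  δ x = x * y + algebraMap ℂ K c ∧
    δ y = 3 / 2 * x ^ 2 - 1 / 2 * y ^ 2 + algebraMap ℂ K (α / 2)

/-- The formulas `(x_j, y_j)`, `j = 0, 1, 2, 3`, for the four charts. They are used with `F = K`
(rational functions) and with `F = ℂ` (values). -/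
def chartMap {F : Type} [Field F] (α c X Y : F) : Fin 4 → F × F :=
  ![(X, Y),
    (1 / X, -((Y - X) * X - (α - 2 * c) / 2) * X),
    (1 / X, -((Y + X) * X + (α + 2 * c) / 2) * X),
    (-(X * Y + 2 * c) * Y, 1 / Y)]

/-- The denominators in the formulas for the four charts. -/
def chartDenom {F : Type} [Field F] (X Y : F) : Fin 4 → F := ![1, X, X, Y]

/-- The coordinate functions `(x_j, y_j)` of the four charts. -/
def chart (α c : ℂ) (j : Fin 4) : K × K :=
  chartMap (algebraMap ℂ K α) (algebraMap ℂ K c) x y j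

/-- The surface glued from the four copies of `ℂ²` with coordinates `(x_j, y_j)`. -/
def phaseSpace (α c : ℂ) : Set (Subalgebra ℂ K) :=
  ⋃ j, affinePlane (chart α c j).1 (chart α c j).2

/-- The nine points to be blown up, starting from the points `y = x`, `y = -x` and `x = 0` of the
line at infinity. -/
def centres (α c : ℂ) : List (Subalgebra ℂ K) :=
  [planePoint (1 / x) (y / x) 0 1,
   planePoint (1 / x) (y - x) 0 0,
   planePoint (1 / x) ((y - x) * x) 0 ((α - 2 * c) / 2),
   planePoint (1 / x) (y / x) 0 (-1),
   planePoint (1 / x) (y + x) 0 0,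
   planePoint (1 / x) ((y + x) * x) 0 (-((α + 2 * c) / 2)),
   planePoint (1 / y) (x / y) 0 0,
   planePoint (1 / y) x 0 0,
   planePoint (1 / y) (x * y) 0 (-(2 * c))]

/-- The rational surface obtained by the nine blow-ups. -/
def surface (α c : ℂ) : Set (Subalgebra ℂ K) := blowUps projectivePlane (centres α c)

/-- The line at infinity, and the exceptional curves of the first and second blow-ups over each of
the three points (more precisely, their strict transforms). -/
def boundary : Fin 7 → Subalgebra ℂ K :=
  ![planeCurve (1 / x) (y / x),
    planeCurve (1 / x) (y - x), planeCurve (1 / x) ((y - x) * x),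
    planeCurve (1 / x) (y + x), planeCurve (1 / x) ((y + x) * x),
    planeCurve (1 / y) x, planeCurve (1 / y) (x * y)]

/-! ## The transformations `s₀`, `s₁`, `s₂` -/

/-- The action on `(x, y)`. -/
def symMap {F : Type} [Field F] (α c X Y : F) : Fin 3 → F × F :=
  ![(X - ((α - 2 * c) / 2) / (Y - X), Y - ((α - 2 * c) / 2) / (Y - X)),
    (X + ((α + 2 * c) / 2) / (Y + X), Y - ((α + 2 * c) / 2) / (Y + X)),
    (X, Y + 2 * c / X)]

/-- The denominators of the action on `(x, y)`. -/
def symDenom {F : Type} [Field F] (X Y : F) : Fin 3 → F := ![Y - X, Y + X, X]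

/-- The action on `α`. -/
def symAlpha (α c : ℂ) : Fin 3 → ℂ := ![(-α + 6 * c) / 2, (-α - 6 * c) / 2, α]

/-- The action on `β`. -/
def symBeta (α β c : ℂ) : Fin 3 → ℂ :=
  ![(-α ^ 2 - 4 * α * c + 4 * β) / 16, (-α ^ 2 + 4 * α * c + 4 * β) / 16, β]

/-- The value of `√(-β)` belonging to the transformed parameters. -/
def symRoot (α c : ℂ) : Fin 3 → ℂ := ![(α + 2 * c) / 4, (-α + 2 * c) / 4, -c]

end Ince

end

open Topology Filter

noncomputable section

namespace Ince

-- Everything is computed with pairs of generators of `K` (`IsChart`). Such a pair gives the local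
-- rings of points and lines together with their residue maps (`exists_residue`). A point dominates
-- `planePoint u v a b` as soon as `u`, `v` take the values `a`, `b` there
-- (`IsPoint.planePoint_le`). A line is recognised in another chart by one function vanishing on it
-- and one that is nonconstant on it (`IsChart.planeCurve_le`). The abstract blow-up thereby becomes
-- the classical pair of charts: by `IsChart.mem_blowUp`, the new points are the origin of `(u / v,
-- v)` and the origins of `(u, v / u - m)`, one for each slope `m`.
--
-- With `u = 1/x`, `V = y/x` the field is `δ u = -V - c u²`, `u δ V = (3/2)(1 - V²) + (α/2) u² - c
-- u² V`. On the line at infinity `u δ V` vanishes only at `V = ±1`, and the chart `(1/y, x/y)` adds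
-- the point `x = 0`. At each of these three points, with `v` centred there, `δ u = e + ...` and `u
-- δ v = 3 e v - e κ u² + ...` with `e ≠ 0` (`exists_isArm`). Each division of `v` by `u` lowers the
-- coefficient `3 e` by `e`. After two divisions `w = v / u²` satisfies `u δ w = e (w - κ) + O(u²)`,
-- and its only zero on `u = 0` is the third centre. After the third division the polar part is
-- gone; this works because there is no term of order `u`. In parallel `u³ dx ∧ dy = const · du ∧
-- dv` loses one power of `u` at each step, which yields the multiplicities `3, 2, 1` and finally
-- `0`.
--
-- Consequently each point of the surface lies on no boundary curve, on one, or on two that cross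
-- normally, with explicit normal forms of the field and of the form (`IsInceField.stratification`).
-- The canonical divisor, the logarithmic poles, the absence of accessible singularities and the
-- locus of regularity are read off from these normal forms. The self-intersections come from a
-- single function on each curve: a local equation except at two points, where it is the product of
-- two local coordinates, so the conormal degree is `2`. The charts with `j ≥ 1` are, up to sign and
-- order, the coordinates `(u, (w - κ) / u)` of the third blow-ups, so gluing them adds to the
-- affine plane exactly the last exceptional curves minus one point each.
--
-- A polar solution has a simple pole with leading coefficients `(-1, -1)`, `(1, -1)` or `(0, 2)`,
-- one for each arm. A linear equation with a regular singular point then forces the next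
-- coefficients, so that the chart functions of that arm have removable singularities
-- (`exists_chart_of_meromorphic`). The symmetries are direct substitutions.

local notation "cst" => algebraMap ℂ K

/-! ## Coordinate systems -/

/-- `(u, v)` is a pair of generators of the field `K = ℂ(x, y)`. -/
def IsChart (u v : K) : Prop := IntermediateField.adjoin ℂ {u, v} = ⊤

theorem isChart_xy : IsChart x y := by
  rw [IsChart, eq_top_iff]
  intro f _
  obtain ⟨p, q, _, rfl⟩ := IsFractionRing.div_surjective (A := MvPolynomial (Fin 2) ℂ) f
  have key : ∀ p : MvPolynomial (Fin 2) ℂ,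
      algebraMap (MvPolynomial (Fin 2) ℂ) K p ∈ IntermediateField.adjoin ℂ {x, y} := by
    intro p
    induction p using MvPolynomial.induction_on with
    | C a =>
      rw [← MvPolynomial.algebraMap_eq, ← IsScalarTower.algebraMap_apply]
      exact IntermediateField.algebraMap_mem _ a
    | add p q hp hq => rw [map_add]; exact add_mem hp hq
    | mul_X p i hp =>
      rw [map_mul]
      refine mul_mem hp ?_
      fin_cases i
      · exact IntermediateField.subset_adjoin ℂ {x, y} (Set.mem_insert x _)
      · exact IntermediateField.subset_adjoin ℂ {x, y} (Set.mem_insert_of_mem x rfl)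
  exact div_mem (key p) (key q)

theorem IsChart.of_mem {u v u' v' : K} (h : IsChart u v)
    (hu : u ∈ IntermediateField.adjoin ℂ {u', v'})
    (hv : v ∈ IntermediateField.adjoin ℂ {u', v'}) : IsChart u' v' := by
  rw [IsChart, eq_top_iff, ← h, IntermediateField.adjoin_le_iff]
  rintro f (rfl | rfl)
  · exact hu
  · exact hv

theorem mem_adjoin_left (u v : K) : u ∈ IntermediateField.adjoin ℂ {u, v} :=
  IntermediateField.subset_adjoin ℂ {u, v} (Set.mem_insert u _)

theorem mem_adjoin_right (u v : K) : v ∈ IntermediateField.adjoin ℂ {u, v} :=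
  IntermediateField.subset_adjoin ℂ {u, v} (Set.mem_insert_of_mem u rfl)

theorem IsChart.swap {u v : K} (h : IsChart u v) : IsChart v u :=
  h.of_mem (mem_adjoin_right v u) (mem_adjoin_left v u)

/-- `K` is algebraic over `ℂ[u, v]`, and its transcendence degree is at least two because the
variables are independent. Two elements over which `K` is algebraic must then form a transcendence
basis. -/
theorem IsChart.algebraicIndependent {u v : K} (h : IsChart u v) :
    AlgebraicIndependent ℂ ![u, v] := by
  have hr : Set.range ![u, v] = {u, v} := by simp [Matrix.range_cons, Set.pair_comm]
  have : Algebra.IsAlgebraic (Algebra.adjoin ℂ (Set.range ![u, v])) K := by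
    rw [hr]
    refine ⟨fun f => ?_⟩
    have hf : f ∈ IntermediateField.adjoin ℂ {u, v} := by rw [h]; trivial
    rw [IntermediateField.mem_adjoin_iff_div] at hf
    obtain ⟨a, ha, b, hb, rfl⟩ := hf
    have hA : IsAlgebraic (Algebra.adjoin ℂ {u, v}) a :=
      isAlgebraic_algebraMap (⟨a, ha⟩ : Algebra.adjoin ℂ {u, v})
    have hB : IsAlgebraic (Algebra.adjoin ℂ {u, v}) b :=
      isAlgebraic_algebraMap (⟨b, hb⟩ : Algebra.adjoin ℂ {u, v})
    rw [div_eq_mul_inv]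
    exact hA.mul hB.inv
  have hX : AlgebraicIndependent ℂ (fun i : Fin 2 => algebraMap (MvPolynomial (Fin 2) ℂ) K
      (MvPolynomial.X i)) := by
    have h0 := MvPolynomial.algebraicIndependent_X (Fin 2) ℂ
    exact h0.map' (f := IsScalarTower.toAlgHom ℂ (MvPolynomial (Fin 2) ℂ) K)
      (IsFractionRing.injective (MvPolynomial (Fin 2) ℂ) K)
  exact (Algebra.IsAlgebraic.isTranscendenceBasis_of_lift_le_trdeg_of_finite ℂ ![u, v]
    (by simpa using hX.lift_cardinalMk_le_trdeg)).1

theorem IsChart.injective {u v : K} (h : IsChart u v) :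
    Function.Injective (MvPolynomial.aeval ![u, v] : MvPolynomial (Fin 2) ℂ →ₐ[ℂ] K) :=
  h.algebraicIndependent

theorem IsChart.left_ne_zero {u v : K} (h : IsChart u v) : u ≠ 0 :=
  h.algebraicIndependent.ne_zero 0

theorem IsChart.right_ne_zero {u v : K} (h : IsChart u v) : v ≠ 0 :=
  h.algebraicIndependent.ne_zero 1

theorem IsChart.div_left {u v : K} (h : IsChart u v) : IsChart u (v / u) :=
  h.of_mem (mem_adjoin_left _ _) (by
    have := mul_mem (mem_adjoin_left u (v / u)) (mem_adjoin_right u (v / u))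
    rwa [mul_div_cancel₀ _ h.left_ne_zero] at this)

theorem IsChart.sub_const {u v : K} (h : IsChart u v) (m : ℂ) :
    IsChart u (v - algebraMap ℂ K m) :=
  h.of_mem (mem_adjoin_left _ _) (by
    have := add_mem (mem_adjoin_right u (v - algebraMap ℂ K m))
      (IntermediateField.algebraMap_mem (IntermediateField.adjoin ℂ {u, v - algebraMap ℂ K m}) m)
    rwa [sub_add_cancel] at this)

theorem IsChart.div_right {u v : K} (h : IsChart u v) : IsChart (u / v) v :=
  h.swap.div_left.swap

theorem IsChart.inv_left {u v : K} (h : IsChart u v) : IsChart (1 / u) v :=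
  h.of_mem (by
    have := inv_mem (mem_adjoin_left (1 / u) v)
    rwa [one_div, inv_inv, ← one_div] at this) (mem_adjoin_right _ _)

theorem IsChart.neg_right {u v : K} (h : IsChart u v) : IsChart u (-v) :=
  h.of_mem (mem_adjoin_left _ _) (by
    have := neg_mem (mem_adjoin_right u (-v))
    rwa [neg_neg] at this)

/-! ## Residue maps of local rings -/

/-- The ring of fractions `ι p / ι q` with `φ q ≠ 0` has a residue map induced by `φ`. -/
theorem exists_residue {A F : Type*} [CommRing A] [Algebra ℂ A] [Field F] [Algebra ℂ F]
    (ι : A →ₐ[ℂ] K) (hι : Function.Injective ι) (φ : A →ₐ[ℂ] F) (R : Subalgebra ℂ K)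
    (hR : ∀ f, f ∈ R ↔ ∃ p q : A, φ q ≠ 0 ∧ f * ι q = ι p) :
    ∃ ψ : R →ₐ[ℂ] F, (∀ (f : R) (p q : A), φ q ≠ 0 → (f : K) * ι q = ι p → ψ f * φ q = φ p) ∧
      ∀ f : R, ψ f ≠ 0 → (f : K)⁻¹ ∈ R := by
  choose p q hq hpq using fun f : R => (hR f).1 f.2
  -- Independence of the chosen fraction: the cross-multiplied identity holds in `K`, is pulled back
  -- to `A` by injectivity of `ι`, and is then mapped by `φ`.
  have spec : ∀ (f : R) (p' q' : A), φ q' ≠ 0 → (f : K) * ι q' = ι p' →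
      φ (p f) / φ (q f) * φ q' = φ p' := by
    intro f p' q' hq' h
    have e : p f * q' = p' * q f := hι (by rw [map_mul, map_mul, ← hpq, ← h]; ring)
    have e' : φ (p f) * φ q' = φ p' * φ (q f) := by rw [← map_mul, e, map_mul]
    rw [div_mul_eq_mul_div, e', mul_div_cancel_right₀ _ (hq f)]
  have spec' : ∀ (f : R) (p' q' : A), φ q' ≠ 0 → (f : K) * ι q' = ι p' →
      φ (p f) / φ (q f) = φ p' / φ q' := fun f p' q' hq' h => by
    rw [eq_div_iff hq', spec f p' q' hq' h]
  refine ⟨⟨⟨⟨⟨fun f => φ (p f) / φ (q f), ?_⟩, ?_⟩, ?_, ?_⟩, ?_⟩, spec, ?_⟩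
  · rw [spec' 1 1 1 (by simp) (by simp)]; simp
  · intro f g
    change φ (p (f * g)) / φ (q (f * g)) = φ (p f) / φ (q f) * (φ (p g) / φ (q g))
    rw [spec' (f * g) (p f * p g) (q f * q g) (by simpa using ⟨hq f, hq g⟩)
      (by push_cast; rw [map_mul, map_mul, ← hpq, ← hpq]; ring), map_mul, map_mul]
    exact (div_mul_div_comm _ _ _ _).symm
  · change φ (p 0) / φ (q 0) = 0
    rw [spec' 0 0 1 (by simp) (by simp)]; simp
  · intro f g
    change φ (p (f + g)) / φ (q (f + g)) = φ (p f) / φ (q f) + φ (p g) / φ (q g)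
    rw [spec' (f + g) (p f * q g + q f * p g) (q f * q g) (by simpa using ⟨hq f, hq g⟩)
      (by push_cast; rw [map_mul, map_add, map_mul, map_mul, ← hpq, ← hpq]; ring), map_mul,
      map_add, map_mul, map_mul, div_add_div _ _ (hq f) (hq g)]
  · intro r
    change φ (p _) / φ (q _) = _
    rw [spec' (algebraMap ℂ R r) (algebraMap ℂ A r) 1 (by simp) (by simp)]; simp
  · intro f hf
    have hf : φ (p f) / φ (q f) ≠ 0 := hf
    rw [hR]
    refine ⟨q f, p f, fun h => hf (by rw [h, zero_div]), ?_⟩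
    rw [← hpq, ← mul_assoc, inv_mul_cancel₀, one_mul]
    intro h0
    apply hf
    have := hpq f
    rw [h0, zero_mul] at this
    rw [hι (a₁ := p f) (a₂ := 0) (by rw [← this, map_zero]), map_zero, zero_div]

/-- `R` has a residue map to `ℂ`, and elements of non-zero residue are invertible. -/
def IsPoint (R : Subalgebra ℂ K) : Prop :=
  ∃ ψ : R →ₐ[ℂ] ℂ, ∀ f : R, ψ f ≠ 0 → (f : K)⁻¹ ∈ R

theorem mem_maxIdeal_iff {R : Subalgebra ℂ K} {F : Type*} [Field F] [Algebra ℂ F]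
    {ψ : R →ₐ[ℂ] F} (hψ : ∀ f : R, ψ f ≠ 0 → (f : K)⁻¹ ∈ R) (f : R) :
    (f : K) ∈ maxIdeal R ↔ ψ f = 0 := by
  constructor
  · rintro ⟨-, h | h⟩
    · rw [show f = 0 from Subtype.ext h, map_zero]
    · by_contra h'
      exact h (hψ f h')
  · intro h
    refine ⟨f.2, or_iff_not_imp_left.2 fun h0 hi => ?_⟩
    have : ψ (f * ⟨_, hi⟩) = 1 := by
      rw [show f * ⟨_, hi⟩ = 1 from Subtype.ext (mul_inv_cancel₀ h0), map_one]
    rw [map_mul, h, zero_mul] at this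
    exact zero_ne_one this

/-- If `χ` gave `f` a value different from its residue, `f` minus that value would be a unit of `R`,
hence of `T`, yet be killed by `χ`. Hence values do not change when passing to a larger local ring.
-/
theorem residue_le {R T : Subalgebra ℂ K} (h : R ≤ T) {ψ : R →ₐ[ℂ] ℂ}
    (hψ : ∀ f : R, ψ f ≠ 0 → (f : K)⁻¹ ∈ R) (χ : T →ₐ[ℂ] ℂ) (f : R) :
    χ ⟨f, h f.2⟩ = ψ f := by
  by_contra hne
  set z := χ ⟨f, h f.2⟩
  have h1 : ψ (f - algebraMap ℂ R z) ≠ 0 := by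
    rw [map_sub, AlgHom.commutes, sub_ne_zero]
    exact fun e => hne e.symm
  have h2 := hψ _ h1
  have h0 : (f : K) - algebraMap ℂ K z ≠ 0 := by
    intro h0
    apply h1
    rw [show f - algebraMap ℂ R z = 0 from Subtype.ext h0, map_zero]
  have h3 : χ (⟨_, h (f - algebraMap ℂ R z).2⟩ * ⟨_, h h2⟩) = 1 := by
    rw [← map_one χ]
    congr 1
    exact Subtype.ext (mul_inv_cancel₀ h0)
  have h4 : χ ⟨_, h (f - algebraMap ℂ R z).2⟩ = 0 := by
    have : (⟨_, h (f - algebraMap ℂ R z).2⟩ : T) = ⟨f, h f.2⟩ - algebraMap ℂ T z :=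
      Subtype.ext rfl
    rw [this, map_sub, AlgHom.commutes, sub_eq_zero]
    rfl
  rw [map_mul, h4, zero_mul] at h3
  exact zero_ne_one h3

/-! ## Values of functions at points -/

/-- The function `f` is regular at `R` with value `z`. -/
def HasVal (R : Subalgebra ℂ K) (f : K) (z : ℂ) : Prop := f - algebraMap ℂ K z ∈ maxIdeal R

theorem hasVal_zero {R : Subalgebra ℂ K} {f : K} : HasVal R f 0 ↔ f ∈ maxIdeal R := by
  simp [HasVal]

theorem hasVal_iff {R : Subalgebra ℂ K} {ψ : R →ₐ[ℂ] ℂ}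
    (hψ : ∀ f : R, ψ f ≠ 0 → (f : K)⁻¹ ∈ R) {f : K} {z : ℂ} :
    HasVal R f z ↔ ∃ h : f ∈ R, ψ ⟨f, h⟩ = z := by
  constructor
  · intro h
    have hf : f ∈ R := by
      have := add_mem h.1 (R.algebraMap_mem z)
      rwa [sub_add_cancel] at this
    refine ⟨hf, ?_⟩
    have := (mem_maxIdeal_iff hψ ((⟨f, hf⟩ : R) - algebraMap ℂ R z)).1 h
    rwa [map_sub, AlgHom.commutes, sub_eq_zero] at this
  · rintro ⟨h, rfl⟩
    refine (mem_maxIdeal_iff hψ ((⟨f, h⟩ : R) - algebraMap ℂ R (ψ ⟨f, h⟩))).2 ?_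
    rw [map_sub, AlgHom.commutes, sub_eq_zero]
    rfl

theorem HasVal.mem {R : Subalgebra ℂ K} {f : K} {z : ℂ} (h : HasVal R f z) : f ∈ R := by
  have := add_mem h.1 (R.algebraMap_mem z)
  rwa [sub_add_cancel] at this

theorem IsPoint.hasVal {R : Subalgebra ℂ K} (hR : IsPoint R) {f : K} (hf : f ∈ R) :
    ∃ z, HasVal R f z := by
  obtain ⟨ψ, hψ⟩ := hR
  exact ⟨_, (hasVal_iff hψ).2 ⟨hf, rfl⟩⟩

theorem HasVal.congr {R : Subalgebra ℂ K} {f g : K} {z w : ℂ} (h : HasVal R f z) (hf : g = f)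
    (hz : z = w) : HasVal R g w := hf ▸ hz ▸ h

section HasVal

variable {R : Subalgebra ℂ K} {f g : K} {z w : ℂ}

theorem IsPoint.const (hR : IsPoint R) (z : ℂ) : HasVal R (algebraMap ℂ K z) z := by
  obtain ⟨ψ, hψ⟩ := hR
  exact (hasVal_iff hψ).2 ⟨R.algebraMap_mem z, ψ.commutes z⟩

theorem IsPoint.one (hR : IsPoint R) : HasVal R 1 1 := by
  simpa using hR.const 1

theorem IsPoint.add (hR : IsPoint R) (hf : HasVal R f z) (hg : HasVal R g w) :
    HasVal R (f + g) (z + w) := by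
  obtain ⟨ψ, hψ⟩ := hR
  rw [hasVal_iff hψ] at *
  obtain ⟨h, rfl⟩ := hf
  obtain ⟨h', rfl⟩ := hg
  exact ⟨add_mem h h', map_add ψ ⟨f, h⟩ ⟨g, h'⟩⟩

theorem IsPoint.mul (hR : IsPoint R) (hf : HasVal R f z) (hg : HasVal R g w) :
    HasVal R (f * g) (z * w) := by
  obtain ⟨ψ, hψ⟩ := hR
  rw [hasVal_iff hψ] at *
  obtain ⟨h, rfl⟩ := hf
  obtain ⟨h', rfl⟩ := hg
  exact ⟨mul_mem h h', map_mul ψ ⟨f, h⟩ ⟨g, h'⟩⟩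

theorem IsPoint.neg (hR : IsPoint R) (hf : HasVal R f z) : HasVal R (-f) (-z) :=
  (hR.mul (hR.const (-1)) hf).congr (by simp) (by simp)

theorem IsPoint.sub (hR : IsPoint R) (hf : HasVal R f z) (hg : HasVal R g w) :
    HasVal R (f - g) (z - w) :=
  (hR.add hf (hR.neg hg)).congr (sub_eq_add_neg _ _) (sub_eq_add_neg _ _).symm

theorem IsPoint.inv (hR : IsPoint R) (hf : HasVal R f z) (hz : z ≠ 0) : HasVal R f⁻¹ z⁻¹ := by
  obtain ⟨ψ, hψ⟩ := hR
  rw [hasVal_iff hψ] at *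
  obtain ⟨h, rfl⟩ := hf
  have hi := hψ _ hz
  have hf0 : f ≠ 0 := by
    rintro rfl
    exact hz (map_zero ψ)
  refine ⟨hi, eq_inv_of_mul_eq_one_left ?_⟩
  rw [← map_mul, ← map_one ψ]
  congr 1
  exact Subtype.ext (inv_mul_cancel₀ hf0)

theorem IsPoint.div (hR : IsPoint R) (hf : HasVal R f z) (hg : HasVal R g w) (hw : w ≠ 0) :
    HasVal R (f / g) (z / w) :=
  (hR.mul hf (hR.inv hg hw)).congr (div_eq_mul_inv _ _) (div_eq_mul_inv _ _).symm

theorem IsPoint.unique (hR : IsPoint R) (hf : HasVal R f z) (hf' : HasVal R f w) : z = w := by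
  obtain ⟨ψ, hψ⟩ := hR
  rw [hasVal_iff hψ] at *
  obtain ⟨h, rfl⟩ := hf
  obtain ⟨h', rfl⟩ := hf'
  rfl

theorem IsPoint.aeval (hR : IsPoint R) {u v : K} {a b : ℂ} (hu : HasVal R u a) (hv : HasVal R v b)
    (p : MvPolynomial (Fin 2) ℂ) :
    HasVal R (MvPolynomial.aeval ![u, v] p) (MvPolynomial.eval ![a, b] p) := by
  induction p using MvPolynomial.induction_on with
  | C r => simpa using hR.const r
  | add p q hp hq => simpa using hR.add hp hq
  | mul_X p i hp =>
    rw [map_mul, map_mul]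
    refine hR.mul hp ?_
    fin_cases i <;> simpa

/-- A point dominates the local ring of the values of a pair of functions. -/
theorem IsPoint.planePoint_le (hR : IsPoint R) {u v : K} {a b : ℂ} (hu : HasVal R u a)
    (hv : HasVal R v b) : planePoint u v a b ≤ R := by
  rintro f ⟨p, q, hq, h⟩
  have hq' := hR.aeval hu hv q
  have h0 : MvPolynomial.aeval ![u, v] q ≠ 0 := by
    intro h0
    rw [h0] at hq'
    exact hq (hR.unique hq' ((hR.const 0).congr (by simp) rfl))
  rw [eq_div_of_mul_eq h0 h]
  exact (hR.div (hR.aeval hu hv p) hq' hq).mem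

end HasVal

theorem mul_mem_maxIdeal {R : Subalgebra ℂ K} {f g : K} (hf : f ∈ maxIdeal R) (hg : g ∈ R) :
    f * g ∈ maxIdeal R := by
  refine ⟨mul_mem hf.1 hg, or_iff_not_imp_left.2 fun h0 hi => ?_⟩
  obtain ⟨hf0, hg0⟩ := mul_ne_zero_iff.1 h0
  rcases hf.2 with h | h
  · exact hf0 h
  · apply h
    have := mul_mem hi hg
    rwa [mul_inv, mul_assoc, inv_mul_cancel₀ hg0, mul_one] at this

theorem not_le_of_mem_maxIdeal {R T : Subalgebra ℂ K} {f : K} (h0 : f ≠ 0) (h : f⁻¹ ∈ R)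
    (hT : f ∈ maxIdeal T) : ¬ R ≤ T := fun hle => hT.2.elim h0 fun hi => hi (hle h)

/-! ## Points and curves in a plane -/

section Plane

variable {u v : K}

theorem IsChart.exists_point_residue (h : IsChart u v) (a b : ℂ) : ∃ ψ : planePoint u v a b →ₐ[ℂ] ℂ,
    (∀ (f : planePoint u v a b) (p q : MvPolynomial (Fin 2) ℂ), MvPolynomial.eval ![a, b] q ≠ 0 →
      (f : K) * MvPolynomial.aeval ![u, v] q = MvPolynomial.aeval ![u, v] p →
      ψ f * MvPolynomial.eval ![a, b] q = MvPolynomial.eval ![a, b] p) ∧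
    ∀ f : planePoint u v a b, ψ f ≠ 0 → (f : K)⁻¹ ∈ planePoint u v a b := by
  have e : ∀ p : MvPolynomial (Fin 2) ℂ,
      MvPolynomial.aeval ![a, b] p = MvPolynomial.eval ![a, b] p := fun p => by
    rw [MvPolynomial.aeval_def, MvPolynomial.eval₂_eq_eval_map]; simp
  have := exists_residue (MvPolynomial.aeval ![u, v]) h.injective
    (MvPolynomial.aeval ![a, b]) (planePoint u v a b) (by simp only [e]; exact fun f => Iff.rfl)
  simpa only [e] using this

theorem IsChart.isPoint (h : IsChart u v) (a b : ℂ) : IsPoint (planePoint u v a b) :=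
  let ⟨ψ, _, hψ⟩ := h.exists_point_residue a b
  ⟨ψ, hψ⟩

theorem IsChart.hasVal_left (h : IsChart u v) (a b : ℂ) : HasVal (planePoint u v a b) u a := by
  obtain ⟨ψ, h1, h2⟩ := h.exists_point_residue a b
  have hm : u ∈ planePoint u v a b := ⟨.X 0, 1, by simp, by simp⟩
  exact (hasVal_iff h2).2 ⟨hm, by simpa using h1 ⟨u, hm⟩ (.X 0) 1 (by simp) (by simp)⟩

theorem IsChart.hasVal_right (h : IsChart u v) (a b : ℂ) : HasVal (planePoint u v a b) v b := by
  obtain ⟨ψ, h1, h2⟩ := h.exists_point_residue a b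
  have hm : v ∈ planePoint u v a b := ⟨.X 1, 1, by simp, by simp⟩
  exact (hasVal_iff h2).2 ⟨hm, by simpa using h1 ⟨v, hm⟩ (.X 1) 1 (by simp) (by simp)⟩

/-- The values give domination in both directions. This is the tool for moving a point from one
coordinate system to another. -/
theorem IsChart.planePoint_eq (h : IsChart u v) {u' v' : K} (h' : IsChart u' v') {a b a' b' : ℂ}
    (h1 : HasVal (planePoint u v a b) u' a') (h2 : HasVal (planePoint u v a b) v' b')
    (h3 : HasVal (planePoint u' v' a' b') u a) (h4 : HasVal (planePoint u' v' a' b') v b) :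
    planePoint u v a b = planePoint u' v' a' b' :=
  le_antisymm ((h'.isPoint a' b').planePoint_le h3 h4) ((h.isPoint a b).planePoint_le h1 h2)

theorem IsChart.planePoint_swap (h : IsChart u v) (a b : ℂ) :
    planePoint u v a b = planePoint v u b a :=
  h.planePoint_eq h.swap (h.hasVal_right a b) (h.hasVal_left a b) (h.swap.hasVal_right b a)
    (h.swap.hasVal_left b a)

theorem IsChart.planePoint_translate (h : IsChart u v) (a b m : ℂ) :
    planePoint u v a b = planePoint u (v - algebraMap ℂ K m) a (b - m) := by
  have h' := h.sub_const m
  have hp := h.isPoint a b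
  have hp' := h'.isPoint a (b - m)
  refine h.planePoint_eq h' (h.hasVal_left a b) (hp.sub (h.hasVal_right a b) (hp.const m))
    (h'.hasVal_left _ _) ?_
  exact (hp'.add (h'.hasVal_right _ _) (hp'.const m)).congr (by ring) (by ring)

theorem IsChart.planePoint_translate_zero (h : IsChart u v) (b : ℂ) :
    planePoint u v 0 b = planePoint u (v - algebraMap ℂ K b) 0 0 := by
  simpa using h.planePoint_translate 0 b b

end Plane

/-- Restriction of a polynomial in two variables to the line on which the first one vanishes. -/
def restrictToLine : MvPolynomial (Fin 2) ℂ →ₐ[ℂ] Polynomial ℂ :=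
  MvPolynomial.aeval ![0, Polynomial.X]

/-- Expansion to order zero in the first variable. It turns divisibility by `X 0` into vanishing on
the line, and, applied once more in one variable, shows that a polynomial vanishing at the origin
lies in `(X 0, X 1)`. -/
theorem exists_eq_X_mul_add (p : MvPolynomial (Fin 2) ℂ) :
    ∃ a, p = MvPolynomial.X 0 * a + Polynomial.aeval (MvPolynomial.X 1) (restrictToLine p) := by
  induction p using MvPolynomial.induction_on with
  | C r => exact ⟨0, by simp [restrictToLine, MvPolynomial.algebraMap_eq]⟩
  | add p q hp hq =>
    obtain ⟨a, ha⟩ := hp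
    obtain ⟨b, hb⟩ := hq
    refine ⟨a + b, ?_⟩
    rw [map_add, map_add]
    linear_combination ha + hb
  | mul_X p i hp =>
    obtain ⟨a, ha⟩ := hp
    fin_cases i
    · refine ⟨p, ?_⟩
      simp [restrictToLine, mul_comm]
    · refine ⟨a * MvPolynomial.X 1, ?_⟩
      have e : restrictToLine (MvPolynomial.X 1) = Polynomial.X := by simp [restrictToLine]
      simp only [Fin.mk_one, map_mul, e, Polynomial.aeval_X]
      linear_combination MvPolynomial.X 1 * ha

theorem X_dvd_iff_restrictToLine {p : MvPolynomial (Fin 2) ℂ} :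
    MvPolynomial.X 0 ∣ p ↔ restrictToLine p = 0 := by
  constructor
  · rintro ⟨a, rfl⟩
    simp [restrictToLine]
  · intro h
    obtain ⟨a, ha⟩ := exists_eq_X_mul_add p
    rw [h, map_zero, add_zero] at ha
    exact ⟨a, ha⟩

theorem exists_eq_of_eval_zero {p : MvPolynomial (Fin 2) ℂ}
    (h : MvPolynomial.eval ![0, 0] p = 0) :
    ∃ a b, p = MvPolynomial.X 0 * a + MvPolynomial.X 1 * b := by
  obtain ⟨a, ha⟩ := exists_eq_X_mul_add p
  have h0 : (restrictToLine p).coeff 0 = 0 := by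
    rw [← h, Polynomial.coeff_zero_eq_eval_zero, ← Polynomial.coe_evalRingHom,
      restrictToLine, ← AlgHom.coe_toRingHom, ← RingHom.comp_apply]
    congr 1
    ext i
    · simp
    · fin_cases i <;> simp
  obtain ⟨b, hb⟩ := Polynomial.X_dvd_iff.2 h0
  rw [hb, map_mul, Polynomial.aeval_X] at ha
  exact ⟨a, _, ha⟩

/-- The restriction of a polynomial in two variables to a line, as a rational function. -/
def restrictToRatFunc : MvPolynomial (Fin 2) ℂ →ₐ[ℂ] RatFunc ℂ :=
  (IsScalarTower.toAlgHom ℂ (Polynomial ℂ) (RatFunc ℂ)).comp restrictToLine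

theorem restrictToRatFunc_eq_zero {p : MvPolynomial (Fin 2) ℂ} :
    restrictToRatFunc p = 0 ↔ MvPolynomial.X 0 ∣ p := by
  rw [X_dvd_iff_restrictToLine, restrictToRatFunc, AlgHom.comp_apply,
    IsScalarTower.coe_toAlgHom', map_eq_zero_iff _ (RatFunc.algebraMap_injective ℂ)]

/-- Over an algebraically closed field the minimal polynomial of an algebraic element is linear, so
a nonconstant function on a curve is transcendental. -/
theorem transcendental_of_forall_ne {F : Type*} [Field F] [Algebra ℂ F] {g : F}
    (hg : ∀ r : ℂ, g ≠ algebraMap ℂ F r) : Transcendental ℂ g := by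
  intro h
  have := IsAlgClosed.degree_eq_one_of_irreducible ℂ (minpoly.irreducible h.isIntegral)
  obtain ⟨r, hr⟩ := minpoly.mem_range_of_degree_eq_one ℂ g this
  exact hg r hr.symm

/-! ## The generic local ring of a coordinate line -/

section Curve

variable {u v : K}

/-- The ring is the localisation of the polynomial ring at the prime `(X 0)`. Restriction to the
line therefore induces its residue map, with values in the rational functions of one variable. -/
theorem IsChart.exists_curve_residue (h : IsChart u v) :
    ∃ ψ : planeCurve u v →ₐ[ℂ] RatFunc ℂ,
    (∀ (f : planeCurve u v) (p q : MvPolynomial (Fin 2) ℂ), restrictToRatFunc q ≠ 0 →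
      (f : K) * MvPolynomial.aeval ![u, v] q = MvPolynomial.aeval ![u, v] p →
      ψ f * restrictToRatFunc q = restrictToRatFunc p) ∧
    ∀ f : planeCurve u v, ψ f ≠ 0 → (f : K)⁻¹ ∈ planeCurve u v :=
  exists_residue (MvPolynomial.aeval ![u, v]) h.injective restrictToRatFunc (planeCurve u v)
    (fun f => by simp only [ne_eq, restrictToRatFunc_eq_zero]; exact Iff.rfl)

theorem right_mem_planeCurve (u v : K) : v ∈ planeCurve u v :=
  ⟨.X 1, 1, fun h => (MvPolynomial.X_prime (i := (0 : Fin 2)) (R := ℂ)).not_isUnit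
    (isUnit_of_dvd_one h), by simp⟩

theorem left_mem_planeCurve (u v : K) : u ∈ planeCurve u v :=
  ⟨.X 0, 1, fun h => (MvPolynomial.X_prime (i := (0 : Fin 2)) (R := ℂ)).not_isUnit
    (isUnit_of_dvd_one h), by simp⟩

theorem IsChart.mem_maxIdeal_planeCurve (h : IsChart u v) {f : K} :
    f ∈ maxIdeal (planeCurve u v) ↔ ∃ a ∈ planeCurve u v, f = a * u := by
  obtain ⟨ψ, h1, h2⟩ := h.exists_curve_residue
  constructor
  · intro hf
    have h3 := (mem_maxIdeal_iff h2 ⟨f, hf.1⟩).1 hf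
    obtain ⟨p, q, hq, e⟩ := hf.1
    have h4 := h1 ⟨f, hf.1⟩ p q (mt restrictToRatFunc_eq_zero.1 hq) e
    rw [h3, zero_mul] at h4
    obtain ⟨a, rfl⟩ := restrictToRatFunc_eq_zero.1 h4.symm
    have h5 : MvPolynomial.aeval ![u, v] q ≠ 0 := fun h0 => hq (by
      rw [(map_eq_zero_iff _ h.injective).1 h0]; exact dvd_zero _)
    refine ⟨MvPolynomial.aeval ![u, v] a / MvPolynomial.aeval ![u, v] q,
      ⟨a, q, hq, div_mul_cancel₀ _ h5⟩, ?_⟩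
    rw [eq_comm, div_mul_eq_mul_div, div_eq_iff h5, e]
    simp [mul_comm]
  · rintro ⟨a, ha, rfl⟩
    rw [mul_comm]
    refine mul_mem_maxIdeal ((mem_maxIdeal_iff h2 ⟨u, left_mem_planeCurve u v⟩).2 ?_) ha
    simpa [restrictToRatFunc, restrictToLine] using
      h1 ⟨u, left_mem_planeCurve u v⟩ (.X 0) 1 (by simp) (by simp)

theorem IsChart.left_mem_maxIdeal (h : IsChart u v) : u ∈ maxIdeal (planeCurve u v) :=
  h.mem_maxIdeal_planeCurve.2 ⟨1, one_mem _, by simp⟩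

theorem IsChart.curve_residue_right {ψ : planeCurve u v →ₐ[ℂ] RatFunc ℂ}
    (hψ : ∀ (f : planeCurve u v) (p q : MvPolynomial (Fin 2) ℂ), restrictToRatFunc q ≠ 0 →
      (f : K) * MvPolynomial.aeval ![u, v] q = MvPolynomial.aeval ![u, v] p →
      ψ f * restrictToRatFunc q = restrictToRatFunc p) :
    ψ ⟨v, right_mem_planeCurve u v⟩ = RatFunc.X := by
  simpa [restrictToRatFunc, restrictToLine] using
    hψ ⟨v, right_mem_planeCurve u v⟩ (.X 1) 1 (by simp) (by simp)

theorem IsChart.sub_const_notMem_maxIdeal (h : IsChart u v) (r : ℂ) :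
    v - algebraMap ℂ K r ∉ maxIdeal (planeCurve u v) := by
  obtain ⟨ψ, h1, h2⟩ := h.exists_curve_residue
  intro hm
  have := (mem_maxIdeal_iff h2 ((⟨v, right_mem_planeCurve u v⟩ : planeCurve u v) -
    algebraMap ℂ _ r)).1 hm
  rw [map_sub, IsChart.curve_residue_right h1, AlgHom.commutes, sub_eq_zero,
    IsScalarTower.algebraMap_apply ℂ (Polynomial ℂ) (RatFunc ℂ), ← RatFunc.algebraMap_X] at this
  have := RatFunc.algebraMap_injective ℂ this
  rw [Polynomial.algebraMap_apply] at this
  exact Polynomial.X_ne_C _ this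

theorem inv_mem_of_notMem_maxIdeal {V : Subalgebra ℂ K} {f : K} (hf : f ∈ V)
    (h : f ∉ maxIdeal V) : f⁻¹ ∈ V := by
  by_contra hi
  exact h ⟨hf, Or.inr hi⟩

theorem IsChart.inv_sub_const_mem (h : IsChart u v) (r : ℂ) :
    (v - algebraMap ℂ K r)⁻¹ ∈ planeCurve u v :=
  inv_mem_of_notMem_maxIdeal
    (sub_mem (right_mem_planeCurve u v) ((planeCurve u v).algebraMap_mem r))
    (h.sub_const_notMem_maxIdeal r)

theorem IsChart.inv_right_mem (h : IsChart u v) : v⁻¹ ∈ planeCurve u v := by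
  simpa using h.inv_sub_const_mem 0

/-- A denominator `q(s, t)` restricts on the curve to `q(0, t)`. This is nonzero when `X 0 ∤ q`,
because a nonconstant `t` is transcendental on the curve. Hence the fractions admitted for `(s, t)`
are regular along the curve `u = 0`. -/
theorem IsChart.planeCurve_le (h : IsChart u v) {s t : K} (hs : s ∈ maxIdeal (planeCurve u v))
    (ht : t ∈ planeCurve u v)
    (ht' : ∀ r, t - algebraMap ℂ K r ∉ maxIdeal (planeCurve u v)) :
    planeCurve s t ≤ planeCurve u v := by
  obtain ⟨ψ, -, h2⟩ := h.exists_curve_residue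
  have hs0 : ψ ⟨s, hs.1⟩ = 0 := (mem_maxIdeal_iff h2 ⟨s, hs.1⟩).1 hs
  have htr : Transcendental ℂ (ψ ⟨t, ht⟩) := by
    refine transcendental_of_forall_ne fun r hr => ht' r ?_
    refine (mem_maxIdeal_iff h2 ((⟨t, ht⟩ : planeCurve u v) - algebraMap ℂ _ r)).2 ?_
    rw [map_sub, hr, AlgHom.commutes, sub_self]
  have e1 : ∀ p : MvPolynomial (Fin 2) ℂ, MvPolynomial.aeval ![s, t] p =
      ((MvPolynomial.aeval ![(⟨s, hs.1⟩ : planeCurve u v), ⟨t, ht⟩] p : planeCurve u v) : K) := by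
    intro p
    rw [← Subalgebra.coe_val, ← AlgHom.comp_apply]
    congr 1
    ext i
    fin_cases i <;> simp
  have e2 : ∀ p : MvPolynomial (Fin 2) ℂ,
      ψ (MvPolynomial.aeval ![(⟨s, hs.1⟩ : planeCurve u v), ⟨t, ht⟩] p) =
        Polynomial.aeval (ψ ⟨t, ht⟩) (restrictToLine p) := by
    intro p
    rw [restrictToLine, ← AlgHom.comp_apply, ← AlgHom.comp_apply]
    congr 1
    ext i
    fin_cases i <;> simp [hs0]
  rintro f ⟨p, q, hq, e⟩
  rw [e1, e1] at e
  have hq0 : ψ (MvPolynomial.aeval ![(⟨s, hs.1⟩ : planeCurve u v), ⟨t, ht⟩] q) ≠ 0 := by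
    rw [e2]
    exact fun h0 => hq (X_dvd_iff_restrictToLine.2 (transcendental_iff.1 htr _ h0))
  have hqK : ((MvPolynomial.aeval ![(⟨s, hs.1⟩ : planeCurve u v), ⟨t, ht⟩] q : planeCurve u v) : K)
      ≠ 0 := fun h0 => hq0 (by rw [Subtype.ext (a2 := (0 : planeCurve u v)) h0, map_zero])
  rw [eq_div_of_mul_eq hqK e, div_eq_mul_inv]
  exact mul_mem (Subtype.prop _) (h2 _ hq0)

theorem IsChart.planeCurve_sub_const (h : IsChart u v) (m : ℂ) :
    planeCurve u (v - algebraMap ℂ K m) = planeCurve u v := by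
  have h' := h.sub_const m
  refine le_antisymm (h.planeCurve_le h.left_mem_maxIdeal
    (sub_mem (right_mem_planeCurve u v) (Subalgebra.algebraMap_mem _ m)) fun r => ?_)
    (h'.planeCurve_le h'.left_mem_maxIdeal ?_ fun r => ?_)
  · rw [sub_sub, ← map_add]
    exact h.sub_const_notMem_maxIdeal _
  · have := add_mem (right_mem_planeCurve u (v - algebraMap ℂ K m))
      (Subalgebra.algebraMap_mem _ m)
    rwa [sub_add_cancel] at this
  · rw [show v - algebraMap ℂ K r = v - algebraMap ℂ K m - algebraMap ℂ K (r - m) by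
      rw [map_sub]; ring]
    exact h'.sub_const_notMem_maxIdeal _

/-- `v` is a unit along `u = 0`, so the strict transform of this line is cut out by `u / v` in the
other chart of the blow-up. -/
theorem IsChart.planeCurve_div (h : IsChart u v) : planeCurve (u / v) v = planeCurve u v := by
  have h' := h.div_right
  refine le_antisymm (h.planeCurve_le ?_ (right_mem_planeCurve u v) h.sub_const_notMem_maxIdeal)
    (h'.planeCurve_le ?_ (right_mem_planeCurve _ v) h'.sub_const_notMem_maxIdeal)
  · rw [div_eq_mul_inv]
    exact mul_mem_maxIdeal h.left_mem_maxIdeal h.inv_right_mem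
  · have := mul_mem_maxIdeal h'.left_mem_maxIdeal (right_mem_planeCurve (u / v) v)
    rwa [div_mul_cancel₀ _ h.right_ne_zero] at this

theorem IsChart.inv_sub_const_notMem_maxIdeal (h : IsChart u v) (r : ℂ) :
    v⁻¹ - algebraMap ℂ K r ∉ maxIdeal (planeCurve u v) := by
  intro hm
  have h1 := mul_mem_maxIdeal hm (right_mem_planeCurve u v)
  rw [sub_mul, inv_mul_cancel₀ h.right_ne_zero] at h1
  rcases eq_or_ne r 0 with rfl | hr
  · rw [map_zero, zero_mul, sub_zero] at h1
    exact h1.2.elim one_ne_zero fun h => h (by simp)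
  · have h2 := mul_mem_maxIdeal h1 (Subalgebra.algebraMap_mem _ (-r⁻¹))
    refine h.sub_const_notMem_maxIdeal r⁻¹ ?_
    convert h2 using 1
    have : algebraMap ℂ K r ≠ 0 := by simpa using hr
    rw [map_neg, map_inv₀]
    field_simp
    ring

/-- Both sides are the exceptional curve of the blow-up of the origin, seen in its two charts. The
slopes `v / u` and `u / v` are inverse to each other, and `v` is `u` times a function regular along
the curve. -/
theorem IsChart.planeCurve_exchange (h : IsChart u v) :
    planeCurve v (u / v) = planeCurve u (v / u) := by
  have h1 := h.div_left
  have h2 := h.swap.div_left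
  have hu := h.left_ne_zero
  have hv := h.right_ne_zero
  have key : ∀ {u v : K}, IsChart u v → planeCurve v (u / v) ≤ planeCurve u (v / u) := by
    intro u v h
    have h1 := h.div_left
    have hu := h.left_ne_zero
    rw [show u / v = (v / u)⁻¹ by rw [inv_div]]
    refine h1.planeCurve_le ?_ h1.inv_right_mem h1.inv_sub_const_notMem_maxIdeal
    have := mul_mem_maxIdeal h1.left_mem_maxIdeal (right_mem_planeCurve u (v / u))
    rwa [mul_div_cancel₀ _ hu] at this
  exact le_antisymm (key h) (key h.swap)

/-- A rational function of one variable is lifted by substituting `v` in numerator and denominator.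
-/
theorem IsChart.curve_surjective {ψ : planeCurve u v →ₐ[ℂ] RatFunc ℂ} (h : IsChart u v)
    (hψ : ∀ (f : planeCurve u v) (p q : MvPolynomial (Fin 2) ℂ), restrictToRatFunc q ≠ 0 →
      (f : K) * MvPolynomial.aeval ![u, v] q = MvPolynomial.aeval ![u, v] p →
      ψ f * restrictToRatFunc q = restrictToRatFunc p) : Function.Surjective ψ := by
  intro g
  obtain ⟨p, q, hq, rfl⟩ := IsFractionRing.div_surjective (A := Polynomial ℂ) g
  have e : ∀ p : Polynomial ℂ, restrictToRatFunc (Polynomial.aeval (MvPolynomial.X 1) p) =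
      algebraMap (Polynomial ℂ) (RatFunc ℂ) p := by
    intro p
    rw [restrictToRatFunc, AlgHom.comp_apply, IsScalarTower.coe_toAlgHom']
    congr 1
    rw [← AlgHom.comp_apply, ← AlgHom.id_apply (R := ℂ) p]
    congr 1
    ext
    simp [restrictToLine]
  have hq0 : restrictToRatFunc (Polynomial.aeval (MvPolynomial.X 1) q) ≠ 0 := by
    rw [e, Ne, map_eq_zero_iff _ (RatFunc.algebraMap_injective ℂ)]
    exact nonZeroDivisors.ne_zero hq
  have hqK :
      MvPolynomial.aeval ![u, v] (Polynomial.aeval (.X 1 : MvPolynomial (Fin 2) ℂ) q) ≠ 0 := by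
    intro h0
    rw [(map_eq_zero_iff _ h.injective).1 h0, map_zero] at hq0
    exact hq0 rfl
  refine ⟨⟨MvPolynomial.aeval ![u, v] (Polynomial.aeval (.X 1 : MvPolynomial (Fin 2) ℂ) p) /
    MvPolynomial.aeval ![u, v] (Polynomial.aeval (.X 1 : MvPolynomial (Fin 2) ℂ) q), _, _,
    mt restrictToRatFunc_eq_zero.2 hq0, div_mul_cancel₀ _ hqK⟩, ?_⟩
  rw [← e p, ← e q, eq_div_iff hq0]
  exact hψ _ _ _ hq0 (div_mul_cancel₀ _ hqK)

/-! ## Coordinates at the origin -/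

theorem IsChart.planePoint_le_planeCurve (_h : IsChart u v) :
    planePoint u v 0 0 ≤ planeCurve u v := by
  rintro f ⟨p, q, hq, e⟩
  refine ⟨p, q, ?_, e⟩
  rintro ⟨a, rfl⟩
  simp at hq

/-- A fraction vanishing on the line has numerator divisible by `X 0`. Dividing the numerator keeps
the denominator, which is nonzero at the origin. -/
theorem IsChart.isLocalEquation (h : IsChart u v) :
    IsLocalEquation (planeCurve u v) (planePoint u v 0 0) u := by
  refine ⟨(h.hasVal_left 0 0).mem, fun f hf => ⟨fun hm => ?_, ?_⟩⟩
  · obtain ⟨ψ, h1, h2⟩ := h.exists_curve_residue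
    have h3 := (mem_maxIdeal_iff h2 ⟨f, hm.1⟩).1 hm
    obtain ⟨p, q, hq, e⟩ := hf
    have hq' : ¬ MvPolynomial.X 0 ∣ q := by
      rintro ⟨a, rfl⟩
      simp at hq
    have h4 := h1 ⟨f, hm.1⟩ p q (mt restrictToRatFunc_eq_zero.1 hq') e
    rw [h3, zero_mul] at h4
    obtain ⟨a, rfl⟩ := restrictToRatFunc_eq_zero.1 h4.symm
    have h5 : MvPolynomial.aeval ![u, v] q ≠ 0 := fun h0 => hq' (by
      rw [(map_eq_zero_iff _ h.injective).1 h0]; exact dvd_zero _)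
    refine ⟨MvPolynomial.aeval ![u, v] a / MvPolynomial.aeval ![u, v] q,
      ⟨a, q, hq, div_mul_cancel₀ _ h5⟩, ?_⟩
    rw [eq_comm, div_mul_eq_mul_div, div_eq_iff h5, e]
    simp [mul_comm]
  · rintro ⟨a, ha, rfl⟩
    exact h.mem_maxIdeal_planeCurve.2 ⟨a, h.planePoint_le_planeCurve ha, rfl⟩

theorem IsChart.isLocalEquation_right (h : IsChart u v) :
    IsLocalEquation (planeCurve v u) (planePoint u v 0 0) v := by
  rw [h.planePoint_swap]
  exact h.swap.isLocalEquation

theorem IsChart.planePoint_le_planeCurve_right (h : IsChart u v) :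
    planePoint u v 0 0 ≤ planeCurve v u := by
  rw [h.planePoint_swap]
  exact h.swap.planePoint_le_planeCurve

theorem IsChart.isCoordinates (h : IsChart u v) : IsCoordinates (planePoint u v 0 0) u v := by
  refine ⟨(h.hasVal_left 0 0).mem, (h.hasVal_right 0 0).mem, fun f => ⟨fun hm => ?_, ?_⟩⟩
  · obtain ⟨ψ, h1, h2⟩ := h.exists_point_residue 0 0
    have h3 := (mem_maxIdeal_iff h2 ⟨f, hm.1⟩).1 hm
    obtain ⟨p, q, hq, e⟩ := hm.1
    have h4 := h1 ⟨f, hm.1⟩ p q hq e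
    rw [h3, zero_mul] at h4
    obtain ⟨a, b, rfl⟩ := exists_eq_of_eval_zero h4.symm
    have h5 : MvPolynomial.aeval ![u, v] q ≠ 0 := fun h0 => hq (by
      rw [(map_eq_zero_iff _ h.injective).1 h0, map_zero])
    refine ⟨MvPolynomial.aeval ![u, v] a / MvPolynomial.aeval ![u, v] q,
      ⟨a, q, hq, div_mul_cancel₀ _ h5⟩, MvPolynomial.aeval ![u, v] b /
      MvPolynomial.aeval ![u, v] q, ⟨b, q, hq, div_mul_cancel₀ _ h5⟩, ?_⟩
    rw [eq_comm, div_mul_eq_mul_div, div_mul_eq_mul_div, ← add_div, div_eq_iff h5, e]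
    simp [mul_comm]
  · rintro ⟨a, ha, b, hb, rfl⟩
    have hp := h.isPoint 0 0
    obtain ⟨z, hz⟩ := hp.hasVal ha
    obtain ⟨w, hw⟩ := hp.hasVal hb
    exact hasVal_zero.1 ((hp.add (hp.mul hz (h.hasVal_left 0 0))
      (hp.mul hw (h.hasVal_right 0 0))).congr rfl (by simp))

theorem IsCoordinates.swap {R : Subalgebra ℂ K} {f g : K} (h : IsCoordinates R f g) :
    IsCoordinates R g f := by
  refine ⟨h.2.1, h.1, fun k => (h.2.2 k).trans ⟨?_, ?_⟩⟩ <;>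
  · rintro ⟨a, ha, b, hb, rfl⟩
    exact ⟨b, hb, a, ha, add_comm _ _⟩

/-- The two coordinates generate the kernel of the residue map, so the quotient is `ℂ`. -/
theorem IsChart.localMultiplicity_coordinates (h : IsChart u v) :
    localMultiplicity (planePoint u v 0 0) ⟨u, (h.hasVal_left 0 0).mem⟩
      ⟨v, (h.hasVal_right 0 0).mem⟩ = 1 := by
  obtain ⟨ψ, h1, h2⟩ := h.exists_point_residue 0 0
  have hker : Ideal.span {⟨u, (h.hasVal_left 0 0).mem⟩, ⟨v, (h.hasVal_right 0 0).mem⟩} =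
      RingHom.ker ψ := by
    ext f
    rw [Ideal.mem_span_pair, RingHom.mem_ker, ← mem_maxIdeal_iff h2, h.isCoordinates.2.2]
    constructor
    · rintro ⟨a, b, rfl⟩
      exact ⟨a, a.2, b, b.2, rfl⟩
    · rintro ⟨a, ha, b, hb, e⟩
      exact ⟨⟨a, ha⟩, ⟨b, hb⟩, Subtype.ext e.symm⟩
  have hs : Function.Surjective ψ := fun z => ⟨algebraMap ℂ _ z, ψ.commutes z⟩
  rw [localMultiplicity, hker, (Ideal.quotientKerAlgEquivOfSurjective hs).toLinearEquiv.finrank_eq,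
    Module.finrank_self]

theorem localMultiplicity_one (R : Subalgebra ℂ K) (f : R) : localMultiplicity R f 1 = 0 := by
  have : Ideal.span {f, 1} = ⊤ := by
    rw [Ideal.eq_top_iff_one]
    exact Ideal.subset_span (by simp)
  rw [localMultiplicity, this]
  exact Module.finrank_zero_of_subsingleton

end Curve

/-! ## Smooth rational curves, self-intersection and intersection -/

theorem isSmoothRationalCurve_of {S : Set (Subalgebra ℂ K)} {u v : K} (h : IsChart u v)
    (hne : ∃ R ∈ S, R ≤ planeCurve u v)
    (hS : ∀ R ∈ S, R ≤ planeCurve u v → ∃ s t, IsChart s t ∧ R = planePoint s t 0 0 ∧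
      planeCurve u v = planeCurve s t) : IsSmoothRationalCurve S (planeCurve u v) := by
  obtain ⟨ψ, h1, h2⟩ := h.exists_curve_residue
  refine ⟨⟨ψ, h.curve_surjective h1, fun f => (mem_maxIdeal_iff h2 f).symm⟩, hne,
    fun R hR hle => ?_⟩
  obtain ⟨s, t, hst, rfl, e⟩ := hS R hR hle
  exact ⟨s, t, e ▸ hst.isLocalEquation, hst.isCoordinates⟩

theorem one_notMem_maxIdeal (V : Subalgebra ℂ K) : (1 : K) ∉ maxIdeal V :=
  fun h => h.2.elim one_ne_zero fun h => h (by simp)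

theorem isOrderOfRestriction_self {V R : Subalgebra ℂ K} (g : R) (h0 : (g : K) ≠ 0) :
    IsOrderOfRestriction V R g ((g : K) / g) 0 :=
  ⟨1, 1, one_notMem_maxIdeal V, one_notMem_maxIdeal V, by simp [div_self h0], by simp⟩

/-- A curve with a rational function `f` vanishing on it to first order, which is a local equation
of the curve at all but two points, and a product of two local coordinates there, one of which
vanishes on the curve. -/
theorem hasSelfIntersection_of {S : Set (Subalgebra ℂ K)} {u v : K} (h : IsChart u v)
    {P Q : Subalgebra ℂ K} (hPQ : P ≠ Q)
    (hP : ∃ s t, IsChart s t ∧ P = planePoint s t 0 0 ∧ planeCurve u v = planeCurve s t ∧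
      u = s * t)
    (hQ : ∃ s t, IsChart s t ∧ Q = planePoint s t 0 0 ∧ planeCurve u v = planeCurve s t ∧
      u = s * t)
    (hPS : P ∈ S) (hQS : Q ∈ S)
    (hS : ∀ R ∈ S, R ≤ planeCurve u v → R = P ∨ R = Q ∨ IsLocalEquation (planeCurve u v) R u) :
    HasSelfIntersection S (planeCurve u v) (-2) := by
  classical
  have hle : ∀ {R}, (∃ s t, IsChart s t ∧ R = planePoint s t 0 0 ∧
      planeCurve u v = planeCurve s t ∧ u = s * t) → R ≤ planeCurve u v := by
    rintro _ ⟨s, t, hst, rfl, e, -⟩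
    rw [e]
    exact hst.planePoint_le_planeCurve
  -- At `P` and `Q` the local equation of the curve is `s`, and `u / s = t` restricts to a function
  -- with a simple zero.
  have hord : ∀ {R}, (∃ s t, IsChart s t ∧ R = planePoint s t 0 0 ∧
      planeCurve u v = planeCurve s t ∧ u = s * t) → ∃ g : R,
      IsLocalEquation (planeCurve u v) R g ∧
        IsOrderOfRestriction (planeCurve u v) R g (u / g) 1 := by
    rintro _ ⟨s, t, hst, rfl, e, e'⟩
    rw [e, e']
    refine ⟨⟨s, (hst.hasVal_left 0 0).mem⟩, hst.isLocalEquation,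
      ⟨t, (hst.hasVal_right 0 0).mem⟩, 1, ?_, one_notMem_maxIdeal _, ?_, ?_⟩
    · simpa using hst.sub_const_notMem_maxIdeal 0
    · simp [mul_div_cancel_left₀ _ hst.left_ne_zero]
    · rw [hst.localMultiplicity_coordinates, localMultiplicity_one]
      rfl
  refine ⟨u, h.left_ne_zero, fun f => h.mem_maxIdeal_planeCurve,
    Finsupp.single P 1 + Finsupp.single Q 1, fun R hR => ?_, fun R hR hRV => ?_, ?_⟩
  · have h1 : R ≠ P := by
      rintro rfl
      exact hR ⟨hPS, hle hP⟩
    have h2 : R ≠ Q := by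
      rintro rfl
      exact hR ⟨hQS, hle hQ⟩
    simp [h1.symm, h2.symm]
  · by_cases h1 : R = P
    · subst h1
      simpa [Finsupp.single_apply, hPQ.symm] using hord hP
    by_cases h2 : R = Q
    · subst h2
      simpa [Finsupp.single_apply, hPQ] using hord hQ
    have h3 := ((hS R hR hRV).resolve_left h1).resolve_left h2
    refine ⟨⟨u, h3.1⟩, h3, ?_⟩
    simpa [Finsupp.single_apply, Ne.symm h1, Ne.symm h2] using
      isOrderOfRestriction_self (V := planeCurve u v) ⟨u, h3.1⟩ h.left_ne_zero
  · rw [Finsupp.sum_add_index' (by simp) (by simp), Finsupp.sum_single_index rfl,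
      Finsupp.sum_single_index rfl]
    norm_num

theorem MeetOnceTransversally.symm {S : Set (Subalgebra ℂ K)} {V W : Subalgebra ℂ K}
    (h : MeetOnceTransversally S V W) : MeetOnceTransversally S W V := by
  obtain ⟨R, hR, h1, h2, h3, f, g, hf, hg, hfg⟩ := h
  exact ⟨R, hR, h2, h1, fun R' h h' h'' => h3 R' h h'' h', g, f, hg, hf, hfg.swap⟩

theorem meetOnceTransversally_of {S : Set (Subalgebra ℂ K)} {s t : K} (h : IsChart s t)
    (hS : planePoint s t 0 0 ∈ S) (hu : ∀ R ∈ S, R ≤ planeCurve s t → R ≤ planeCurve t s →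
      R = planePoint s t 0 0) : MeetOnceTransversally S (planeCurve s t) (planeCurve t s) :=
  ⟨_, hS, h.planePoint_le_planeCurve, h.planePoint_le_planeCurve_right, hu, s, t,
    h.isLocalEquation, h.isLocalEquation_right, h.isCoordinates⟩

/-! ## Blowing up the origin of a coordinate system -/

theorem localRingAt_residue (A : Subalgebra ℂ K) (φ : A →ₐ[ℂ] ℂ) :
    ∃ ψ : localRingAt A φ →ₐ[ℂ] ℂ, (∀ (f : localRingAt A φ) (p q : A), φ q ≠ 0 →
      (f : K) * q = p → ψ f * φ q = φ p) ∧
    ∀ f : localRingAt A φ, ψ f ≠ 0 → (f : K)⁻¹ ∈ localRingAt A φ :=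
  exists_residue A.val Subtype.val_injective φ (localRingAt A φ) (fun _ => Iff.rfl)

theorem le_localRingAt (A : Subalgebra ℂ K) (φ : A →ₐ[ℂ] ℂ) : A ≤ localRingAt A φ :=
  fun f hf => ⟨⟨f, hf⟩, 1, by simp, by simp⟩

theorem isPoint_localRingAt (A : Subalgebra ℂ K) (φ : A →ₐ[ℂ] ℂ) : IsPoint (localRingAt A φ) :=
  let ⟨ψ, _, h⟩ := localRingAt_residue A φ
  ⟨ψ, h⟩

theorem hasVal_localRingAt (A : Subalgebra ℂ K) (φ : A →ₐ[ℂ] ℂ) (f : A) :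
    HasVal (localRingAt A φ) f (φ f) := by
  obtain ⟨ψ, h1, h2⟩ := localRingAt_residue A φ
  refine (hasVal_iff h2).2 ⟨le_localRingAt A φ f.2, ?_⟩
  simpa using h1 ⟨f, le_localRingAt A φ f.2⟩ f 1 (by simp) (by simp)

theorem HasVal.of_le {R T : Subalgebra ℂ K} (hR : IsPoint R) (hT : IsPoint T) (h : R ≤ T)
    {f : K} {z : ℂ} (hf : HasVal R f z) : HasVal T f z := by
  obtain ⟨ψ, hψ⟩ := hR
  obtain ⟨χ, hχ⟩ := hT
  rw [hasVal_iff hψ] at hf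
  obtain ⟨hm, rfl⟩ := hf
  exact (hasVal_iff hχ).2 ⟨h hm, residue_le h hψ χ ⟨f, hm⟩⟩

/-- The local ring of `A` at a point is dominated by every point which contains `A` and is
dominated by it. -/
theorem localRingAt_le {A R : Subalgebra ℂ K} {φ : A →ₐ[ℂ] ℂ} (hR : IsPoint R) (hA : A ≤ R)
    (h : R ≤ localRingAt A φ) : localRingAt A φ ≤ R := by
  rintro f ⟨p, q, hq, e⟩
  obtain ⟨z, hz⟩ := hR.hasVal (hA q.2)
  have hz' := (hz.of_le hR (isPoint_localRingAt A φ) h)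
  rw [(isPoint_localRingAt A φ).unique (hasVal_localRingAt A φ q) hz'] at hq
  have h0 : (q : K) ≠ 0 := by
    intro h0
    rw [h0] at hz
    exact hq (hR.unique hz ((hR.const 0).congr (by simp) rfl))
  rw [eq_div_of_mul_eq h0 e, div_eq_mul_inv]
  exact mul_mem (hA p.2) (hR.inv hz hq).mem

theorem div_mem_blowUpAlgebra {R : Subalgebra ℂ K} {a b : K} (hb : b ∈ maxIdeal R) :
    b / a ∈ blowUpAlgebra R a :=
  Algebra.subset_adjoin (Or.inr ⟨b, hb, rfl⟩)

theorem le_blowUpAlgebra (R : Subalgebra ℂ K) (a : K) : R ≤ blowUpAlgebra R a :=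
  fun _ hf => Algebra.subset_adjoin (Or.inl hf)

theorem blowUpAlgebra_le {R T : Subalgebra ℂ K} {a : K} (h : R ≤ T)
    (h' : ∀ b ∈ maxIdeal R, b / a ∈ T) : blowUpAlgebra R a ≤ T := by
  refine Algebra.adjoin_le ?_
  rintro f (hf | ⟨b, hb, rfl⟩)
  · exact h hf
  · exact h' b hb

section BlowUp

variable {u v : K}

theorem IsChart.le_blowUp_chart (h : IsChart u v) (m : ℂ) :
    planePoint u v 0 0 ≤ planePoint u (v / u - algebraMap ℂ K m) 0 0 := by
  have h' := h.div_left.sub_const m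
  have hp := h'.isPoint 0 0
  refine hp.planePoint_le (h'.hasVal_left 0 0) ?_
  refine (hp.mul (h'.hasVal_left 0 0) (hp.add (h'.hasVal_right 0 0) (hp.const m))).congr ?_
    (by simp)
  rw [sub_add_cancel, mul_div_cancel₀ _ h.left_ne_zero]

theorem IsChart.hasVal_blowUp_slope (h : IsChart u v) (m : ℂ) :
    HasVal (planePoint u (v / u - algebraMap ℂ K m) 0 0) (v / u) m := by
  have h' := h.div_left.sub_const m
  have hp := h'.isPoint 0 0
  exact (hp.add (h'.hasVal_right 0 0) (hp.const m)).congr (by ring) (by simp)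

/-- A point of the blow-up at which `u / a` does not vanish. -/
theorem IsChart.localRingAt_eq (h : IsChart u v) {a : K} (ha0 : a ≠ 0)
    (ha : a ∈ maxIdeal (planePoint u v 0 0))
    (φ : blowUpAlgebra (planePoint u v 0 0) a →ₐ[ℂ] ℂ)
    (hs : φ ⟨u / a, div_mem_blowUpAlgebra (hasVal_zero.1 (h.hasVal_left 0 0))⟩ ≠ 0) :
    ∃ m, localRingAt _ φ = planePoint u (v / u - algebraMap ℂ K m) 0 0 := by
  have hu := h.left_ne_zero
  have hR := h.isPoint 0 0
  have hT := isPoint_localRingAt _ φ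
  have hRT : planePoint u v 0 0 ≤ localRingAt _ φ :=
    (le_blowUpAlgebra _ _).trans (le_localRingAt _ φ)
  set S : blowUpAlgebra (planePoint u v 0 0) a :=
    ⟨u / a, div_mem_blowUpAlgebra (hasVal_zero.1 (h.hasVal_left 0 0))⟩
  set V : blowUpAlgebra (planePoint u v 0 0) a :=
    ⟨v / a, div_mem_blowUpAlgebra (hasVal_zero.1 (h.hasVal_right 0 0))⟩
  have hvS := hasVal_localRingAt _ φ S
  have hvV := hasVal_localRingAt _ φ V
  -- The value of `v / u = (v / a) / (u / a)`, that is, the slope of the tangent direction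
  -- represented by `φ`.
  set m := φ V / φ S
  have h' := h.div_left.sub_const m
  have hR' := h'.isPoint 0 0
  have hle : planePoint u (v / u - algebraMap ℂ K m) 0 0 ≤ localRingAt _ φ := by
    refine hT.planePoint_le ((h.hasVal_left 0 0).of_le hR hT hRT) ?_
    refine (hT.sub (hT.div hvV hvS hs) (hT.const m)).congr ?_ (sub_self _)
    simp only [S, V]
    field_simp
  refine ⟨m, le_antisymm (localRingAt_le hR' (blowUpAlgebra_le (h.le_blowUp_chart m) ?_) hle) hle⟩
  -- From `a = p u + q v` the function `a / u = p + q (v / u)` is regular at the point of slope `m`,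
  -- and its value is inverse to `φ (u / a)`. So `a` and `u` differ there by a unit, and dividing
  -- the maximal ideal by `a` gives regular functions.
  obtain ⟨p, hp, q, hq, e⟩ := (h.isCoordinates.2.2 a).1 ha
  have hau : HasVal (planePoint u (v / u - algebraMap ℂ K m) 0 0) (a / u) (φ S)⁻¹ := by
    obtain ⟨z, hz⟩ := hR'.hasVal (add_mem (h.le_blowUp_chart m hp)
      (mul_mem (h.le_blowUp_chart m hq) (h.hasVal_blowUp_slope m).mem))
    have hz := hz.congr (g := a / u) (by rw [e]; field_simp) rfl
    refine hz.congr rfl (hT.unique (hz.of_le hR' hT hle) ?_)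
    refine (hT.inv hvS hs).congr ?_ rfl
    simp [S]
  intro b hb
  obtain ⟨p', hp', q', hq', e'⟩ := (h.isCoordinates.2.2 b).1 hb
  have : b / a = (p' + q' * (v / u)) / (a / u) := by
    rw [e']
    field_simp
  rw [this, div_eq_mul_inv]
  exact mul_mem (add_mem (h.le_blowUp_chart m hp')
      (mul_mem (h.le_blowUp_chart m hq') (h.hasVal_blowUp_slope m).mem))
    (hR'.inv hau (inv_ne_zero hs)).mem

/-- The blow-up algebra for `a = u` is contained in the local ring of each point of finite slope.
The required `φ` is the residue map of that ring, restricted. -/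
theorem IsChart.exists_localRingAt_eq (h : IsChart u v) (m : ℂ) :
    ∃ φ : blowUpAlgebra (planePoint u v 0 0) u →ₐ[ℂ] ℂ,
      planePoint u (v / u - algebraMap ℂ K m) 0 0 = localRingAt _ φ := by
  have h' := h.div_left.sub_const m
  have hR' := h'.isPoint 0 0
  have hu := h.left_ne_zero
  have hB : blowUpAlgebra (planePoint u v 0 0) u ≤
      planePoint u (v / u - algebraMap ℂ K m) 0 0 := by
    refine blowUpAlgebra_le (h.le_blowUp_chart m) fun b hb => ?_
    obtain ⟨p, hp, q, hq, rfl⟩ := (h.isCoordinates.2.2 b).1 hb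
    rw [show (p * u + q * v) / u = p + q * (v / u) by field_simp]
    exact add_mem (h.le_blowUp_chart m hp)
      (mul_mem (h.le_blowUp_chart m hq) (h.hasVal_blowUp_slope m).mem)
  obtain ⟨ψ, hψ⟩ := hR'
  have hR' := h'.isPoint 0 0
  set φ := ψ.comp (Subalgebra.inclusion hB)
  have hval : ∀ {f z}, f ∈ blowUpAlgebra (planePoint u v 0 0) u →
      HasVal (planePoint u (v / u - algebraMap ℂ K m) 0 0) f z →
      HasVal (localRingAt _ φ) f z := by
    intro f z hf hz
    obtain ⟨h1, h2⟩ := (hasVal_iff hψ).1 hz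
    exact (hasVal_localRingAt _ φ ⟨f, hf⟩).congr rfl h2
  have hle : planePoint u (v / u - algebraMap ℂ K m) 0 0 ≤ localRingAt _ φ :=
    (isPoint_localRingAt _ φ).planePoint_le
      (hval (le_blowUpAlgebra _ _ (h.hasVal_left 0 0).mem) (h'.hasVal_left 0 0))
      (hval (sub_mem (div_mem_blowUpAlgebra (hasVal_zero.1 (h.hasVal_right 0 0)))
        (Subalgebra.algebraMap_mem _ m)) (h'.hasVal_right 0 0))
  exact ⟨φ, le_antisymm hle (localRingAt_le hR' hB hle)⟩

/-- Writing `a = p u + q v` gives `p (u / a) + q (v / a) = 1`, so at each point of the blow-up one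
of `u / a`, `v / a` is nonzero. If it is `u / a`, the point has a finite slope; otherwise the slope
is infinite and the point is the origin of `(u / v, v)`. Two charts therefore replace the whole
family indexed by `a`. -/
theorem IsChart.mem_blowUp (h : IsChart u v) (S : Set (Subalgebra ℂ K)) (T : Subalgebra ℂ K) :
    T ∈ blowUp S (planePoint u v 0 0) ↔ (T ∈ S ∧ T ≠ planePoint u v 0 0) ∨
      T = planePoint (u / v) v 0 0 ∨
      ∃ m, T = planePoint u (v / u - algebraMap ℂ K m) 0 0 := by
  have hu := h.left_ne_zero
  have hv := h.right_ne_zero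
  constructor
  · rintro (hT | ⟨a, ha, ha0, φ, rfl⟩)
    · exact Or.inl hT
    · right
      by_cases hs : φ ⟨u / a, div_mem_blowUpAlgebra (hasVal_zero.1 (h.hasVal_left 0 0))⟩ = 0
      · left
        obtain ⟨p, hp, q, hq, e⟩ := (h.isCoordinates.2.2 a).1 ha
        have ht : φ ⟨v / a, div_mem_blowUpAlgebra (hasVal_zero.1 (h.hasVal_right 0 0))⟩ ≠ 0 := by
          intro ht
          have h1 : φ (⟨p, le_blowUpAlgebra _ _ hp⟩ *
              ⟨u / a, div_mem_blowUpAlgebra (hasVal_zero.1 (h.hasVal_left 0 0))⟩ +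
              ⟨q, le_blowUpAlgebra _ _ hq⟩ *
              ⟨v / a, div_mem_blowUpAlgebra (hasVal_zero.1 (h.hasVal_right 0 0))⟩) = 1 := by
            rw [← map_one φ]
            congr 1
            apply Subtype.ext
            change p * (u / a) + q * (v / a) = 1
            rw [← mul_div_assoc, ← mul_div_assoc, ← add_div, ← e, div_self ha0]
          rw [map_add, map_mul, map_mul, hs, ht, mul_zero, mul_zero, add_zero] at h1
          exact zero_ne_one h1
        -- The type of `φ` depends on the local ring, so exchanging `u` and `v` is done for a
        -- variable ring `R` equal to the one of the exchanged coordinates.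
        have key : ∀ (R : Subalgebra ℂ K) (e : planePoint v u 0 0 = R) (ha : a ∈ maxIdeal R)
            (hu : u ∈ maxIdeal R) (hv : v ∈ maxIdeal R) (φ : blowUpAlgebra R a →ₐ[ℂ] ℂ),
            φ ⟨u / a, div_mem_blowUpAlgebra hu⟩ = 0 → φ ⟨v / a, div_mem_blowUpAlgebra hv⟩ ≠ 0 →
            localRingAt _ φ = planePoint v (u / v) 0 0 := by
          rintro _ rfl ha hu' hv' φ hs ht
          obtain ⟨m, hm⟩ := h.swap.localRingAt_eq ha0 ha φ ht
          have hT := isPoint_localRingAt _ φ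
          have h2 : HasVal (localRingAt _ φ) (u / v) 0 :=
            (hT.div (hasVal_localRingAt _ φ ⟨u / a, div_mem_blowUpAlgebra hu'⟩)
              (hasVal_localRingAt _ φ ⟨v / a, div_mem_blowUpAlgebra hv'⟩) ht).congr
              (by field_simp) (by rw [hs, zero_div])
          have h3 : HasVal (localRingAt _ φ) (u / v) m := hm ▸ h.swap.hasVal_blowUp_slope m
          rw [hT.unique h3 h2] at hm
          simpa using hm
        rw [h.div_right.planePoint_swap]
        exact key _ (h.planePoint_swap 0 0).symm ha (hasVal_zero.1 (h.hasVal_left 0 0))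
          (hasVal_zero.1 (h.hasVal_right 0 0)) φ hs ht
      · exact Or.inr (h.localRingAt_eq ha0 ha φ hs)
  · rintro (hT | rfl | ⟨m, rfl⟩)
    · exact Or.inl hT
    · right
      rw [h.planePoint_swap, h.div_right.planePoint_swap]
      obtain ⟨φ, hφ⟩ := h.swap.exists_localRingAt_eq 0
      exact ⟨v, hasVal_zero.1 (h.swap.hasVal_left 0 0), hv, φ, by simpa using hφ⟩
    · right
      obtain ⟨φ, hφ⟩ := h.exists_localRingAt_eq m
      exact ⟨u, hasVal_zero.1 (h.hasVal_left 0 0), hu, φ, hφ⟩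

end BlowUp

/-! ## Computations with two-forms and derivations -/

/-- The Jacobian rule: squares of one-forms vanish and the mixed products are opposite. -/
theorem wedge_eq_of_D_eq {u v u' v' : K} (a b c d : K)
    (hu : KaehlerDifferential.D ℂ K u' =
      a • KaehlerDifferential.D ℂ K u + b • KaehlerDifferential.D ℂ K v)
    (hv : KaehlerDifferential.D ℂ K v' =
      c • KaehlerDifferential.D ℂ K u + d • KaehlerDifferential.D ℂ K v) :
    wedge u' v' = (a * d - b * c) • wedge u v := by
  have h2 : ExteriorAlgebra.ι K (KaehlerDifferential.D ℂ K v) *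
      ExteriorAlgebra.ι K (KaehlerDifferential.D ℂ K u) = (-1 : K) • wedge u v := by
    rw [neg_one_smul, eq_neg_iff_add_eq_zero]
    exact ExteriorAlgebra.ι_add_mul_swap _ _
  simp only [wedge, hu, hv, map_add, map_smul, add_mul, mul_add, smul_mul_assoc, mul_smul_comm,
    ExteriorAlgebra.ι_sq_zero, smul_zero, h2, zero_add, add_zero]
  rw [smul_smul, smul_smul, smul_smul, ← add_smul]
  congr 1
  ring

theorem wedge_swap (u v : K) : wedge v u = -wedge u v := by
  rw [wedge_eq_of_D_eq (u := u) (v := v) 0 1 1 0 (by simp) (by simp)]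
  simp

theorem wedge_div_left {u v : K} (hu : u ≠ 0) : wedge u (v / u) = u⁻¹ • wedge u v := by
  rw [wedge_eq_of_D_eq (u := u) (v := v) 1 0 (-(v / u ^ 2)) u⁻¹ (by simp) ?_]
  · simp
  · rw [Derivation.leibniz_div, smul_sub, smul_smul, smul_smul, sub_eq_neg_add, neg_smul]
    congr 2
    · field_simp
    · field_simp

theorem wedge_div_right {u v : K} (hv : v ≠ 0) : wedge (u / v) v = v⁻¹ • wedge u v := by
  rw [wedge_swap, wedge_div_left hv, wedge_swap u v, smul_neg, neg_neg]

theorem wedge_sub_const (u v : K) (m : ℂ) : wedge u (v - cst m) = wedge u v := by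
  rw [wedge_eq_of_D_eq (u := u) (v := v) 1 0 0 1 (by simp) (by simp)]
  simp

theorem wedge_neg_right (u v : K) : wedge u (-v) = -wedge u v := by
  rw [wedge_eq_of_D_eq (u := u) (v := v) 1 0 0 (-1) (by simp) (by simp)]
  simp

theorem wedge_inv_left (u v : K) :
    wedge (1 / u) v = -((u ^ 2)⁻¹ • wedge u v) := by
  rw [wedge_eq_of_D_eq (u := u) (v := v) (-(u ^ 2)⁻¹) 0 0 1 ?_ (by simp)]
  · simp
  · rw [one_div, Derivation.leibniz_inv]
    simp

/-- A derivation multiplied by `h` preserves the local ring at the origin when it does so for the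
two coordinates. -/
theorem IsChart.mul_derivation_mem {s t h : K} (hst : IsChart s t) (δ : Derivation ℂ K K)
    (hs : h * δ s ∈ planePoint s t 0 0) (ht : h * δ t ∈ planePoint s t 0 0) :
    ∀ f ∈ planePoint s t 0 0, h * δ f ∈ planePoint s t 0 0 := by
  have hp := hst.isPoint 0 0
  have key : ∀ p : MvPolynomial (Fin 2) ℂ,
      h * δ (MvPolynomial.aeval ![s, t] p) ∈ planePoint s t 0 0 := by
    intro p
    induction p using MvPolynomial.induction_on with
    | C r => simp
    | add p q hp hq => rw [map_add, map_add, mul_add]; exact add_mem hp hq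
    | mul_X p i ih =>
      have hm := (hp.aeval (hst.hasVal_left 0 0) (hst.hasVal_right 0 0) p).mem
      have hX : ∀ i, MvPolynomial.aeval ![s, t] (MvPolynomial.X i : MvPolynomial (Fin 2) ℂ) ∈
          planePoint s t 0 0 ∧
          h * δ (MvPolynomial.aeval ![s, t] (MvPolynomial.X i : MvPolynomial (Fin 2) ℂ)) ∈
          planePoint s t 0 0 := by
        intro i
        fin_cases i
        · simpa using ⟨(hst.hasVal_left 0 0).mem, hs⟩
        · simpa using ⟨(hst.hasVal_right 0 0).mem, ht⟩
      rw [map_mul, Derivation.leibniz, smul_eq_mul, smul_eq_mul, mul_add, mul_left_comm,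
        mul_left_comm h]
      exact add_mem (mul_mem hm (hX i).2) (mul_mem (hX i).1 ih)
  rintro f ⟨p, q, hq, e⟩
  have hqv := hp.aeval (hst.hasVal_left 0 0) (hst.hasVal_right 0 0) q
  have hpv := hp.aeval (hst.hasVal_left 0 0) (hst.hasVal_right 0 0) p
  have h0 : MvPolynomial.aeval ![s, t] q ≠ 0 := fun h0 => hq (by
    rw [(map_eq_zero_iff _ hst.injective).1 h0, map_zero])
  have hi := (hp.inv hqv hq).mem
  have hf : f ∈ planePoint s t 0 0 := ⟨p, q, hq, e⟩
  have e2 := congrArg δ e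
  rw [Derivation.leibniz, smul_eq_mul, smul_eq_mul] at e2
  have : h * δ f = (h * δ (MvPolynomial.aeval ![s, t] p) -
      f * (h * δ (MvPolynomial.aeval ![s, t] q))) * (MvPolynomial.aeval ![s, t] q)⁻¹ := by
    rw [← div_eq_mul_inv, eq_div_iff h0]
    linear_combination h * e2
  rw [this]
  exact mul_mem (sub_mem (key p) (mul_mem hf (key q))) hi

/-! ## The three kinds of points -/

/-- A point on none of the curves `D i`. -/
def IsInterior (D : Fin 7 → Subalgebra ℂ K) (δ : Derivation ℂ K K) (R : Subalgebra ℂ K) : Prop :=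
  ∃ s t, IsChart s t ∧ R = planePoint s t 0 0 ∧ (∀ i, ¬ R ≤ D i) ∧
    (∃ w : ℂ, w ≠ 0 ∧ wedge x y = cst w • wedge s t) ∧ δ s ∈ R ∧ δ t ∈ R

/-- A point on exactly one of the curves `D i`. -/
def IsSmoothBoundary (D : Fin 7 → Subalgebra ℂ K) (m : Fin 7 → ℕ) (δ : Derivation ℂ K K)
    (R : Subalgebra ℂ K) : Prop :=
  ∃ i s t, IsChart s t ∧ R = planePoint s t 0 0 ∧ D i = planeCurve s t ∧
    (∀ j, R ≤ D j → j = i) ∧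
    (∃ w : ℂ, w ≠ 0 ∧ s ^ m i • wedge x y = cst w • wedge s t) ∧
    (∃ a ∈ R, s * δ s = a * s) ∧ ∃ z, z ≠ 0 ∧ HasVal R (s * δ t) z

/-- A point on exactly two of the curves `D i`. -/
def IsCorner (D : Fin 7 → Subalgebra ℂ K) (m : Fin 7 → ℕ) (δ : Derivation ℂ K K)
    (R : Subalgebra ℂ K) : Prop :=
  ∃ i j s t, affineE6.Adj i j ∧ IsChart s t ∧ R = planePoint s t 0 0 ∧ D i = planeCurve s t ∧
    D j = planeCurve t s ∧ (∀ k, R ≤ D k → k = i ∨ k = j) ∧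
    (∃ w : ℂ, w ≠ 0 ∧ (s ^ m i * t ^ m j) • wedge x y = cst w • wedge s t) ∧
    (∃ a ∈ R, s * t * δ s = a * s) ∧ ∃ a z, z ≠ 0 ∧ HasVal R a z ∧ s * t * δ t = a * t

/-! ## Three successive blow-ups -/

/-- The points lying over the origin of the coordinate system `(u, v)` after blowing up the origin,
the origin of `(u, v / u)`, and the point `(0, κ)` of `(u, v / u ^ 2)`. -/
inductive ArmPoint (u v : K) (κ : ℂ) : Subalgebra ℂ K → Prop
  | corner₁ : ArmPoint u v κ (planePoint (u / v) v 0 0)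
  | side₁ (m : ℂ) (hm : m ≠ 0) : ArmPoint u v κ (planePoint u (v / u - cst m) 0 0)
  | corner₂ : ArmPoint u v κ (planePoint (u / (v / u)) (v / u) 0 0)
  | side₂ (m : ℂ) (hm : m ≠ 0) : ArmPoint u v κ (planePoint u (v / u / u - cst κ - cst m) 0 0)
  | corner₃ : ArmPoint u v κ
      (planePoint (u / (v / u / u - cst κ)) (v / u / u - cst κ) 0 0)
  | side₃ (m : ℂ) : ArmPoint u v κ (planePoint u ((v / u / u - cst κ) / u - cst m) 0 0)

section Arm

variable {u v : K} {κ : ℂ}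

theorem IsChart.le_div_left (h : IsChart u v) : planePoint u v 0 0 ≤ planePoint u (v / u) 0 0 := by
  simpa using h.le_blowUp_chart 0

theorem IsChart.le_div_right (h : IsChart u v) : planePoint u v 0 0 ≤ planePoint (u / v) v 0 0 := by
  rw [h.planePoint_swap, h.div_right.planePoint_swap]
  exact h.swap.le_div_left

theorem IsChart.le_third (h : IsChart u v) (κ : ℂ) :
    planePoint u v 0 0 ≤ planePoint u (v / u / u - cst κ) 0 0 :=
  h.le_div_left.trans (h.div_left.le_blowUp_chart κ)

theorem ArmPoint.le {R : Subalgebra ℂ K} (hR : ArmPoint u v κ R) (h : IsChart u v) :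
    planePoint u v 0 0 ≤ R := by
  cases hR with
  | corner₁ => exact h.le_div_right
  | side₁ m hm => exact h.le_blowUp_chart m
  | corner₂ => exact h.le_div_left.trans h.div_left.le_div_right
  | side₂ m hm =>
    rw [sub_sub, ← map_add]
    exact h.le_third _
  | corner₃ => exact (h.le_third κ).trans (h.div_left.div_left.sub_const κ).le_div_right
  | side₃ m => exact (h.le_third κ).trans ((h.div_left.div_left.sub_const κ).le_blowUp_chart m)

theorem inv_mem_of_hasVal {R : Subalgebra ℂ K} (hR : IsPoint R) {f : K} {z : ℂ}
    (hf : HasVal R f z) (hz : z ≠ 0) : f⁻¹ ∈ R := (hR.inv hf hz).mem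

/-- Three applications of `IsChart.mem_blowUp`. What needs proof is that points which are not
centres survive the later blow-ups. For old points this is `hS`, since both later centres dominate
the origin of `(u, v)`. For new points a suitable function has an inverse regular at one point and
vanishes at the other. -/
theorem IsChart.mem_blowUps_arm (h : IsChart u v) {S : Set (Subalgebra ℂ K)}
    (hS : ∀ R ∈ S, planePoint u v 0 0 ≤ R → R = planePoint u v 0 0) (κ : ℂ)
    (T : Subalgebra ℂ K) :
    T ∈ blowUps S [planePoint u v 0 0, planePoint u (v / u) 0 0,
      planePoint u (v / u / u - cst κ) 0 0] ↔
      (T ∈ S ∧ T ≠ planePoint u v 0 0) ∨ ArmPoint u v κ T := by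
  have h1 := h.div_left
  have h2 := h1.div_left
  have hw := h2.sub_const κ
  -- `v / u` vanishes at both later centres, whereas its inverse is regular at the first corner and
  -- at the points of nonzero slope.
  have hc1 : ∀ {P}, v / u ∈ maxIdeal P → planePoint (u / v) v 0 0 ≠ P := fun hP e =>
    not_le_of_mem_maxIdeal h1.right_ne_zero
      (by rw [inv_div]; exact (h.div_right.hasVal_left 0 0).mem) hP e.le
  have hs1 : ∀ {P m}, m ≠ 0 → v / u ∈ maxIdeal P →
      planePoint u (v / u - cst m) 0 0 ≠ P := fun hm hP e =>
    not_le_of_mem_maxIdeal h1.right_ne_zero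
      (inv_mem_of_hasVal ((h1.sub_const _).isPoint 0 0) (h.hasVal_blowUp_slope _) hm) hP e.le
  have hP2 : v / u ∈ maxIdeal (planePoint u (v / u) 0 0) := hasVal_zero.1 (h1.hasVal_right 0 0)
  have hP3 : v / u ∈ maxIdeal (planePoint u (v / u / u - cst κ) 0 0) :=
    hasVal_zero.1 ((h1.hasVal_right 0 0).of_le (h1.isPoint 0 0) (hw.isPoint 0 0)
      (h1.le_blowUp_chart κ))
  simp only [blowUps, List.foldl_cons, List.foldl_nil]
  rw [hw.mem_blowUp, h1.mem_blowUp, h.mem_blowUp]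
  constructor
  · rintro (⟨⟨hT | rfl | ⟨m, rfl⟩, hn⟩ | rfl | ⟨m, rfl⟩, hn'⟩ | rfl | ⟨m, rfl⟩)
    · exact Or.inl hT
    · exact Or.inr .corner₁
    · exact Or.inr (.side₁ m (by rintro rfl; simp at hn))
    · exact Or.inr .corner₂
    · refine Or.inr ?_
      have := ArmPoint.side₂ (u := u) (v := v) (κ := κ) (m - κ)
        (sub_ne_zero.2 (by rintro rfl; simp at hn'))
      rwa [sub_sub, ← map_add, add_sub_cancel] at this
    · exact Or.inr .corner₃
    · exact Or.inr (.side₃ m)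
  · rintro (⟨hT, hn⟩ | hT)
    · exact Or.inl ⟨Or.inl ⟨Or.inl ⟨hT, hn⟩, fun e => hn (hS T hT (e ▸ h.le_div_left))⟩,
        fun e => hn (hS T hT (e ▸ h.le_third κ))⟩
    · cases hT with
      | corner₁ => exact Or.inl ⟨Or.inl ⟨Or.inr (Or.inl rfl), hc1 hP2⟩, hc1 hP3⟩
      | side₁ m hm =>
        exact Or.inl ⟨Or.inl ⟨Or.inr (Or.inr ⟨m, rfl⟩), hs1 hm hP2⟩, hs1 hm hP3⟩
      | corner₂ =>
        refine Or.inl ⟨Or.inr (Or.inl rfl), fun e => ?_⟩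
        refine not_le_of_mem_maxIdeal (f := u / (v / u)) h1.div_right.left_ne_zero ?_
          (hasVal_zero.1 (h1.div_right.hasVal_left 0 0)) e.ge
        rw [inv_div]
        exact (h1.hasVal_blowUp_slope κ).mem
      | side₂ m hm =>
        refine Or.inl ⟨Or.inr (Or.inr ⟨κ + m, by rw [map_add, sub_sub]⟩), fun e => ?_⟩
        have h' := hw.sub_const m
        refine not_le_of_mem_maxIdeal hw.right_ne_zero
          (inv_mem_of_hasVal (h'.isPoint 0 0) ?_ hm) (hasVal_zero.1 (hw.hasVal_right 0 0)) e.le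
        exact ((h'.isPoint 0 0).add (h'.hasVal_right 0 0) ((h'.isPoint 0 0).const m)).congr
          (by ring) (by simp)
      | corner₃ => exact Or.inr (Or.inl rfl)
      | side₃ m => exact Or.inr (Or.inr ⟨m, rfl⟩)

theorem IsChart.second_centre_mem (h : IsChart u v) (S : Set (Subalgebra ℂ K)) :
    planePoint u (v / u) 0 0 ∈ blowUps S [planePoint u v 0 0] := by
  simp only [blowUps, List.foldl_cons, List.foldl_nil]
  rw [h.mem_blowUp]
  exact Or.inr (Or.inr ⟨0, by simp⟩)

theorem IsChart.third_centre_mem (h : IsChart u v) (S : Set (Subalgebra ℂ K)) (κ : ℂ) :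
    planePoint u (v / u / u - cst κ) 0 0 ∈
      blowUps S [planePoint u v 0 0, planePoint u (v / u) 0 0] := by
  simp only [blowUps, List.foldl_cons, List.foldl_nil]
  rw [h.div_left.mem_blowUp]
  exact Or.inr (Or.inr ⟨κ, rfl⟩)

end Arm

/-- The data at the origin of the coordinate system `(u, v)` near a point of the line `u = 0` at
infinity: the curves through it and its infinitely near points, the vector field and the
two-form. -/
structure IsArm (D : Fin 7 → Subalgebra ℂ K) (m : Fin 7 → ℕ) (δ : Derivation ℂ K K) (u v : K)
    (κ : ℂ) (i j : Fin 7) (w e a₁ a₂ a₃ b₁ b₂ b₃ : ℂ) : Prop where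
  chart : IsChart u v
  line : D 0 = planeCurve u v
  first : D i = planeCurve u (v / u)
  second : D j = planeCurve u (v / u / u)
  mult_line : m 0 = 3
  mult_first : m i = 2
  mult_second : m j = 1
  line_adj_first : affineE6.Adj 0 i
  first_adj_second : affineE6.Adj i j
  other : ∀ k, k = 0 ∨ k = i ∨ k = j ∨ ¬ planePoint u v 0 0 ≤ D k
  wedge_ne_zero : w ≠ 0
  wedge_eq : u ^ 3 • wedge x y = cst w • wedge u v
  slope_ne_zero : e ≠ 0
  left : δ u = cst e + cst a₁ * v + cst a₂ * v ^ 2 + cst a₃ * u ^ 2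
  right : u * δ v = 3 * cst e * v + cst b₁ * v ^ 2 + cst b₂ * v ^ 3 - cst e * cst κ * u ^ 2 +
    cst b₃ * u ^ 2 * v

/-! ### Normal forms of the field and of the two-form along one arm -/

namespace IsArm

variable {D : Fin 7 → Subalgebra ℂ K} {m : Fin 7 → ℕ} {δ : Derivation ℂ K K} {u v : K}
    {κ : ℂ} {i j : Fin 7} {w e a₁ a₂ a₃ b₁ b₂ b₃ : ℂ}

theorem second_eq (A : IsArm D m δ u v κ i j w e a₁ a₂ a₃ b₁ b₂ b₃) :
    D j = planeCurve u (v / u / u - cst κ) := by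
  rw [A.chart.div_left.div_left.planeCurve_sub_const, A.second]

/-- Differentiating the quotient subtracts `(v / u) δ u`, whose leading term is `e (v / u)`. The
coefficient `3 e` drops to `2 e`, and the term in `κ` loses one power of `u`. -/
theorem derivation_first (A : IsArm D m δ u v κ i j w e a₁ a₂ a₃ b₁ b₂ b₃) :
    u * δ (v / u) = v / u * (2 * cst e + cst (b₁ - a₁) * v + cst (b₂ - a₂) * v ^ 2 +
      cst (b₃ - a₃) * u ^ 2) - cst e * cst κ * u := by
  have hu := A.chart.left_ne_zero
  rw [Derivation.leibniz_div, smul_eq_mul, smul_eq_mul, smul_eq_mul, A.right, A.left]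
  simp only [map_sub]
  field_simp
  ring

/-- After the second division the coefficient is `e` and the term in `κ` has become constant, so the
two combine into `e (v / u² - κ)`. There is no term of exact order `u`; this is what makes the last
blow-up remove the pole. -/
theorem derivation_second (A : IsArm D m δ u v κ i j w e a₁ a₂ a₃ b₁ b₂ b₃) :
    u * δ (v / u / u - cst κ) = cst e * (v / u / u - cst κ) + u ^ 2 * (v / u / u *
      (cst (b₁ - 2 * a₁) * (v / u / u) + cst (b₂ - 2 * a₂) * u ^ 2 * (v / u / u) ^ 2 +
        cst (b₃ - 2 * a₃))) := by
  have hu := A.chart.left_ne_zero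
  have h1 := A.derivation_first
  rw [map_sub, Derivation.map_algebraMap, sub_zero, Derivation.leibniz_div, smul_eq_mul,
    smul_eq_mul, smul_eq_mul, h1, A.left]
  simp only [map_sub, map_mul, map_ofNat]
  field_simp
  ring

theorem left_eq (A : IsArm D m δ u v κ i j w e a₁ a₂ a₃ b₁ b₂ b₃) :
    δ u = cst e + u ^ 2 * (cst a₁ * (v / u / u) + cst a₂ * u ^ 2 * (v / u / u) ^ 2 + cst a₃) := by
  have hu := A.chart.left_ne_zero
  rw [A.left]
  field_simp
  ring

/-- The polar contributions `e (v / u² - κ) / u²` of `derivation_second` and of `left_eq` cancel, so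
no pole is left along `u = 0`. -/
theorem derivation_third (A : IsArm D m δ u v κ i j w e a₁ a₂ a₃ b₁ b₂ b₃) :
    δ ((v / u / u - cst κ) / u) = v / u / u *
      (cst (b₁ - 2 * a₁) * (v / u / u) + cst (b₂ - 2 * a₂) * u ^ 2 * (v / u / u) ^ 2 +
        cst (b₃ - 2 * a₃)) - (v / u / u - cst κ) *
      (cst a₁ * (v / u / u) + cst a₂ * u ^ 2 * (v / u / u) ^ 2 + cst a₃) := by
  have hu := A.chart.left_ne_zero
  have h1 := A.derivation_second
  generalize hq : v / u / u * (cst (b₁ - 2 * a₁) * (v / u / u) +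
    cst (b₂ - 2 * a₂) * u ^ 2 * (v / u / u) ^ 2 + cst (b₃ - 2 * a₃)) = Q at *
  have h2 := A.left_eq
  generalize cst a₁ * (v / u / u) + cst a₂ * u ^ 2 * (v / u / u) ^ 2 + cst a₃ = P at *
  generalize v / u / u - cst κ = W at *
  rw [Derivation.leibniz_div, smul_eq_mul, smul_eq_mul, smul_eq_mul, h1, h2]
  field_simp
  ring

/-- Since `du ∧ d(v / u) = u⁻¹ du ∧ dv`, each blow-up lowers the order of the pole by one. -/
theorem wedge_first (A : IsArm D m δ u v κ i j w e a₁ a₂ a₃ b₁ b₂ b₃) :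
    u ^ 2 • wedge x y = cst w • wedge u (v / u) := by
  have hu := A.chart.left_ne_zero
  rw [wedge_div_left hu, smul_comm, ← A.wedge_eq, smul_smul]
  congr 1
  field_simp

theorem wedge_second (A : IsArm D m δ u v κ i j w e a₁ a₂ a₃ b₁ b₂ b₃) :
    u • wedge x y = cst w • wedge u (v / u / u - cst κ) := by
  have hu := A.chart.left_ne_zero
  rw [wedge_sub_const, wedge_div_left hu, smul_comm, ← A.wedge_first, smul_smul]
  congr 1
  field_simp

theorem wedge_third (A : IsArm D m δ u v κ i j w e a₁ a₂ a₃ b₁ b₂ b₃) :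
    wedge x y = cst w • wedge u ((v / u / u - cst κ) / u) := by
  have hu := A.chart.left_ne_zero
  rw [wedge_div_left hu, smul_comm, ← A.wedge_second, smul_smul, inv_mul_cancel₀ hu, one_smul]

theorem eq_of_le (A : IsArm D m δ u v κ i j w e a₁ a₂ a₃ b₁ b₂ b₃) {R : Subalgebra ℂ K}
    (hR : ArmPoint u v κ R) {k : Fin 7} (hk : R ≤ D k) : k = 0 ∨ k = i ∨ k = j := by
  rcases A.other k with h | h | h | h
  · exact Or.inl h
  · exact Or.inr (Or.inl h)
  · exact Or.inr (Or.inr h)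
  · exact absurd ((hR.le A.chart).trans hk) h

/-- Points at which `v / u` is regular do not lie on the line at infinity. -/
theorem not_le_line (A : IsArm D m δ u v κ i j w e a₁ a₂ a₃ b₁ b₂ b₃) {R : Subalgebra ℂ K}
    (h : v / u ∈ R) : ¬ R ≤ D 0 := by
  refine not_le_of_mem_maxIdeal (f := u / v) A.chart.div_right.left_ne_zero (by rwa [inv_div]) ?_
  rw [A.line, div_eq_mul_inv]
  exact mul_mem_maxIdeal A.chart.left_mem_maxIdeal A.chart.inv_right_mem

theorem not_le_line' (A : IsArm D m δ u v κ i j w e a₁ a₂ a₃ b₁ b₂ b₃) {R : Subalgebra ℂ K}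
    (hu : u ∈ R) (h : v / u / u ∈ R) : ¬ R ≤ D 0 := by
  refine A.not_le_line ?_
  have := mul_mem hu h
  rwa [mul_div_cancel₀ _ A.chart.left_ne_zero] at this

/-- Points at which `v / u ^ 2` is regular do not lie on the first exceptional curve. -/
theorem not_le_first (A : IsArm D m δ u v κ i j w e a₁ a₂ a₃ b₁ b₂ b₃) {R : Subalgebra ℂ K}
    (h : v / u / u ∈ R) : ¬ R ≤ D i := by
  have h1 := A.chart.div_left
  refine not_le_of_mem_maxIdeal (f := u / (v / u)) h1.div_right.left_ne_zero
    (by rwa [inv_div]) ?_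
  rw [A.first, div_eq_mul_inv]
  exact mul_mem_maxIdeal h1.left_mem_maxIdeal h1.inv_right_mem

/-- Points at which `u / v` is regular do not lie on the second exceptional curve. -/
theorem not_le_second (A : IsArm D m δ u v κ i j w e a₁ a₂ a₃ b₁ b₂ b₃) {R : Subalgebra ℂ K}
    (h : u / v ∈ R) : ¬ R ≤ D j := by
  have h1 := A.chart.div_left
  have h2 := h1.div_left
  refine not_le_of_mem_maxIdeal (f := v / u) h1.right_ne_zero (by rwa [inv_div]) ?_
  rw [A.second]
  have := mul_mem_maxIdeal h2.left_mem_maxIdeal (right_mem_planeCurve u (v / u / u))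
  rwa [mul_div_cancel₀ _ A.chart.left_ne_zero] at this

theorem not_le_second' (A : IsArm D m δ u v κ i j w e a₁ a₂ a₃ b₁ b₂ b₃) {R : Subalgebra ℂ K}
    (h : (v / u / u - cst κ) / u ∈ R) : ¬ R ≤ D j := by
  have hw := A.chart.div_left.div_left.sub_const κ
  refine not_le_of_mem_maxIdeal (f := u / (v / u / u - cst κ)) hw.div_right.left_ne_zero
    (by rwa [inv_div]) ?_
  rw [A.second_eq, div_eq_mul_inv]
  exact mul_mem_maxIdeal hw.left_mem_maxIdeal hw.inv_right_mem

/-- In the coordinates `s = u / v`, `t = v` one has `s t = u`. The line at infinity is `s = 0` and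
the first exceptional curve is `t = 0`. The quotient `a = u δ v / v` is regular with value `3 e`,
and `u δ s = (δ u - a) s`. -/
theorem corner₁_isCorner (A : IsArm D m δ u v κ i j w e a₁ a₂ a₃ b₁ b₂ b₃) :
    IsCorner D m δ (planePoint (u / v) v 0 0) := by
  have h := A.chart
  have hu := h.left_ne_zero
  have hv := h.right_ne_zero
  have h' := h.div_right
  have hp := h'.isPoint 0 0
  have hs := h'.hasVal_left 0 0
  have ht := h'.hasVal_right 0 0
  have huv : HasVal (planePoint (u / v) v 0 0) u 0 :=
    (hp.mul hs ht).congr (div_mul_cancel₀ u hv).symm (by simp)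
  -- The term `e κ u²` of `u δ v` is divisible by `v` in this chart because `u² = u (u / v) v`.
  set a := 3 * cst e + cst b₁ * v + cst b₂ * v ^ 2 - cst e * cst κ * u * (u / v) +
    cst b₃ * u ^ 2 with ha
  have hav : HasVal (planePoint (u / v) v 0 0) a (3 * e) := by
    refine (hp.add (hp.sub (hp.add (hp.add (hp.const (3 * e)) (hp.mul (hp.const b₁) ht))
      (hp.mul (hp.const b₂) (hp.mul ht ht))) (hp.mul (hp.mul (hp.const (e * κ)) huv) hs))
      (hp.mul (hp.const b₃) (hp.mul huv huv))).congr ?_ (by simp)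
    simp only [ha, map_mul, map_ofNat]
    ring
  have hδv : u * δ v = a * v := by
    rw [A.right, ha]
    field_simp
  have hδu : δ u ∈ planePoint (u / v) v 0 0 := by
    rw [A.left]
    exact (hp.add (hp.add (hp.add (hp.const e) (hp.mul (hp.const a₁) ht))
      (hp.mul (hp.const a₂) ((hp.mul ht ht).congr (sq v) rfl)))
      (hp.mul (hp.const a₃) ((hp.mul huv huv).congr (sq u) rfl))).mem
  refine ⟨0, i, u / v, v, A.line_adj_first, h', rfl, ?_, ?_, fun k hk => ?_, ?_, ?_, ?_⟩
  · rw [h.planeCurve_div, A.line]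
  · rw [h.planeCurve_exchange, A.first]
  · rcases A.eq_of_le .corner₁ hk with h | h | rfl
    · exact Or.inl h
    · exact Or.inr h
    · exact absurd hk (A.not_le_second hs.mem)
  · refine ⟨w, A.wedge_ne_zero, ?_⟩
    rw [wedge_div_right hv, smul_comm, ← A.wedge_eq, smul_smul, A.mult_line, A.mult_first]
    congr 1
    field_simp
  · refine ⟨δ u - a, sub_mem hδu hav.mem, ?_⟩
    rw [Derivation.leibniz_div, smul_eq_mul, smul_eq_mul, smul_eq_mul]
    field_simp
    linear_combination -hδv
  · exact ⟨a, 3 * e, by simpa using A.slope_ne_zero, hav, by rw [div_mul_cancel₀ _ hv, hδv]⟩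

/-- On the first exceptional curve `u δ (v / u)` has the value `2 e n` at slope `n`. It vanishes
only at slope zero, which is the second centre. -/
theorem side₁_isSmoothBoundary (A : IsArm D m δ u v κ i j w e a₁ a₂ a₃ b₁ b₂ b₃) {n : ℂ}
    (hn : n ≠ 0) : IsSmoothBoundary D m δ (planePoint u (v / u - cst n) 0 0) := by
  have h1 := A.chart.div_left
  have hu := A.chart.left_ne_zero
  have h' := h1.sub_const n
  have hp := h'.isPoint 0 0
  have hs := h'.hasVal_left 0 0
  have ht := A.chart.hasVal_blowUp_slope n
  have hv : HasVal (planePoint u (v / u - cst n) 0 0) v 0 :=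
    (hp.mul hs ht).congr (mul_div_cancel₀ v hu).symm (by simp)
  refine ⟨i, u, v / u - cst n, h', rfl, ?_, fun k hk => ?_, ?_, ?_, 2 * e * n, ?_, ?_⟩
  · rw [h1.planeCurve_sub_const, A.first]
  · rcases A.eq_of_le (.side₁ n hn) hk with rfl | h | rfl
    · exact absurd hk (A.not_le_line ht.mem)
    · exact h
    · refine absurd hk (A.not_le_second ?_)
      have := inv_mem_of_hasVal hp ht hn
      rwa [inv_div] at this
  · exact ⟨w, A.wedge_ne_zero, by rw [A.mult_first, A.wedge_first, wedge_sub_const]⟩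
  · refine ⟨δ u, ?_, mul_comm _ _⟩
    rw [A.left]
    exact (hp.add (hp.add (hp.add (hp.const e) (hp.mul (hp.const a₁) hv))
      (hp.mul (hp.const a₂) ((hp.mul hv hv).congr (sq v) rfl)))
      (hp.mul (hp.const a₃) ((hp.mul hs hs).congr (sq u) rfl))).mem
  · simpa using ⟨A.slope_ne_zero, hn⟩
  · rw [map_sub, Derivation.map_algebraMap, sub_zero, A.derivation_first]
    refine (hp.sub (hp.mul ht (hp.add (hp.add (hp.add (hp.const (2 * e))
      (hp.mul (hp.const (b₁ - a₁)) hv)) (hp.mul (hp.const (b₂ - a₂)) (hp.mul hv hv)))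
      (hp.mul (hp.const (b₃ - a₃)) (hp.mul hs hs)))) (hp.mul (hp.const (e * κ)) hs)).congr ?_
      (by simp; ring)
    simp only [map_mul, map_ofNat]
    ring

theorem corner₂_isCorner (A : IsArm D m δ u v κ i j w e a₁ a₂ a₃ b₁ b₂ b₃) :
    IsCorner D m δ (planePoint (u / (v / u)) (v / u) 0 0) := by
  have h := A.chart.div_left
  have hu := h.left_ne_zero
  have hv := h.right_ne_zero
  have h' := h.div_right
  have hp := h'.isPoint 0 0
  have hs := h'.hasVal_left 0 0
  have ht := h'.hasVal_right 0 0
  have huv : HasVal (planePoint (u / (v / u)) (v / u) 0 0) u 0 :=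
    (hp.mul hs ht).congr (div_mul_cancel₀ u hv).symm (by simp)
  have hvv : HasVal (planePoint (u / (v / u)) (v / u) 0 0) v 0 :=
    (hp.mul huv ht).congr (mul_div_cancel₀ v hu).symm (by simp)
  set a := 2 * cst e + cst (b₁ - a₁) * v + cst (b₂ - a₂) * v ^ 2 +
      cst (b₃ - a₃) * u ^ 2 - cst e * cst κ * (u / (v / u)) with ha
  have hav : HasVal (planePoint (u / (v / u)) (v / u) 0 0) a (2 * e) := by
    refine (hp.sub (hp.add (hp.add (hp.add (hp.const (2 * e))
      (hp.mul (hp.const (b₁ - a₁)) hvv)) (hp.mul (hp.const (b₂ - a₂)) (hp.mul hvv hvv)))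
      (hp.mul (hp.const (b₃ - a₃)) (hp.mul huv huv))) (hp.mul (hp.const (e * κ)) hs)).congr ?_
      (by simp)
    simp only [ha, map_mul, map_ofNat]
    ring
  have hδv : u * δ (v / u) = a * (v / u) := by
    rw [A.derivation_first, ha, sub_mul _ _ (v / u), mul_assoc _ (u / (v / u)),
      div_mul_cancel₀ _ hv]
    ring
  have hδu : δ u ∈ planePoint (u / (v / u)) (v / u) 0 0 := by
    rw [A.left]
    exact (hp.add (hp.add (hp.add (hp.const e) (hp.mul (hp.const a₁) hvv))
      (hp.mul (hp.const a₂) ((hp.mul hvv hvv).congr (sq v) rfl)))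
      (hp.mul (hp.const a₃) ((hp.mul huv huv).congr (sq u) rfl))).mem
  refine ⟨i, j, u / (v / u), v / u, A.first_adj_second, h', rfl, ?_, ?_, fun k hk => ?_, ?_, ?_, ?_⟩
  · rw [h.planeCurve_div, A.first]
  · rw [h.planeCurve_exchange, A.second]
  · rcases A.eq_of_le .corner₂ hk with rfl | h
    · exact absurd hk (A.not_le_line ht.mem)
    · exact h
  · refine ⟨w, A.wedge_ne_zero, ?_⟩
    rw [wedge_div_right hv, smul_comm, ← A.wedge_first, smul_smul, A.mult_first, A.mult_second]
    congr 1
    generalize v / u = V at *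
    field_simp
  · refine ⟨δ u - a, sub_mem hδu hav.mem, ?_⟩
    generalize v / u = V at *
    rw [Derivation.leibniz_div, smul_eq_mul, smul_eq_mul, smul_eq_mul]
    field_simp
    linear_combination -hδv
  · exact ⟨a, 2 * e, by simpa using A.slope_ne_zero, hav, by rw [div_mul_cancel₀ _ hv, hδv]⟩

theorem hasVal_quadratic {R : Subalgebra ℂ K} (hp : IsPoint R) {z : ℂ} {f g : K}
    (hf : HasVal R f 0) (hg : HasVal R g z) (a b c : ℂ) :
    HasVal R (cst a * g + cst b * f ^ 2 * g ^ 2 + cst c) (a * z + c) :=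
  (hp.add (hp.add (hp.mul (hp.const a) hg) (hp.mul (hp.mul (hp.const b)
    ((hp.mul hf hf).congr (sq f) rfl)) ((hp.mul hg hg).congr (sq g) rfl))) (hp.const c)).congr rfl
    (by simp)

/-- On the second exceptional curve `u δ (v / u²)` has the value `e n` at distance `n` from the
third centre. -/
theorem side₂_isSmoothBoundary (A : IsArm D m δ u v κ i j w e a₁ a₂ a₃ b₁ b₂ b₃) {n : ℂ}
    (hn : n ≠ 0) : IsSmoothBoundary D m δ (planePoint u (v / u / u - cst κ - cst n) 0 0) := by
  have h2 := A.chart.div_left.div_left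
  have hw := h2.sub_const κ
  have hu := A.chart.left_ne_zero
  have h' := hw.sub_const n
  have hp := h'.isPoint 0 0
  have hs := h'.hasVal_left 0 0
  have ht : HasVal (planePoint u (v / u / u - cst κ - cst n) 0 0) (v / u / u - cst κ) n :=
    (hp.add (h'.hasVal_right 0 0) (hp.const n)).congr (by ring) (by simp)
  have ht' : HasVal (planePoint u (v / u / u - cst κ - cst n) 0 0) (v / u / u) (n + κ) :=
    (hp.add ht (hp.const κ)).congr (by ring) rfl
  refine ⟨j, u, v / u / u - cst κ - cst n, h', rfl, ?_, fun k hk => ?_, ?_, ?_, e * n, ?_, ?_⟩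
  · rw [hw.planeCurve_sub_const, A.second_eq]
  · rcases A.eq_of_le (.side₂ n hn) hk with rfl | rfl | h
    · exact absurd hk (A.not_le_line' hs.mem ht'.mem)
    · exact absurd hk (A.not_le_first ht'.mem)
    · exact h
  · exact ⟨w, A.wedge_ne_zero, by
      rw [A.mult_second, pow_one, A.wedge_second, wedge_sub_const _ (v / u / u - cst κ)]⟩
  · refine ⟨δ u, ?_, mul_comm _ _⟩
    rw [A.left_eq]
    exact add_mem (Subalgebra.algebraMap_mem _ _) (mul_mem (pow_mem hs.mem 2)
      (hasVal_quadratic hp hs ht' _ _ _).mem)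
  · exact mul_ne_zero A.slope_ne_zero hn
  · rw [map_sub, Derivation.map_algebraMap, sub_zero, A.derivation_second]
    exact (hp.add (hp.mul (hp.const e) ht) (hp.mul ((hp.mul hs hs).congr (sq u) rfl) (hp.mul ht'
      (hasVal_quadratic hp hs ht' _ _ _)))).congr rfl (by simp)

/-- The curve `t = 0` of this chart is the last exceptional curve, which is not a component of the
boundary, so only `s = 0` counts. The factor `t` in `u δ t = e t + u² Q` cancels in `s δ t = e + s u
Q`, which leaves the nonzero value `e`. -/
theorem corner₃_isSmoothBoundary (A : IsArm D m δ u v κ i j w e a₁ a₂ a₃ b₁ b₂ b₃) :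
    IsSmoothBoundary D m δ
      (planePoint (u / (v / u / u - cst κ)) (v / u / u - cst κ) 0 0) := by
  have h2 := A.chart.div_left.div_left
  have hw := h2.sub_const κ
  have hu := A.chart.left_ne_zero
  have hW := hw.right_ne_zero
  have h' := hw.div_right
  have hp := h'.isPoint 0 0
  have hs := h'.hasVal_left 0 0
  have ht := h'.hasVal_right 0 0
  have hu0 := (hp.mul hs ht).congr (div_mul_cancel₀ u hW).symm (zero_mul _)
  have ht' : HasVal (planePoint (u / (v / u / u - cst κ)) (v / u / u - cst κ) 0 0)
    (v / u / u) (0 + κ) := (hp.add ht (hp.const κ)).congr (by ring) rfl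
  have hP := hasVal_quadratic hp hu0 ht' a₁ a₂ a₃
  have hQ := hp.mul ht' (hasVal_quadratic hp hu0 ht' (b₁ - 2 * a₁) (b₂ - 2 * a₂)
    (b₃ - 2 * a₃))
  have hδ := A.derivation_second
  have hδu := A.left_eq
  refine ⟨j, _, _, h', rfl, ?_, fun k hk => ?_, ?_, ?_, e, A.slope_ne_zero, ?_⟩
  · rw [hw.planeCurve_div, A.second_eq]
  · rcases A.eq_of_le .corner₃ hk with rfl | rfl | h
    · exact absurd hk (A.not_le_line' hu0.mem ht'.mem)
    · exact absurd hk (A.not_le_first ht'.mem)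
    · exact h
  · refine ⟨w, A.wedge_ne_zero, ?_⟩
    rw [A.mult_second, wedge_div_right hW, smul_comm, ← A.wedge_second, smul_smul]
    congr 1
    generalize v / u / u - cst κ = W at *
    field_simp
  · refine ⟨_, sub_mem (mul_mem (mul_mem hu0.mem hs.mem) hP.mem)
      (mul_mem (mul_mem hs.mem hs.mem) hQ.mem), ?_⟩
    generalize v / u / u * (cst (b₁ - 2 * a₁) * (v / u / u) +
      cst (b₂ - 2 * a₂) * u ^ 2 * (v / u / u) ^ 2 + cst (b₃ - 2 * a₃)) = Q at *
    generalize cst a₁ * (v / u / u) + cst a₂ * u ^ 2 * (v / u / u) ^ 2 + cst a₃ = P at *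
    generalize v / u / u - cst κ = W at *
    rw [Derivation.leibniz_div, smul_eq_mul, smul_eq_mul, smul_eq_mul, hδu]
    field_simp
    linear_combination -hδ
  · refine (hp.add (hp.const e) (hp.mul (hp.mul hs hu0) hQ)).congr ?_ (by simp)
    generalize v / u / u * (cst (b₁ - 2 * a₁) * (v / u / u) +
      cst (b₂ - 2 * a₂) * u ^ 2 * (v / u / u) ^ 2 + cst (b₃ - 2 * a₃)) = Q at *
    generalize v / u / u - cst κ = W at *
    rw [div_mul_eq_mul_div, hδ]
    field_simp

theorem side₃_isInterior (A : IsArm D m δ u v κ i j w e a₁ a₂ a₃ b₁ b₂ b₃) (n : ℂ) :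
    IsInterior D δ (planePoint u ((v / u / u - cst κ) / u - cst n) 0 0) := by
  have hw := A.chart.div_left.div_left.sub_const κ
  have hu := A.chart.left_ne_zero
  have h3 := hw.div_left
  have h' := h3.sub_const n
  have hp := h'.isPoint 0 0
  have hs := h'.hasVal_left 0 0
  have hz := hw.hasVal_blowUp_slope n
  have ht := (hp.mul hs hz).congr (mul_div_cancel₀ _ hu).symm rfl
  have ht' : HasVal (planePoint u ((v / u / u - cst κ) / u - cst n) 0 0) (v / u / u) (0 * n + κ) :=
    (hp.add ht (hp.const κ)).congr (by ring) rfl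
  have hP := hasVal_quadratic hp hs ht' a₁ a₂ a₃
  have hQ := hp.mul ht' (hasVal_quadratic hp hs ht' (b₁ - 2 * a₁) (b₂ - 2 * a₂)
    (b₃ - 2 * a₃))
  refine ⟨_, _, h', rfl, fun k hk => ?_, ⟨w, A.wedge_ne_zero, ?_⟩, ?_, ?_⟩
  · rcases A.eq_of_le (.side₃ n) hk with rfl | rfl | rfl
    · exact A.not_le_line' hs.mem ht'.mem hk
    · exact A.not_le_first ht'.mem hk
    · exact A.not_le_second' hz.mem hk
  · rw [wedge_sub_const, ← A.wedge_third]
  · rw [A.left_eq]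
    exact add_mem (Subalgebra.algebraMap_mem _ _) (mul_mem (pow_mem hs.mem 2) hP.mem)
  · rw [map_sub, Derivation.map_algebraMap, sub_zero, A.derivation_third]
    exact sub_mem hQ.mem (mul_mem ht.mem hP.mem)

end IsArm

/-! ## The vector field -/

/-- A derivation of `ℂ(x, y)` is determined by arbitrary values on `x` and `y`. -/
theorem exists_derivation (f g : K) : ∃ δ : Derivation ℂ K K, δ x = f ∧ δ y = g := by
  let A := MvPolynomial (Fin 2) ℂ
  let d : Derivation ℂ A K := MvPolynomial.mkDerivation ℂ ![f, g]
  -- The differentials of `K` are the localisation of those of the polynomial ring, so a derivation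
  -- of the polynomial ring into `K` extends once nonzero polynomials act invertibly on `K`.
  let l : Ω[K⁄ℂ] →ₗ[A] K := IsLocalizedModule.lift (nonZeroDivisors A)
    (KaehlerDifferential.map ℂ ℂ A K) d.liftKaehlerDifferential (fun a => by
      rw [Module.End.isUnit_iff]
      have ha : algebraMap A K a ≠ 0 := IsFractionRing.to_map_ne_zero_of_mem_nonZeroDivisors a.2
      have e : ∀ k : K, algebraMap A (Module.End A K) a k = algebraMap A K a * k := fun k => by
        rw [Module.algebraMap_end_apply, Algebra.smul_def]
      refine ⟨fun p q h => ?_, fun k => ⟨(algebraMap A K a)⁻¹ * k, ?_⟩⟩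
      · rw [e, e] at h
        exact mul_left_cancel₀ ha h
      · rw [e, mul_inv_cancel_left₀ ha])
  let l' : Ω[K⁄ℂ] →ₗ[K] K := l.extendScalarsOfIsLocalization (nonZeroDivisors A) K
  have key : ∀ p : A, (l'.compDer (KaehlerDifferential.D ℂ K)) (algebraMap A K p) = d p := by
    intro p
    have h1 : l (KaehlerDifferential.map ℂ ℂ A K (KaehlerDifferential.D ℂ A p)) =
        d.liftKaehlerDifferential (KaehlerDifferential.D ℂ A p) :=
      IsLocalizedModule.lift_apply (nonZeroDivisors A) _ _ _ _
    rw [KaehlerDifferential.map_D, Derivation.liftKaehlerDifferential_comp_D] at h1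
    exact h1
  refine ⟨l'.compDer (KaehlerDifferential.D ℂ K), ?_, ?_⟩
  · exact (key _).trans (MvPolynomial.mkDerivation_X ℂ ![f, g] 0)
  · exact (key _).trans (MvPolynomial.mkDerivation_X ℂ ![f, g] 1)

theorem exists_isInceField (α c : ℂ) : ∃ δ, IsInceField α c δ := exists_derivation _ _

/-! ## The three points at infinity -/

theorem x_ne_zero : x ≠ 0 := isChart_xy.left_ne_zero

theorem y_ne_zero : y ≠ 0 := isChart_xy.right_ne_zero

/-- The local equation of the line at infinity. -/
def armU : Fin 3 → K := ![1 / x, 1 / x, 1 / y]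

/-- The affine coordinate of the line at infinity, centred at the three points. -/
def armV : Fin 3 → K := ![y / x - 1, y / x + 1, x / y]

/-- The positions of the third centres. -/
def armKappa (α c : ℂ) : Fin 3 → ℂ := ![(α - 2 * c) / 2, -((α + 2 * c) / 2), -(2 * c)]

/-- The index of the first exceptional curve. -/
def armFirst : Fin 3 → Fin 7 := ![1, 3, 5]

/-- The index of the second exceptional curve. -/
def armSecond : Fin 3 → Fin 7 := ![2, 4, 6]

theorem isChart_line : IsChart (1 / x) (y / x) := isChart_xy.div_left.inv_left

theorem isChart_arm (k : Fin 3) : IsChart (armU k) (armV k) := by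
  fin_cases k
  · simpa [armU, armV] using isChart_line.sub_const 1
  · simpa [armU, armV] using isChart_line.sub_const (-1)
  · exact isChart_xy.swap.div_left.inv_left

theorem boundary_first (k : Fin 3) :
    boundary (armFirst k) = planeCurve (armU k) (armV k / armU k) := by
  have hx := x_ne_zero
  have hy := y_ne_zero
  fin_cases k
  · change planeCurve (1 / x) (y - x) = planeCurve (1 / x) ((y / x - 1) / (1 / x))
    congr 1
    field_simp
  · change planeCurve (1 / x) (y + x) = planeCurve (1 / x) ((y / x + 1) / (1 / x))
    congr 1
    field_simp
  · change planeCurve (1 / y) x = planeCurve (1 / y) ((x / y) / (1 / y))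
    congr 1
    field_simp

theorem boundary_second (k : Fin 3) :
    boundary (armSecond k) = planeCurve (armU k) (armV k / armU k / armU k) := by
  have hx := x_ne_zero
  have hy := y_ne_zero
  fin_cases k
  · change planeCurve (1 / x) ((y - x) * x) = planeCurve (1 / x) ((y / x - 1) / (1 / x) / (1 / x))
    congr 1
    field_simp
  · change planeCurve (1 / x) ((y + x) * x) = planeCurve (1 / x) ((y / x + 1) / (1 / x) / (1 / x))
    congr 1
    field_simp
  · change planeCurve (1 / y) (x * y) = planeCurve (1 / y) ((x / y) / (1 / y) / (1 / y))
    congr 1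
    field_simp

/-- One inclusion suffices: the substitution `(u, v) ↦ (u / v, 1 / v)` is an involution. It
identifies the line at infinity in its two standard charts. -/
theorem IsChart.planeCurve_inv {u v : K} (h : IsChart u v) :
    planeCurve (u / v) (1 / v) = planeCurve u v := by
  have key : ∀ {u v : K}, IsChart u v → planeCurve (u / v) (1 / v) ≤ planeCurve u v := by
    intro u v h
    rw [one_div, div_eq_mul_inv]
    exact h.planeCurve_le (mul_mem_maxIdeal h.left_mem_maxIdeal h.inv_right_mem) h.inv_right_mem
      h.inv_sub_const_notMem_maxIdeal
  refine le_antisymm (key h) ?_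
  have h' : IsChart (u / v) (1 / v) := h.div_right.swap.inv_left.swap
  have := key h'
  have hv := h.right_ne_zero
  rwa [one_div_one_div, div_div, mul_one_div_cancel hv, div_one] at this

theorem boundary_line (k : Fin 3) : boundary 0 = planeCurve (armU k) (armV k) := by
  have hx := x_ne_zero
  have hy := y_ne_zero
  fin_cases k
  · change planeCurve (1 / x) (y / x) = planeCurve (1 / x) (y / x - 1)
    rw [← isChart_line.planeCurve_sub_const 1, map_one]
  · change planeCurve (1 / x) (y / x) = planeCurve (1 / x) (y / x + 1)
    rw [← isChart_line.planeCurve_sub_const (-1), map_neg, map_one, sub_neg_eq_add]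
  · change planeCurve (1 / x) (y / x) = planeCurve (1 / y) (x / y)
    rw [← isChart_line.planeCurve_inv]
    congr 1 <;> field_simp

theorem armU_mem_maxIdeal_first (k : Fin 3) : armU k ∈ maxIdeal (boundary (armFirst k)) := by
  rw [boundary_first]
  exact (isChart_arm k).div_left.left_mem_maxIdeal

theorem armU_mem_maxIdeal_second (k : Fin 3) : armU k ∈ maxIdeal (boundary (armSecond k)) := by
  rw [boundary_second]
  exact (isChart_arm k).div_left.div_left.left_mem_maxIdeal

theorem armV_mem_maxIdeal_first (k : Fin 3) : armV k ∈ maxIdeal (boundary (armFirst k)) := by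
  have := mul_mem_maxIdeal (armU_mem_maxIdeal_first k)
    (boundary_first k ▸ right_mem_planeCurve (armU k) (armV k / armU k))
  rwa [mul_div_cancel₀ _ (isChart_arm k).left_ne_zero] at this

theorem armV_mem_maxIdeal_second (k : Fin 3) : armV k ∈ maxIdeal (boundary (armSecond k)) := by
  have hu := (isChart_arm k).left_ne_zero
  have := mul_mem_maxIdeal (mul_mem_maxIdeal (armU_mem_maxIdeal_second k)
    (armU_mem_maxIdeal_second k).1)
    (boundary_second k ▸ right_mem_planeCurve (armU k) (armV k / armU k / armU k))
  rwa [mul_assoc, mul_div_cancel₀ _ hu, mul_div_cancel₀ _ hu] at this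

theorem eq_zero_or_arm (i : Fin 7) : i = 0 ∨ ∃ k, i = armFirst k ∨ i = armSecond k := by
  revert i
  decide

/-- A function vanishing at one of the three points has an inverse at the others which is
regular. -/
theorem inv_armV_mem {k l : Fin 3} (hkl : k ≠ l) :
    (armV l)⁻¹ ∈ planePoint (armU k) (armV k) 0 0 := by
  have hx := x_ne_zero
  have hy := y_ne_zero
  have hp := (isChart_arm k).isPoint 0 0
  have hv := (isChart_arm k).hasVal_right 0 0
  have h2 : cst 2 = 2 := map_ofNat _ 2
  have hc := hp.const 2
  rw [h2] at hc
  fin_cases k <;> fin_cases l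
  · exact absurd rfl hkl
  · refine inv_mem_of_hasVal hp ((hp.add hv hc).congr ?_ rfl) (by norm_num)
    change y / x + 1 = y / x - 1 + 2
    ring
  · refine ((hp.add hv hp.one).congr ?_ rfl).mem
    change (x / y)⁻¹ = y / x - 1 + 1
    rw [inv_div]
    ring
  · refine inv_mem_of_hasVal hp ((hp.sub hv hc).congr ?_ rfl) (by norm_num)
    change y / x - 1 = y / x + 1 - 2
    ring
  · exact absurd rfl hkl
  · refine ((hp.sub hv hp.one).congr ?_ rfl).mem
    change (x / y)⁻¹ = y / x + 1 - 1
    rw [inv_div]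
    ring
  · refine ((hp.div hv (hp.sub hp.one hv) (by norm_num)).congr ?_ rfl).mem
    change (y / x - 1)⁻¹ = x / y / (1 - x / y)
    rw [inv_eq_iff_eq_inv, inv_div]
    field_simp
  · refine ((hp.div hv (hp.add hp.one hv) (by norm_num)).congr ?_ rfl).mem
    change (y / x + 1)⁻¹ = x / y / (1 + x / y)
    rw [inv_eq_iff_eq_inv, inv_div]
    field_simp
  · exact absurd rfl hkl

theorem not_le_of_arm_ne {k l : Fin 3} (hkl : k ≠ l) {T : Subalgebra ℂ K}
    (hT : armV l ∈ maxIdeal T) : ¬ planePoint (armU k) (armV k) 0 0 ≤ T :=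
  not_le_of_mem_maxIdeal (isChart_arm l).right_ne_zero (inv_armV_mem hkl) hT

theorem wedge_line : (1 / x) ^ 3 • wedge x y = cst (-1) • wedge (1 / x) (y / x) := by
  have hx := x_ne_zero
  rw [wedge_inv_left, wedge_div_left hx, smul_smul, ← neg_smul, smul_smul]
  congr 1
  rw [map_neg, map_one]
  field_simp

/-- With `V = y / x` the field at infinity is `δ (1/x) = -V - c / x²`, `(1/x) δ V = (3/2)(1 - V²) +
(α/2) / x² - (c / x²) V`. The first two sets of constants come from expanding this at `V = ±1`,
where `e = ∓1`. The third comes from `δ (1/y) = 1/2 - (3/2)(x/y)² - (α/2) / y²` and its companion,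
where `e = 1/2`. In each case `κ` is read off from the coefficient `-e κ` of `u²` in `u δ v`. -/
theorem exists_isArm {α c : ℂ} {δ : Derivation ℂ K K} (hδ : IsInceField α c δ) (k : Fin 3) :
    ∃ w e a₁ a₂ a₃ b₁ b₂ b₃, IsArm boundary affineE6Mult δ (armU k) (armV k) (armKappa α c k)
      (armFirst k) (armSecond k) w e a₁ a₂ a₃ b₁ b₂ b₃ := by
  have hx := x_ne_zero
  have hy := y_ne_zero
  obtain ⟨h1, h2⟩ := hδ
  have other : ∀ j, j = 0 ∨ j = armFirst k ∨ j = armSecond k ∨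
      ¬ planePoint (armU k) (armV k) 0 0 ≤ boundary j := by
    intro j
    rcases eq_zero_or_arm j with h | ⟨l, hl⟩
    · exact Or.inl h
    by_cases hkl : k = l
    · subst hkl
      rcases hl with h | h
      · exact Or.inr (Or.inl h)
      · exact Or.inr (Or.inr (Or.inl h))
    · refine Or.inr (Or.inr (Or.inr (not_le_of_arm_ne hkl ?_)))
      rcases hl with rfl | rfl
      · exact armV_mem_maxIdeal_first l
      · exact armV_mem_maxIdeal_second l
  have t2 : cst 2 = 2 := map_ofNat _ 2
  have t3 : cst 3 = 3 := map_ofNat _ 3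
  have hD1 : δ (1 : K) = 0 := δ.map_one_eq_zero
  fin_cases k
  · refine ⟨-1, -1, -1, 0, -c, -(3 / 2), 0, -c, isChart_arm 0, boundary_line 0, boundary_first 0,
      boundary_second 0, rfl, rfl, rfl, by simp [affineE6, armFirst],
      by simp [affineE6, armFirst, armSecond], other, by norm_num, ?_, by norm_num,
      ?_, ?_⟩
    · change (1 / x) ^ 3 • wedge x y = cst (-1) • wedge (1 / x) (y / x - 1)
      rw [show y / x - 1 = y / x - cst 1 by simp, wedge_sub_const]
      exact wedge_line
    · change δ (1 / x) = cst (-1) + cst (-1) * (y / x - 1) + cst 0 * (y / x - 1) ^ 2 +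
        cst (-c) * (1 / x) ^ 2
      rw [Derivation.leibniz_div, hD1, h1]
      simp
      field_simp
      ring
    · change (1 / x) * δ (y / x - 1) = 3 * cst (-1) * (y / x - 1) +
        cst (-(3 / 2)) * (y / x - 1) ^ 2 + cst 0 * (y / x - 1) ^ 3 -
        cst (-1) * cst ((α - 2 * c) / 2) * (1 / x) ^ 2 + cst (-c) * (1 / x) ^ 2 * (y / x - 1)
      rw [map_sub, hD1, Derivation.leibniz_div, h1, h2]
      simp [t2, t3]
      field_simp
      ring
  · refine ⟨-1, 1, -1, 0, -c, -(3 / 2), 0, -c, isChart_arm 1, boundary_line 1, boundary_first 1,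
      boundary_second 1, rfl, rfl, rfl, by simp [affineE6, armFirst],
      by simp [affineE6, armFirst, armSecond], other, by norm_num, ?_, by norm_num,
      ?_, ?_⟩
    · change (1 / x) ^ 3 • wedge x y = cst (-1) • wedge (1 / x) (y / x + 1)
      rw [show y / x + 1 = y / x - cst (-1) by simp, wedge_sub_const]
      exact wedge_line
    · change δ (1 / x) = cst (1) + cst (-1) * (y / x + 1) + cst 0 * (y / x + 1) ^ 2 +
        cst (-c) * (1 / x) ^ 2
      rw [Derivation.leibniz_div, hD1, h1]
      simp
      field_simp
      ring
    · change (1 / x) * δ (y / x + 1) = 3 * cst 1 * (y / x + 1) +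
        cst (-(3 / 2)) * (y / x + 1) ^ 2 + cst 0 * (y / x + 1) ^ 3 -
        cst 1 * cst (-((α + 2 * c) / 2)) * (1 / x) ^ 2 + cst (-c) * (1 / x) ^ 2 * (y / x + 1)
      rw [map_add, hD1, Derivation.leibniz_div, h1, h2]
      simp [t2, t3]
      field_simp
      ring
  · refine ⟨1, 1 / 2, 0, -(3 / 2), -(α / 2), 0, -(3 / 2), -(α / 2), isChart_arm 2, boundary_line 2,
      boundary_first 2, boundary_second 2, rfl, rfl, rfl, by simp [affineE6, armFirst],
      by simp [affineE6, armFirst, armSecond], other, by norm_num,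
      ?_, by norm_num, ?_, ?_⟩
    · change (1 / y) ^ 3 • wedge x y = cst 1 • wedge (1 / y) (x / y)
      rw [wedge_inv_left, wedge_div_left hy, wedge_swap x y, smul_smul]
      simp only [smul_neg, neg_neg]
      rw [smul_smul]
      congr 1
      rw [map_one]
      field_simp
    · change δ (1 / y) = cst (1 / 2) + cst 0 * (x / y) + cst (-(3 / 2)) * (x / y) ^ 2 +
        cst (-(α / 2)) * (1 / y) ^ 2
      rw [Derivation.leibniz_div, hD1, h2]
      simp [t2, t3]
      field_simp
      ring
    · change (1 / y) * δ (x / y) = 3 * cst (1 / 2) * (x / y) +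
        cst 0 * (x / y) ^ 2 + cst (-(3 / 2)) * (x / y) ^ 3 -
        cst (1 / 2) * cst (-(2 * c)) * (1 / y) ^ 2 + cst (-(α / 2)) * (1 / y) ^ 2 * (x / y)
      rw [Derivation.leibniz_div, h1, h2]
      simp [t2, t3]
      field_simp
      ring

/-! ## The projective plane -/

/-- The points of the line at infinity other than `x = 0`. -/
def linePoint (m : ℂ) : Subalgebra ℂ K := planePoint (1 / x) (y / x - cst m) 0 0

/-- The three points at infinity which are blown up. -/
def armBase (k : Fin 3) : Subalgebra ℂ K := planePoint (armU k) (armV k) 0 0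

theorem isPoint_armBase (k : Fin 3) : IsPoint (armBase k) := (isChart_arm k).isPoint 0 0

theorem linePoint_eq (m : ℂ) : linePoint m = planePoint (1 / x) (y / x) 0 m :=
  (isChart_line.planePoint_translate_zero m).symm

theorem linePoint_one : linePoint 1 = armBase 0 := by
  change planePoint _ (y / x - cst 1) 0 0 = planePoint (1 / x) (y / x - 1) 0 0
  rw [map_one]

theorem linePoint_neg_one : linePoint (-1) = armBase 1 := by
  change planePoint _ (y / x - cst (-1)) 0 0 = planePoint (1 / x) (y / x + 1) 0 0
  rw [map_neg, map_one, sub_neg_eq_add]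

theorem isPoint_linePoint (m : ℂ) : IsPoint (linePoint m) := (isChart_line.sub_const m).isPoint 0 0

theorem isPoint_affine (a b : ℂ) : IsPoint (planePoint x y a b) := isChart_xy.isPoint a b

theorem hasVal_linePoint_left (m : ℂ) : HasVal (linePoint m) (1 / x) 0 :=
  (isChart_line.sub_const m).hasVal_left 0 0

theorem hasVal_linePoint_right (m : ℂ) : HasVal (linePoint m) (y / x) m :=
  ((isPoint_linePoint m).add ((isChart_line.sub_const m).hasVal_right 0 0)
    ((isPoint_linePoint m).const m)).congr (by ring) (by simp)

/-- Points of the two charts at infinity whose coordinate along the normal of the line is nonzero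
are affine. Of the remaining ones, only the origin of `(x/y, 1/y)` is invisible in `(1/x, y/x)`. -/
theorem mem_projectivePlane (R : Subalgebra ℂ K) : R ∈ projectivePlane ↔
    (∃ a b, R = planePoint x y a b) ∨ (∃ m, R = linePoint m) ∨ R = armBase 2 := by
  have hx := x_ne_zero
  have hy := y_ne_zero
  have h1 := isChart_line
  have h2 : IsChart (x / y) (1 / y) := isChart_xy.swap.div_left.inv_left.swap
  constructor
  · rintro ((⟨a, b, rfl⟩ | ⟨a, b, rfl⟩) | ⟨a, b, rfl⟩)
    · exact Or.inl ⟨a, b, rfl⟩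
    · rcases eq_or_ne a 0 with rfl | ha
      · exact Or.inr (Or.inl ⟨b, (linePoint_eq b).symm⟩)
      · have hp := h1.isPoint a b
        have hq := isPoint_affine (1 / a) (b / a)
        have ha' : (1 : ℂ) / a ≠ 0 := one_div_ne_zero ha
        refine Or.inl ⟨1 / a, b / a, h1.planePoint_eq isChart_xy ?_ ?_ ?_ ?_⟩
        · exact (hp.div hp.one (h1.hasVal_left a b) ha).congr (by field_simp) rfl
        · exact (hp.div (h1.hasVal_right a b) (h1.hasVal_left a b) ha).congr (by field_simp) rfl
        · exact (hq.div hq.one (isChart_xy.hasVal_left _ _) ha').congr rfl (by field_simp)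
        · exact (hq.div (isChart_xy.hasVal_right _ _) (isChart_xy.hasVal_left _ _) ha').congr rfl
            (by field_simp)
    · have hp := h2.isPoint a b
      rcases eq_or_ne b 0 with rfl | hb
      · rcases eq_or_ne a 0 with rfl | ha
        · exact Or.inr (Or.inr (h2.planePoint_swap 0 0))
        · have hq := h1.isPoint 0 (1 / a)
          have ha' : (1 : ℂ) / a ≠ 0 := one_div_ne_zero ha
          refine Or.inr (Or.inl ⟨1 / a, ?_⟩)
          rw [linePoint_eq]
          refine h2.planePoint_eq h1 ?_ ?_ ?_ ?_
          · exact (hp.div (h2.hasVal_right a 0) (h2.hasVal_left a 0) ha).congr (by field_simp)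
              (by simp)
          · exact (hp.div hp.one (h2.hasVal_left a 0) ha).congr (by field_simp) rfl
          · exact (hq.div hq.one (h1.hasVal_right _ _) ha').congr (by field_simp) (by field_simp)
          · exact (hq.div (h1.hasVal_left _ _) (h1.hasVal_right _ _) ha').congr (by field_simp)
              (by simp)
      · have hq := isPoint_affine (a / b) (1 / b)
        have hb' : (1 : ℂ) / b ≠ 0 := one_div_ne_zero hb
        refine Or.inl ⟨a / b, 1 / b, h2.planePoint_eq isChart_xy ?_ ?_ ?_ ?_⟩
        · exact (hp.div (h2.hasVal_left a b) (h2.hasVal_right a b) hb).congr (by field_simp) rfl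
        · exact (hp.div hp.one (h2.hasVal_right a b) hb).congr (by field_simp) rfl
        · exact (hq.div (isChart_xy.hasVal_left _ _) (isChart_xy.hasVal_right _ _) hb').congr rfl
            (by field_simp)
        · exact (hq.div hq.one (isChart_xy.hasVal_right _ _) hb').congr rfl (by field_simp)
  · rintro (⟨a, b, rfl⟩ | ⟨m, rfl⟩ | rfl)
    · exact Or.inl (Or.inl ⟨a, b, rfl⟩)
    · exact Or.inl (Or.inr ⟨0, m, linePoint_eq m⟩)
    · exact Or.inr ⟨0, 0, (h2.planePoint_swap 0 0).symm⟩

/-! ## The surface -/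

theorem armU_inv_mem_affine (k : Fin 3) (a b : ℂ) : (armU k)⁻¹ ∈ planePoint x y a b := by
  fin_cases k
  · change (1 / x)⁻¹ ∈ _
    simpa using (isChart_xy.hasVal_left a b).mem
  · change (1 / x)⁻¹ ∈ _
    simpa using (isChart_xy.hasVal_left a b).mem
  · change (1 / y)⁻¹ ∈ _
    simpa using (isChart_xy.hasVal_right a b).mem

theorem not_armBase_le_affine (k : Fin 3) (a b : ℂ) : ¬ armBase k ≤ planePoint x y a b := by
  have hp := isPoint_armBase k
  have hu : HasVal (armBase k) (armU k) 0 := (isChart_arm k).hasVal_left 0 0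
  -- With `u = 1 / f` one has `1 / (f - a) = u / (1 - a u)`, which is regular at infinity, while `f
  -- - a` vanishes at the affine point.
  have key : ∀ (f : K) (a : ℂ), armU k = 1 / f → f ≠ 0 → (f - cst a)⁻¹ ∈ armBase k := by
    intro f a hf hf0
    refine ((hp.div hu (hp.sub hp.one (hp.mul (hp.const a) hu)) (by norm_num)).congr ?_ rfl).mem
    rw [hf, inv_eq_iff_eq_inv, inv_div]
    field_simp
  have hx : ∀ (_ : armU k = 1 / x), ¬ armBase k ≤ planePoint x y a b := fun hf =>
    not_le_of_mem_maxIdeal (isChart_xy.swap.sub_const a).right_ne_zero (key x a hf x_ne_zero)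
      (isChart_xy.hasVal_left a b)
  fin_cases k
  · exact hx rfl
  · exact hx rfl
  · exact not_le_of_mem_maxIdeal (isChart_xy.sub_const b).right_ne_zero (key y b rfl y_ne_zero)
      (isChart_xy.hasVal_right a b)

theorem inv_armV_mem_linePoint {m : ℂ} (h1 : m ≠ 1) (h2 : m ≠ -1) (k : Fin 3) :
    (armV k)⁻¹ ∈ linePoint m := by
  have hp := isPoint_linePoint m
  have hv := hasVal_linePoint_right m
  fin_cases k
  · exact inv_mem_of_hasVal hp (hp.sub hv hp.one) (sub_ne_zero.2 h1)
  · exact inv_mem_of_hasVal hp (hp.add hv hp.one) (by rwa [Ne, add_eq_zero_iff_eq_neg])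
  · change (x / y)⁻¹ ∈ _
    rw [inv_div]
    exact hv.mem

theorem ArmPoint.isPoint {u v : K} {κ : ℂ} {R : Subalgebra ℂ K} (hR : ArmPoint u v κ R)
    (h : IsChart u v) : IsPoint R := by
  have h1 := h.div_left
  have hw := h1.div_left.sub_const κ
  cases hR with
  | corner₁ => exact h.div_right.isPoint 0 0
  | side₁ m hm => exact (h1.sub_const m).isPoint 0 0
  | corner₂ => exact h1.div_right.isPoint 0 0
  | side₂ m hm => exact (hw.sub_const m).isPoint 0 0
  | corner₃ => exact hw.div_right.isPoint 0 0
  | side₃ m => exact (hw.div_left.sub_const m).isPoint 0 0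

theorem armV_mem_maxIdeal {k : Fin 3} {κ : ℂ} {R : Subalgebra ℂ K}
    (hR : ArmPoint (armU k) (armV k) κ R) : armV k ∈ maxIdeal R :=
  hasVal_zero.1 (((isChart_arm k).hasVal_right 0 0).of_le (isPoint_armBase k)
    (hR.isPoint (isChart_arm k)) (hR.le (isChart_arm k)))

theorem armBase_not_le {k l : Fin 3} (hkl : k ≠ l) {κ : ℂ} {R : Subalgebra ℂ K}
    (hR : ArmPoint (armU l) (armV l) κ R) : ¬ armBase k ≤ R :=
  not_le_of_arm_ne hkl (armV_mem_maxIdeal hR)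

/-- Distinct points of the plane do not dominate one another. This is the separation hypothesis
under which the three successive blow-ups over a base point are described. -/
theorem eq_of_armBase_le {k : Fin 3} {R : Subalgebra ℂ K} (hR : R ∈ projectivePlane)
    (h : armBase k ≤ R) : R = armBase k := by
  rcases (mem_projectivePlane R).1 hR with ⟨a, b, rfl⟩ | ⟨m, rfl⟩ | rfl
  · exact absurd h (not_armBase_le_affine k a b)
  · have hp := isPoint_armBase k
    have hv : HasVal (armBase k) (armV k) 0 := (isChart_arm k).hasVal_right 0 0
    have key : (y / x - cst m)⁻¹ ∈ armBase k → False := fun hi =>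
      not_le_of_mem_maxIdeal (isChart_line.sub_const m).right_ne_zero hi
        (hasVal_linePoint_right m) h
    fin_cases k
    · by_contra hne
      refine key (inv_mem_of_hasVal hp ((hp.sub (hp.add hv hp.one) (hp.const m)).congr ?_ rfl) ?_)
      · change y / x - cst m = y / x - 1 + 1 - cst m
        ring
      · intro h0
        apply hne
        rw [show m = 1 by linear_combination -h0]
        exact linePoint_one
    · by_contra hne
      refine key (inv_mem_of_hasVal hp ((hp.sub (hp.sub hv hp.one) (hp.const m)).congr ?_ rfl) ?_)
      · change y / x - cst m = y / x + 1 - 1 - cst m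
        ring
      · intro h0
        apply hne
        rw [show m = -1 by linear_combination -h0]
        exact linePoint_neg_one
    · refine (key ?_).elim
      refine ((hp.div hv (hp.sub hp.one (hp.mul (hp.const m) hv)) (by norm_num)).congr ?_ rfl).mem
      change (y / x - cst m)⁻¹ = x / y / (1 - cst m * (x / y))
      have hx := x_ne_zero
      have hy := y_ne_zero
      rw [inv_eq_iff_eq_inv, inv_div]
      field_simp
  · by_cases hk : k = 2
    · rw [hk]
    · exact absurd h (not_le_of_arm_ne hk (hasVal_zero.1 ((isChart_arm 2).hasVal_right 0 0)))

/-- The three centres over one point of the line at infinity. -/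
def armCentres (α c : ℂ) (k : Fin 3) : List (Subalgebra ℂ K) :=
  [planePoint (armU k) (armV k) 0 0, planePoint (armU k) (armV k / armU k) 0 0,
    planePoint (armU k) (armV k / armU k / armU k - cst (armKappa α c k)) 0 0]

theorem centres_eq (α c : ℂ) :
    centres α c = armCentres α c 0 ++ armCentres α c 1 ++ armCentres α c 2 := by
  have hx := x_ne_zero
  have hy := y_ne_zero
  have third : ∀ (k : Fin 3) (s t : K), armU k = s → armV k / armU k / armU k = t →
      planePoint s t 0 (armKappa α c k) =
        planePoint (armU k) (armV k / armU k / armU k - cst (armKappa α c k)) 0 0 := by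
    rintro k s t rfl rfl
    exact (isChart_arm k).div_left.div_left.planePoint_translate_zero _
  have e1 : planePoint (1 / x) (y / x) 0 1 = planePoint (armU 0) (armV 0) 0 0 := by
    rw [← linePoint_eq, linePoint_one, armBase]
  have e2 : planePoint (1 / x) (y - x) 0 0 = planePoint (armU 0) (armV 0 / armU 0) 0 0 := by
    change _ = planePoint (1 / x) ((y / x - 1) / (1 / x)) 0 0
    congr 1
    field_simp
  have e3 := third 0 (1 / x) ((y - x) * x) rfl (by
    change (y / x - 1) / (1 / x) / (1 / x) = _
    field_simp)
  have e4 : planePoint (1 / x) (y / x) 0 (-1) = planePoint (armU 1) (armV 1) 0 0 := by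
    rw [← linePoint_eq, linePoint_neg_one, armBase]
  have e5 : planePoint (1 / x) (y + x) 0 0 = planePoint (armU 1) (armV 1 / armU 1) 0 0 := by
    change _ = planePoint (1 / x) ((y / x + 1) / (1 / x)) 0 0
    congr 1
    field_simp
  have e6 := third 1 (1 / x) ((y + x) * x) rfl (by
    change (y / x + 1) / (1 / x) / (1 / x) = _
    field_simp)
  have e8 : planePoint (1 / y) x 0 0 = planePoint (armU 2) (armV 2 / armU 2) 0 0 := by
    change _ = planePoint (1 / y) ((x / y) / (1 / y)) 0 0
    congr 1
    field_simp
  have e9 := third 2 (1 / y) (x * y) rfl (by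
    change (x / y) / (1 / y) / (1 / y) = _
    field_simp)
  have k0 : armKappa α c 0 = (α - 2 * c) / 2 := rfl
  have k1 : armKappa α c 1 = -((α + 2 * c) / 2) := rfl
  have k2 : armKappa α c 2 = -(2 * c) := rfl
  simp only [centres, armCentres, List.cons_append, List.nil_append]
  rw [← e1, ← e2, ← e3, ← e4, ← e5, ← e6, ← e8, ← e9, k0, k1, k2]
  rfl

theorem blowUps_append (S : Set (Subalgebra ℂ K)) (l l' : List (Subalgebra ℂ K)) :
    blowUps S (l ++ l') = blowUps (blowUps S l) l' := List.foldl_append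

theorem mem_blowUps_armCentres (α c : ℂ) {k : Fin 3} {S : Set (Subalgebra ℂ K)}
    (hS : ∀ R ∈ S, armBase k ≤ R → R = armBase k) (T : Subalgebra ℂ K) :
    T ∈ blowUps S (armCentres α c k) ↔ (T ∈ S ∧ T ≠ armBase k) ∨
      ArmPoint (armU k) (armV k) (armKappa α c k) T :=
  (isChart_arm k).mem_blowUps_arm hS _ T

theorem mem_blowUps_arm_zero (α c : ℂ) (T : Subalgebra ℂ K) :
    T ∈ blowUps projectivePlane (armCentres α c 0) ↔ (T ∈ projectivePlane ∧ T ≠ armBase 0) ∨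
      ArmPoint (armU 0) (armV 0) (armKappa α c 0) T :=
  mem_blowUps_armCentres α c (fun _ hR h => eq_of_armBase_le hR h) T

/-- The points over the first base point do not dominate the second one, because `armV 0` vanishes
on them while its inverse is regular at the second base point. The second triple of blow-ups
therefore leaves them untouched. -/
theorem mem_blowUps_arm_one (α c : ℂ) (T : Subalgebra ℂ K) :
    T ∈ blowUps projectivePlane (armCentres α c 0 ++ armCentres α c 1) ↔
      (T ∈ projectivePlane ∧ T ≠ armBase 0 ∧ T ≠ armBase 1) ∨
      ArmPoint (armU 0) (armV 0) (armKappa α c 0) T ∨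
      ArmPoint (armU 1) (armV 1) (armKappa α c 1) T := by
  rw [blowUps_append, mem_blowUps_armCentres, mem_blowUps_arm_zero]
  · constructor
    · rintro (⟨⟨h1, h2⟩ | h, h3⟩ | h)
      · exact Or.inl ⟨h1, h2, h3⟩
      · exact Or.inr (Or.inl h)
      · exact Or.inr (Or.inr h)
    · rintro (⟨h1, h2, h3⟩ | h | h)
      · exact Or.inl ⟨Or.inl ⟨h1, h2⟩, h3⟩
      · exact Or.inl ⟨Or.inr h, fun e => armBase_not_le (k := 1) (by decide) h e.ge⟩
      · exact Or.inr h
  · intro R hR h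
    rcases (mem_blowUps_arm_zero α c R).1 hR with hR | hR
    · exact eq_of_armBase_le hR.1 h
    · exact absurd h (armBase_not_le (k := 1) (by decide) hR)

theorem mem_surface_iff (α c : ℂ) (T : Subalgebra ℂ K) :
    T ∈ surface α c ↔ (T ∈ projectivePlane ∧ ∀ k, T ≠ armBase k) ∨
      ∃ k, ArmPoint (armU k) (armV k) (armKappa α c k) T := by
  rw [surface, centres_eq, blowUps_append, mem_blowUps_armCentres, mem_blowUps_arm_one]
  · constructor
    · rintro (⟨⟨h1, h2, h2'⟩ | h | h, h3⟩ | h)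
      · exact Or.inl ⟨h1, fun k => by fin_cases k <;> assumption⟩
      · exact Or.inr ⟨0, h⟩
      · exact Or.inr ⟨1, h⟩
      · exact Or.inr ⟨2, h⟩
    · rintro (⟨h1, h2⟩ | ⟨k, h⟩)
      · exact Or.inl ⟨Or.inl ⟨h1, h2 0, h2 1⟩, h2 2⟩
      · fin_cases k
        · exact Or.inl ⟨Or.inr (Or.inl h), fun e => armBase_not_le (k := 2) (by decide) h e.ge⟩
        · exact Or.inl ⟨Or.inr (Or.inr h), fun e => armBase_not_le (k := 2) (by decide) h e.ge⟩
        · exact Or.inr h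
  · intro R hR h
    rcases (mem_blowUps_arm_one α c R).1 hR with hR | hR | hR
    · exact eq_of_armBase_le hR.1 h
    · exact absurd h (armBase_not_le (k := 2) (by decide) hR)
    · exact absurd h (armBase_not_le (k := 2) (by decide) hR)

theorem mem_surface (α c : ℂ) (T : Subalgebra ℂ K) :
    T ∈ surface α c ↔ (∃ a b, T = planePoint x y a b) ∨
      (∃ m, m ≠ 1 ∧ m ≠ -1 ∧ T = linePoint m) ∨
      ∃ k, ArmPoint (armU k) (armV k) (armKappa α c k) T := by
  rw [mem_surface_iff, mem_projectivePlane]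
  refine (or_congr_left ⟨?_, ?_⟩).trans or_assoc
  · rintro ⟨h | ⟨m, rfl⟩ | h, hk⟩
    · exact Or.inl h
    · exact Or.inr ⟨m, by rintro rfl; exact hk 0 linePoint_one,
        by rintro rfl; exact hk 1 linePoint_neg_one, rfl⟩
    · exact absurd h (hk 2)
  · rintro (⟨a, b, rfl⟩ | ⟨m, h1, h2, rfl⟩)
    · exact ⟨Or.inl ⟨a, b, rfl⟩, fun k e => not_armBase_le_affine k a b e.ge⟩
    · refine ⟨Or.inr (Or.inl ⟨m, rfl⟩), fun k e => ?_⟩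
      have := inv_armV_mem_linePoint h1 h2 k
      rw [e] at this
      exact (hasVal_zero.1 ((isChart_arm k).hasVal_right 0 0)).2.elim (isChart_arm k).right_ne_zero
        fun h => h this

/-- Every member of the list is a point of the surface obtained by blowing up the earlier ones. -/
def AreCentres (S : Set (Subalgebra ℂ K)) (l : List (Subalgebra ℂ K)) : Prop :=
  ∀ (k : ℕ) (hk : k < l.length), l[k] ∈ blowUps S (l.take k)

theorem AreCentres.append {S : Set (Subalgebra ℂ K)} {l l' : List (Subalgebra ℂ K)}
    (h : AreCentres S l) (h' : AreCentres (blowUps S l) l') : AreCentres S (l ++ l') := by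
  intro k hk
  rw [List.take_append, blowUps_append]
  rcases lt_or_ge k l.length with hl | hl
  · rw [List.getElem_append_left hl, Nat.sub_eq_zero_of_le hl.le]
    exact h k hl
  · rw [List.getElem_append_right hl, List.take_of_length_le hl]
    exact h' _ _

theorem areCentres_armCentres (α c : ℂ) {k : Fin 3} {S : Set (Subalgebra ℂ K)}
    (hS : armBase k ∈ S) : AreCentres S (armCentres α c k) := by
  intro n hn
  have hn' : n < 3 := hn
  interval_cases n
  · exact hS
  · exact (isChart_arm k).second_centre_mem _
  · exact (isChart_arm k).third_centre_mem _ _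

/-- Every centre is a point of the surface constructed before. -/
theorem areCentres_centres (α c : ℂ) : AreCentres projectivePlane (centres α c) := by
  have h0 : armBase 0 ∈ projectivePlane :=
    (mem_projectivePlane _).2 (Or.inr (Or.inl ⟨1, linePoint_one.symm⟩))
  have h1 : armBase 1 ∈ projectivePlane :=
    (mem_projectivePlane _).2 (Or.inr (Or.inl ⟨-1, linePoint_neg_one.symm⟩))
  have h2 : armBase 2 ∈ projectivePlane := (mem_projectivePlane _).2 (Or.inr (Or.inr rfl))
  have hne : ∀ {k l : Fin 3}, k ≠ l → armBase k ≠ armBase l := fun hkl h =>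
    not_le_of_arm_ne hkl (hasVal_zero.1 ((isChart_arm _).hasVal_right 0 0)) h.le
  rw [centres_eq]
  exact ((areCentres_armCentres α c h0).append (areCentres_armCentres α c
    ((mem_blowUps_arm_zero α c _).2 (Or.inl ⟨h1, hne (by decide)⟩)))).append
    (areCentres_armCentres α c ((mem_blowUps_arm_one α c _).2
      (Or.inl ⟨h2, hne (by decide), hne (by decide)⟩)))

/-! ## The stratification of the surface -/

theorem IsChart.planePoint_translate_both {u v : K} (h : IsChart u v) (a b : ℂ) :
    IsChart (u - cst a) (v - cst b) ∧
      planePoint u v a b = planePoint (u - cst a) (v - cst b) 0 0 := by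
  have h' := (h.swap.sub_const a).swap
  refine ⟨h'.sub_const b, ?_⟩
  rw [h.planePoint_swap, h.swap.planePoint_translate b a a, sub_self, ← h'.planePoint_swap,
    h'.planePoint_translate_zero]

theorem not_affine_le_boundary (a b : ℂ) (i : Fin 7) : ¬ planePoint x y a b ≤ boundary i := by
  rcases eq_zero_or_arm i with rfl | ⟨k, rfl | rfl⟩
  · refine not_le_of_mem_maxIdeal isChart_line.left_ne_zero ?_ isChart_line.left_mem_maxIdeal
    exact armU_inv_mem_affine 0 a b
  · exact not_le_of_mem_maxIdeal (isChart_arm k).left_ne_zero (armU_inv_mem_affine k a b)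
      (armU_mem_maxIdeal_first k)
  · exact not_le_of_mem_maxIdeal (isChart_arm k).left_ne_zero (armU_inv_mem_affine k a b)
      (armU_mem_maxIdeal_second k)

theorem eq_zero_of_linePoint_le {m : ℂ} (h1 : m ≠ 1) (h2 : m ≠ -1) {i : Fin 7}
    (h : linePoint m ≤ boundary i) : i = 0 := by
  rcases eq_zero_or_arm i with rfl | ⟨k, rfl | rfl⟩
  · rfl
  · exact absurd h (not_le_of_mem_maxIdeal (isChart_arm k).right_ne_zero
      (inv_armV_mem_linePoint h1 h2 k) (armV_mem_maxIdeal_first k))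
  · exact absurd h (not_le_of_mem_maxIdeal (isChart_arm k).right_ne_zero
      (inv_armV_mem_linePoint h1 h2 k) (armV_mem_maxIdeal_second k))

section VectorField

variable {α c : ℂ} {δ : Derivation ℂ K K}

theorem IsInceField.affine_isInterior (hδ : IsInceField α c δ) (a b : ℂ) :
    IsInterior boundary δ (planePoint x y a b) := by
  have hp := isPoint_affine a b
  have hx := (isChart_xy.hasVal_left a b).mem
  have hy := (isChart_xy.hasVal_right a b).mem
  have hc : ∀ z, cst z ∈ planePoint x y a b := Subalgebra.algebraMap_mem _
  have t2 : cst (3 / 2) = 3 / 2 := by simp [map_ofNat cst 3, map_ofNat cst 2]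
  have t3 : cst (1 / 2) = 1 / 2 := by simp [map_ofNat cst 2]
  obtain ⟨h1, h2⟩ := isChart_xy.planePoint_translate_both a b
  refine ⟨_, _, h1, h2, not_affine_le_boundary a b, ⟨1, one_ne_zero, ?_⟩, ?_, ?_⟩
  · rw [map_one, one_smul, wedge_sub_const, wedge_swap y (x - cst a), wedge_sub_const,
      ← wedge_swap]
  · rw [map_sub, Derivation.map_algebraMap, sub_zero, hδ.1]
    exact add_mem (mul_mem hx hy) (hc c)
  · rw [map_sub, Derivation.map_algebraMap, sub_zero, hδ.2, ← t2, ← t3]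
    exact add_mem (sub_mem (mul_mem (hc _) (pow_mem hx 2)) (mul_mem (hc _) (pow_mem hy 2))) (hc _)

/-- The value of `(1/x) δ (y/x)` at the point `m` of the line at infinity is `(3/2)(1 - m²)`, so
only the blown-up points `m = ±1` of this chart have to be excluded. -/
theorem IsInceField.linePoint_isSmoothBoundary (hδ : IsInceField α c δ) {m : ℂ} (h1 : m ≠ 1)
    (h2 : m ≠ -1) : IsSmoothBoundary boundary affineE6Mult δ (linePoint m) := by
  have hx := x_ne_zero
  have h := isChart_line.sub_const m
  have hp := isPoint_linePoint m
  have hs := hasVal_linePoint_left m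
  have hv := hasVal_linePoint_right m
  have hD1 : δ (1 : K) = 0 := δ.map_one_eq_zero
  refine ⟨0, 1 / x, y / x - cst m, h, rfl, ?_, fun j hj => eq_zero_of_linePoint_le h1 h2 hj,
    ⟨-1, by norm_num, ?_⟩, ⟨δ (1 / x), ?_, mul_comm _ _⟩, 3 / 2 * (1 - m ^ 2), ?_, ?_⟩
  · exact (isChart_line.planeCurve_sub_const m).symm
  · rw [wedge_sub_const]
    exact wedge_line
  · have : δ (1 / x) = -(y / x + cst c * (1 / x) * (1 / x)) := by
      rw [Derivation.leibniz_div, hD1, hδ.1]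
      simp
      field_simp
    rw [this]
    exact (hp.neg (hp.add hv (hp.mul (hp.mul (hp.const c) hs) hs))).mem
  · have : 1 - m ^ 2 ≠ 0 := by
      intro h0
      have : (1 - m) * (1 + m) = 0 := by linear_combination h0
      rcases mul_eq_zero.1 this with h | h
      · exact h1 (by linear_combination -h)
      · exact h2 (by linear_combination h)
    simpa using this
  · refine (hp.sub (hp.add (hp.mul (hp.const (3 / 2)) (hp.sub hp.one (hp.mul hv hv)))
      (hp.mul (hp.const (α / 2)) (hp.mul hs hs)))
      (hp.mul (hp.mul (hp.const c) (hp.mul hs hs)) hv)).congr ?_ (by ring)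
    have t2 : cst 2 = 2 := map_ofNat _ 2
    have t3 : cst 3 = 3 := map_ofNat _ 3
    rw [map_sub, Derivation.map_algebraMap, Derivation.leibniz_div, hδ.1, hδ.2]
    simp [t2, t3]
    field_simp
    ring

/-- Every point of the surface is of one of the three kinds. -/
theorem IsInceField.stratification (hδ : IsInceField α c δ) {R : Subalgebra ℂ K}
    (hR : R ∈ surface α c) : IsInterior boundary δ R ∨
      IsSmoothBoundary boundary affineE6Mult δ R ∨ IsCorner boundary affineE6Mult δ R := by
  rcases (mem_surface α c R).1 hR with ⟨a, b, rfl⟩ | ⟨m, h1, h2, rfl⟩ | ⟨k, hk⟩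
  · exact Or.inl (hδ.affine_isInterior a b)
  · exact Or.inr (Or.inl (hδ.linePoint_isSmoothBoundary h1 h2))
  · obtain ⟨w, e, a₁, a₂, a₃, b₁, b₂, b₃, A⟩ := exists_isArm hδ k
    cases hk with
    | corner₁ => exact Or.inr (Or.inr A.corner₁_isCorner)
    | side₁ m hm => exact Or.inr (Or.inl (A.side₁_isSmoothBoundary hm))
    | corner₂ => exact Or.inr (Or.inr A.corner₂_isCorner)
    | side₂ m hm => exact Or.inr (Or.inl (A.side₂_isSmoothBoundary hm))
    | corner₃ => exact Or.inr (Or.inl A.corner₃_isSmoothBoundary)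
    | side₃ m => exact Or.inl (A.side₃_isInterior m)

end VectorField

/-! ## The anticanonical divisor and the vector field near the boundary -/

theorem prod_ite_pow {ι : Type*} [Fintype ι] [DecidableEq ι] (i j : ι) (hij : i ≠ j) (s t : K)
    (m : ι → ℕ) :
    ∏ k, (if k = i then s else if k = j then t else 1) ^ m k = s ^ m i * t ^ m j := by
  have : ∀ k, (if k = i then s else if k = j then t else 1) ^ m k =
      (if k = i then s ^ m i else 1) * (if k = j then t ^ m j else 1) := by
    intro k
    by_cases h : k = i
    · subst h
      simp [hij]
    · by_cases h' : k = j
      · subst h'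
        simp [h]
      · simp [h, h']
  simp only [this, Finset.prod_mul_distrib, Finset.prod_ite_eq', Finset.mem_univ, if_true]

theorem prod_ite {ι : Type*} [Fintype ι] [DecidableEq ι] (i j : ι) (hij : i ≠ j) (s t : K) :
    ∏ k, (if k = i then s else if k = j then t else 1) = s * t := by
  simpa using prod_ite_pow i j hij s t 1

section Strata

variable {D : Fin 7 → Subalgebra ℂ K} {m : Fin 7 → ℕ} {δ : Derivation ℂ K K} {R : Subalgebra ℂ K}

theorem IsInterior.areLocalEquations (h : IsInterior D δ R) : AreLocalEquations D R 1 := by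
  obtain ⟨s, t, -, -, h, -⟩ := h
  exact fun i => ⟨fun hi => absurd hi (h i), fun _ => rfl⟩

theorem areLocalEquations_of_chart {i j : Fin 7} {s t : K} (h : IsChart s t)
    (hi : D i = planeCurve s t)
    (hk : ∀ k, planePoint s t 0 0 ≤ D k → k = i ∨ k = j) (hj : D j = planeCurve t s) :
    AreLocalEquations D (planePoint s t 0 0)
      (fun k => if k = i then s else if k = j then t else 1) := by
  intro k
  dsimp only
  refine ⟨fun hle => ?_, fun hle => ?_⟩
  · by_cases h1 : k = i
    · rw [if_pos h1, h1, hi]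
      exact h.isLocalEquation
    · obtain rfl := (hk k hle).resolve_left h1
      rw [if_neg h1, if_pos rfl, hj]
      exact h.isLocalEquation_right
  · have h1 : k ≠ i := by
      rintro rfl
      exact hle (hi ▸ h.planePoint_le_planeCurve)
    have h2 : k ≠ j := by
      rintro rfl
      exact hle (hj ▸ h.planePoint_le_planeCurve_right)
    rw [if_neg h1, if_neg h2]

theorem areLocalEquations_single {i : Fin 7} {s t : K} (h : IsChart s t)
    (hi : D i = planeCurve s t) (hk : ∀ k, planePoint s t 0 0 ≤ D k → k = i) :
    AreLocalEquations D (planePoint s t 0 0) (Function.update 1 i s) := by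
  intro k
  by_cases h1 : k = i
  · subst h1
    rw [Function.update_self, hi]
    exact ⟨fun _ => h.isLocalEquation, fun hle => absurd h.planePoint_le_planeCurve hle⟩
  · rw [Function.update_of_ne h1]
    exact ⟨fun hle => absurd (hk k hle) h1, fun _ => rfl⟩

theorem prod_update_pow (i : Fin 7) (s : K) (m : Fin 7 → ℕ) :
    ∏ k, (Function.update (1 : Fin 7 → K) i s k) ^ m k = s ^ m i := by
  rw [Finset.prod_eq_single i]
  · simp
  · intro k _ hk
    simp [Function.update_of_ne hk]
  · simp

theorem prod_update (i : Fin 7) (s : K) :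
    ∏ k, Function.update (1 : Fin 7 → K) i s k = s := by
  simpa using prod_update_pow i s 1

theorem isAnticanonical_of_strata {S : Set (Subalgebra ℂ K)}
    (hS : ∀ R ∈ S, IsInterior D δ R ∨ IsSmoothBoundary D m δ R ∨ IsCorner D m δ R) :
    IsAnticanonical S D m := by
  intro R hR
  have hw : ∀ w : ℂ, w ≠ 0 → cst w ≠ 0 ∧ cst w ∈ R ∧ (cst w)⁻¹ ∈ R := fun w hw =>
    ⟨by simpa using hw, R.algebraMap_mem w, by rw [← map_inv₀]; exact R.algebraMap_mem _⟩
  rcases hS R hR with h | h | h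
  · refine ⟨1, h.areLocalEquations, ?_⟩
    obtain ⟨s, t, hst, rfl, -, ⟨w, hw0, e⟩, -⟩ := h
    exact ⟨s, t, hst.isCoordinates, cst w, (hw w hw0).1, (hw w hw0).2.1, (hw w hw0).2.2,
      by simpa using e⟩
  · obtain ⟨i, s, t, hst, rfl, hi, hk, ⟨w, hw0, e⟩, -⟩ := h
    exact ⟨_, areLocalEquations_single hst hi hk, s, t, hst.isCoordinates, cst w, (hw w hw0).1,
      (hw w hw0).2.1, (hw w hw0).2.2, by rw [prod_update_pow, e]⟩
  · obtain ⟨i, j, s, t, hij, hst, rfl, hi, hj, hk, ⟨w, hw0, e⟩, -⟩ := h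
    exact ⟨_, areLocalEquations_of_chart hst hi hk hj, s, t, hst.isCoordinates, cst w,
      (hw w hw0).1, (hw w hw0).2.1, (hw w hw0).2.2, by rw [prod_ite_pow i j hij.ne, e]⟩

theorem hasLogPoles_of_strata {S : Set (Subalgebra ℂ K)}
    (hS : ∀ R ∈ S, IsInterior D δ R ∨ IsSmoothBoundary D m δ R ∨ IsCorner D m δ R) :
    HasLogPoles δ S D := by
  intro R hR
  rcases hS R hR with h | h | h
  · refine ⟨1, h.areLocalEquations, ?_⟩
    obtain ⟨s, t, hst, rfl, hk, -, h1, h2⟩ := h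
    refine ⟨?_, fun i hi => absurd hi (hk i)⟩
    have := hst.mul_derivation_mem (h := 1) δ (by simpa using h1) (by simpa using h2)
    simpa using this
  · obtain ⟨i, s, t, hst, rfl, hi, hk, -, ⟨a, ha, h1⟩, z, -, h2⟩ := h
    refine ⟨_, areLocalEquations_single hst hi hk, ?_⟩
    rw [prod_update]
    refine ⟨hst.mul_derivation_mem δ ?_ h2.mem, fun k hle => ⟨a, ha, ?_⟩⟩
    · rw [h1]
      exact mul_mem ha (hst.hasVal_left 0 0).mem
    · rw [hk k hle, Function.update_self, h1]
  · obtain ⟨i, j, s, t, hij, hst, rfl, hi, hj, hk, -, ⟨a, ha, h1⟩, b, z, hz, hb, h2⟩ := h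
    refine ⟨_, areLocalEquations_of_chart hst hi hk hj, ?_⟩
    rw [prod_ite i j hij.ne]
    refine ⟨hst.mul_derivation_mem δ ?_ ?_, fun k hle => ?_⟩
    · rw [h1]
      exact mul_mem ha (hst.hasVal_left 0 0).mem
    · rw [h2]
      exact mul_mem hb.mem (hst.hasVal_right 0 0).mem
    · rcases hk k hle with rfl | rfl
      · exact ⟨a, ha, by rw [if_pos rfl, h1]⟩
      · exact ⟨b, hb.mem, by rw [if_neg hij.ne', if_pos rfl, h2]⟩

theorem IsInterior.isRegularAt (h : IsInterior D δ R) : IsRegularAt δ R := by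
  obtain ⟨s, t, hst, rfl, hk, -, h1, h2⟩ := h
  have := hst.mul_derivation_mem (h := 1) δ (by simpa using h1) (by simpa using h2)
  intro r hr
  simpa using this r hr

/-- If `δ t` were regular, `s δ t` would vanish at the point together with `s`. -/
theorem IsSmoothBoundary.not_isRegularAt (h : IsSmoothBoundary D m δ R) : ¬ IsRegularAt δ R := by
  obtain ⟨i, s, t, hst, rfl, hi, hk, -, -, z, hz, h2⟩ := h
  intro hr
  have hp := hst.isPoint 0 0
  obtain ⟨w, hw⟩ := hp.hasVal (hr t (hst.hasVal_right 0 0).mem)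
  have := hp.unique h2 (hp.mul (hst.hasVal_left 0 0) hw)
  exact hz (by simpa using this)

theorem IsCorner.not_isRegularAt (h : IsCorner D m δ R) : ¬ IsRegularAt δ R := by
  obtain ⟨i, j, s, t, hij, hst, rfl, hi, hj, hk, -, -, b, z, hz, hb, h2⟩ := h
  intro hr
  have hp := hst.isPoint 0 0
  obtain ⟨w, hw⟩ := hp.hasVal (hr t (hst.hasVal_right 0 0).mem)
  have e : s * δ t = b := mul_right_cancel₀ hst.right_ne_zero (by rw [← h2]; ring)
  have := hp.unique hb (e ▸ hp.mul (hst.hasVal_left 0 0) hw)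
  exact hz (by simpa using this)

theorem IsSmoothBoundary.exists_le (h : IsSmoothBoundary D m δ R) : ∃ i, R ≤ D i := by
  obtain ⟨i, s, t, hst, rfl, hi, -⟩ := h
  exact ⟨i, hi ▸ hst.planePoint_le_planeCurve⟩

theorem IsCorner.exists_le (h : IsCorner D m δ R) :
    ∃ i j, i ≠ j ∧ R ≤ D i ∧ R ≤ D j := by
  obtain ⟨i, j, s, t, hij, hst, rfl, hi, hj, -⟩ := h
  exact ⟨i, j, hij.ne, hi ▸ hst.planePoint_le_planeCurve, hj ▸ hst.planePoint_le_planeCurve_right⟩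

/-- The condition does not depend on the coordinates. The equation `x₁` is a multiple of `s`, so `s
δ x₁` vanishes at `R`; as `s` is a multiple of `x₁`, accessibility makes `s δ x₂` vanish too.
Writing `t = p x₁ + q x₂`, with `s δ` preserving the local ring, `s δ t` would vanish, against its
value `z ≠ 0`. -/
theorem IsSmoothBoundary.not_isAccessible (h : IsSmoothBoundary D m δ R)
    (S : Set (Subalgebra ℂ K)) : ¬ IsAccessible δ S D R := by
  obtain ⟨i, s, t, hst, rfl, hi, hk, -, ⟨a, ha, h1⟩, z, hz, h2⟩ := h
  rintro ⟨-, i', hi', -, x₁, x₂, hx₁, hx, hacc⟩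
  obtain rfl := hk i' hi'
  have hp := hst.isPoint 0 0
  have hs := hst.hasVal_left 0 0
  have ht := hst.hasVal_right 0 0
  have hlog := hst.mul_derivation_mem δ (by rw [h1]; exact mul_mem ha hs.mem) h2.mem
  rw [hi] at hx₁
  obtain ⟨b, hb, e1⟩ := (hx₁.2 s hs.mem).1 hst.left_mem_maxIdeal
  obtain ⟨b', hb', e2⟩ := (hst.isLocalEquation.2 x₁ hx₁.1).1
    ((hx₁.2 x₁ hx₁.1).2 ⟨1, one_mem _, by simp⟩)
  have hx₁0 : HasVal (planePoint s t 0 0) x₁ 0 :=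
    hasVal_zero.2 ((hx.2.2 x₁).2 ⟨1, one_mem _, 0, zero_mem _, by simp⟩)
  have hx₂0 : HasVal (planePoint s t 0 0) x₂ 0 :=
    hasVal_zero.2 ((hx.2.2 x₂).2 ⟨0, zero_mem _, 1, one_mem _, by simp⟩)
  obtain ⟨p, hpR, q, hqR, e3⟩ := (hx.2.2 t).1 (hasVal_zero.1 ht)
  obtain ⟨vp, hvp⟩ := hp.hasVal hpR
  obtain ⟨vq, hvq⟩ := hp.hasVal hqR
  obtain ⟨vp', hvp'⟩ := hp.hasVal (hlog p hpR)
  obtain ⟨vq', hvq'⟩ := hp.hasVal (hlog q hqR)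
  obtain ⟨vb, hvb⟩ := hp.hasVal hb
  obtain ⟨vd, hvd⟩ := hp.hasVal (add_mem (hlog b' hb') (mul_mem hb' ha))
  have h4 : HasVal (planePoint s t 0 0) (s * δ x₁) 0 := by
    refine (hp.mul hvd hs).congr ?_ (by simp)
    rw [e2, Derivation.leibniz, smul_eq_mul, smul_eq_mul]
    linear_combination b' * h1
  have h5 : HasVal (planePoint s t 0 0) (s * δ x₂) 0 :=
    (hp.mul hvb (hasVal_zero.2 hacc)).congr (by rw [← mul_assoc, ← e1]) (by simp)
  have h6 : HasVal (planePoint s t 0 0) (s * δ t) 0 := by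
    refine (hp.add (hp.add (hp.mul hvp' hx₁0) (hp.mul hvp h4)) (hp.add (hp.mul hvq' hx₂0)
      (hp.mul hvq h5))).congr ?_ (by simp)
    rw [e3, map_add, Derivation.leibniz, Derivation.leibniz]
    simp only [smul_eq_mul]
    ring
  exact hz (hp.unique h2 h6)

theorem not_isAccessible_of_strata {S : Set (Subalgebra ℂ K)}
    (hS : ∀ R ∈ S, IsInterior D δ R ∨ IsSmoothBoundary D m δ R ∨ IsCorner D m δ R)
    (R : Subalgebra ℂ K) : ¬ IsAccessible δ S D R := by
  intro hacc
  obtain ⟨hR, i, hi, huniq, -⟩ := id hacc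
  rcases hS R hR with h | h | h
  · obtain ⟨s, t, -, -, hk, -⟩ := h
    exact hk i hi
  · exact h.not_isAccessible S hacc
  · obtain ⟨j, k, hjk, hj, hk⟩ := h.exists_le
    exact hjk ((huniq j hj).trans (huniq k hk).symm)

theorem isRegularAt_iff_of_strata
    (hR : IsInterior D δ R ∨ IsSmoothBoundary D m δ R ∨ IsCorner D m δ R) :
    IsRegularAt δ R ↔ ∀ i, ¬ R ≤ D i := by
  rcases hR with h | h | h
  · refine ⟨fun _ => ?_, fun _ => h.isRegularAt⟩
    obtain ⟨s, t, -, -, hk, -⟩ := h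
    exact hk
  · obtain ⟨i, hi⟩ := h.exists_le
    exact ⟨fun hr => absurd hr h.not_isRegularAt, fun hn => absurd hi (hn i)⟩
  · obtain ⟨i, -, -, hi, -⟩ := h.exists_le
    exact ⟨fun hr => absurd hr h.not_isRegularAt, fun hn => absurd hi (hn i)⟩

theorem exists_chart_of_le
    (hR : IsInterior D δ R ∨ IsSmoothBoundary D m δ R ∨ IsCorner D m δ R) {i : Fin 7}
    (hi : R ≤ D i) : ∃ s t, IsChart s t ∧ R = planePoint s t 0 0 ∧ D i = planeCurve s t := by
  rcases hR with h | h | h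
  · obtain ⟨s, t, -, -, hk, -⟩ := h
    exact absurd hi (hk i)
  · obtain ⟨j, s, t, hst, rfl, hj, hk, -⟩ := h
    obtain rfl := hk i hi
    exact ⟨s, t, hst, rfl, hj⟩
  · obtain ⟨j, k, s, t, -, hst, rfl, hj, hk, huniq, -⟩ := h
    rcases huniq i hi with rfl | rfl
    · exact ⟨s, t, hst, rfl, hj⟩
    · exact ⟨t, s, hst.swap, hst.planePoint_swap 0 0, hk⟩

theorem adj_of_le (hR : IsInterior D δ R ∨ IsSmoothBoundary D m δ R ∨ IsCorner D m δ R)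
    {i j : Fin 7} (hij : i ≠ j) (hi : R ≤ D i) (hj : R ≤ D j) : affineE6.Adj i j := by
  rcases hR with h | h | h
  · obtain ⟨s, t, -, -, hk, -⟩ := h
    exact absurd hi (hk i)
  · obtain ⟨k, s, t, -, -, -, hk, -⟩ := h
    exact absurd ((hk i hi).trans (hk j hj).symm) hij
  · obtain ⟨k, l, s, t, hkl, -, -, -, -, huniq, -⟩ := h
    rcases huniq i hi with rfl | rfl <;> rcases huniq j hj with rfl | rfl
    · exact absurd rfl hij
    · exact hkl
    · exact hkl.symm
    · exact absurd rfl hij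

end Strata

/-! ## The points on the boundary curves -/

namespace IsArm

variable {D : Fin 7 → Subalgebra ℂ K} {m : Fin 7 → ℕ} {δ : Derivation ℂ K K} {u v : K}
    {κ : ℂ} {i j : Fin 7} {w e a₁ a₂ a₃ b₁ b₂ b₃ : ℂ} {R : Subalgebra ℂ K}

/-- `v / u` has a pole along the line at infinity, and it is regular at every point over the base
point except the first corner. -/
theorem eq_corner₁ (A : IsArm D m δ u v κ i j w e a₁ a₂ a₃ b₁ b₂ b₃) (hR : ArmPoint u v κ R)
    (h : R ≤ D 0) : R = planePoint (u / v) v 0 0 := by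
  have hu := (hR.le A.chart) (A.chart.hasVal_left 0 0).mem
  have h1 := A.chart.div_left
  have hw := h1.div_left.sub_const κ
  have key : v / u / u - cst κ ∈ R → False := fun hm => by
    refine A.not_le_line' hu ?_ h
    simpa using add_mem hm (R.algebraMap_mem κ)
  cases hR with
  | corner₁ => rfl
  | side₁ n hn => exact absurd h (A.not_le_line (A.chart.hasVal_blowUp_slope n).mem)
  | corner₂ => exact absurd h (A.not_le_line (h1.div_right.hasVal_right 0 0).mem)
  | side₂ n hn =>
    refine (key ?_).elim
    simpa using add_mem ((hw.sub_const n).hasVal_right 0 0).mem (Subalgebra.algebraMap_mem _ n)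
  | corner₃ => exact (key (hw.div_right.hasVal_right 0 0).mem).elim
  | side₃ n =>
    refine (key ?_).elim
    simpa [mul_div_cancel₀ _ A.chart.left_ne_zero] using
      mul_mem hu (hw.hasVal_blowUp_slope n).mem

theorem mem_first (A : IsArm D m δ u v κ i j w e a₁ a₂ a₃ b₁ b₂ b₃) (hR : ArmPoint u v κ R)
    (h : R ≤ D i) : R = planePoint (u / v) v 0 0 ∨
      R = planePoint (u / (v / u)) (v / u) 0 0 ∨
      ∃ n, n ≠ 0 ∧ R = planePoint u (v / u - cst n) 0 0 := by
  have hu := (hR.le A.chart) (A.chart.hasVal_left 0 0).mem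
  have h1 := A.chart.div_left
  have hw := h1.div_left.sub_const κ
  have key : v / u / u - cst κ ∈ R → False := fun hm => by
    refine A.not_le_first ?_ h
    simpa using add_mem hm (R.algebraMap_mem κ)
  cases hR with
  | corner₁ => exact Or.inl rfl
  | side₁ n hn => exact Or.inr (Or.inr ⟨n, hn, rfl⟩)
  | corner₂ => exact Or.inr (Or.inl rfl)
  | side₂ n hn =>
    refine (key ?_).elim
    simpa using add_mem ((hw.sub_const n).hasVal_right 0 0).mem (Subalgebra.algebraMap_mem _ n)
  | corner₃ => exact (key (hw.div_right.hasVal_right 0 0).mem).elim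
  | side₃ n =>
    refine (key ?_).elim
    simpa [mul_div_cancel₀ _ A.chart.left_ne_zero] using
      mul_mem hu (hw.hasVal_blowUp_slope n).mem

theorem mem_second (A : IsArm D m δ u v κ i j w e a₁ a₂ a₃ b₁ b₂ b₃) (hR : ArmPoint u v κ R)
    (h : R ≤ D j) : R = planePoint (u / (v / u)) (v / u) 0 0 ∨
      R = planePoint (u / (v / u / u - cst κ)) (v / u / u - cst κ) 0 0 ∨
      ∃ n, n ≠ 0 ∧ R = planePoint u (v / u / u - cst κ - cst n) 0 0 := by
  have h1 := A.chart.div_left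
  have hw := h1.div_left.sub_const κ
  cases hR with
  | corner₁ => exact absurd h (A.not_le_second (A.chart.div_right.hasVal_left 0 0).mem)
  | side₁ n hn =>
    refine absurd h (A.not_le_second ?_)
    rw [← inv_div v u]
    exact inv_mem_of_hasVal ((h1.sub_const n).isPoint 0 0) (A.chart.hasVal_blowUp_slope n) hn
  | corner₂ => exact Or.inl rfl
  | side₂ n hn => exact Or.inr (Or.inr ⟨n, hn, rfl⟩)
  | corner₃ => exact Or.inr (Or.inl rfl)
  | side₃ n => exact absurd h (A.not_le_second' (hw.hasVal_blowUp_slope n).mem)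

theorem eq_corner₂ (A : IsArm D m δ u v κ i j w e a₁ a₂ a₃ b₁ b₂ b₃) (hR : ArmPoint u v κ R)
    (h : R ≤ D i) (h' : R ≤ D j) : R = planePoint (u / (v / u)) (v / u) 0 0 := by
  rcases A.mem_first hR h with rfl | h | ⟨n, hn, rfl⟩
  · exact absurd h' (A.not_le_second (A.chart.div_right.hasVal_left 0 0).mem)
  · exact h
  · refine absurd h' (A.not_le_second ?_)
    rw [← inv_div v u]
    exact inv_mem_of_hasVal ((A.chart.div_left.sub_const n).isPoint 0 0)
      (A.chart.hasVal_blowUp_slope n) hn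

theorem meet_line_first {S : Set (Subalgebra ℂ K)}
    (A : IsArm D m δ u v κ i j w e a₁ a₂ a₃ b₁ b₂ b₃) (hS : ∀ R, ArmPoint u v κ R → R ∈ S)
    (h : ∀ R ∈ S, R ≤ D i → ArmPoint u v κ R) : MeetOnceTransversally S (D 0) (D i) := by
  have := meetOnceTransversally_of (S := S) A.chart.div_right (hS _ .corner₁)
  rw [A.chart.planeCurve_div, A.chart.planeCurve_exchange, ← A.line, ← A.first] at this
  exact this fun R hR h1 h2 => A.eq_corner₁ (h R hR h2) h1

theorem meet_first_second {S : Set (Subalgebra ℂ K)}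
    (A : IsArm D m δ u v κ i j w e a₁ a₂ a₃ b₁ b₂ b₃) (hS : ∀ R, ArmPoint u v κ R → R ∈ S)
    (h : ∀ R ∈ S, R ≤ D i → ArmPoint u v κ R) : MeetOnceTransversally S (D i) (D j) := by
  have h1 := A.chart.div_left
  have := meetOnceTransversally_of (S := S) h1.div_right (hS _ .corner₂)
  rw [h1.planeCurve_div, h1.planeCurve_exchange, ← A.first, ← A.second] at this
  exact this fun R hR h1 h2 => A.eq_corner₂ (h R hR h1) h1 h2

/-- The function `u` vanishes to first order along the curve. It equals `v (u / v)` at the first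
corner and `(u / (v / u)) (v / u)` at the second, and is a local equation at all other points of the
curve. -/
theorem selfIntersection_first {S : Set (Subalgebra ℂ K)}
    (A : IsArm D m δ u v κ i j w e a₁ a₂ a₃ b₁ b₂ b₃) (hS : ∀ R, ArmPoint u v κ R → R ∈ S)
    (h : ∀ R ∈ S, R ≤ D i → ArmPoint u v κ R) : HasSelfIntersection S (D i) (-2) := by
  have hu := A.chart.left_ne_zero
  have hv := A.chart.right_ne_zero
  have h1 := A.chart.div_left
  rw [A.first] at h ⊢
  refine hasSelfIntersection_of h1 (P := planePoint (u / v) v 0 0)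
    (Q := planePoint (u / (v / u)) (v / u) 0 0) (fun e => ?_)
    ⟨v, u / v, A.chart.div_right.swap, A.chart.div_right.planePoint_swap 0 0,
      A.chart.planeCurve_exchange.symm, (mul_div_cancel₀ _ hv).symm⟩
    ⟨_, _, h1.div_right, rfl, h1.planeCurve_div.symm,
      (div_mul_cancel₀ _ h1.right_ne_zero).symm⟩ (hS _ .corner₁) (hS _ .corner₂)
    fun R hR hle => ?_
  · refine not_le_of_mem_maxIdeal h1.right_ne_zero ?_
      (hasVal_zero.1 (h1.div_right.hasVal_right 0 0)) e.le
    rw [inv_div]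
    exact (A.chart.div_right.hasVal_left 0 0).mem
  · rcases A.mem_first (h R hR hle) (A.first ▸ hle) with rfl | rfl | ⟨n, hn, rfl⟩
    · exact Or.inl rfl
    · exact Or.inr (Or.inl rfl)
    · rw [← h1.planeCurve_sub_const n]
      exact Or.inr (Or.inr (h1.sub_const n).isLocalEquation)

/-- Again `u` is the test function. The two exceptional points are the second corner and the
intersection with the last exceptional curve, where the third centre was blown up. -/
theorem selfIntersection_second {S : Set (Subalgebra ℂ K)}
    (A : IsArm D m δ u v κ i j w e a₁ a₂ a₃ b₁ b₂ b₃) (hS : ∀ R, ArmPoint u v κ R → R ∈ S)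
    (h : ∀ R ∈ S, R ≤ D j → ArmPoint u v κ R) : HasSelfIntersection S (D j) (-2) := by
  have hu := A.chart.left_ne_zero
  have h1 := A.chart.div_left
  have h2 := h1.div_left
  have hw := h2.sub_const κ
  have e2 := h2.planeCurve_sub_const κ
  rw [A.second_eq] at h ⊢
  refine hasSelfIntersection_of hw (P := planePoint (u / (v / u)) (v / u) 0 0)
    (Q := planePoint (u / (v / u / u - cst κ)) (v / u / u - cst κ) 0 0) (fun e => ?_)
    ⟨v / u, u / (v / u), h1.div_right.swap, h1.div_right.planePoint_swap 0 0,
      e2.trans h1.planeCurve_exchange.symm, (mul_div_cancel₀ _ h1.right_ne_zero).symm⟩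
    ⟨_, _, hw.div_right, rfl, hw.planeCurve_div.symm,
      (div_mul_cancel₀ _ hw.right_ne_zero).symm⟩ (hS _ .corner₂) (hS _ .corner₃)
    fun R hR hle => ?_
  · refine not_le_of_mem_maxIdeal (f := u / (v / u)) h1.div_right.left_ne_zero ?_
      (hasVal_zero.1 (h1.div_right.hasVal_left 0 0)) e.ge
    rw [inv_div]
    simpa using add_mem (hw.div_right.hasVal_right 0 0).mem (Subalgebra.algebraMap_mem _ κ)
  · rcases A.mem_second (h R hR hle) (A.second_eq ▸ hle) with rfl | rfl | ⟨n, hn, rfl⟩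
    · exact Or.inl rfl
    · exact Or.inr (Or.inl rfl)
    · rw [← hw.planeCurve_sub_const n]
      exact Or.inr (Or.inr (hw.sub_const n).isLocalEquation)

end IsArm

/-! ### Incidence of the seven boundary curves on the surface -/

variable {α c : ℂ} {R : Subalgebra ℂ K}

theorem armPoint_mem_surface {k : Fin 3} (h : ArmPoint (armU k) (armV k) (armKappa α c k) R) :
    R ∈ surface α c :=
  (mem_surface α c R).2 (Or.inr (Or.inr ⟨k, h⟩))

/-- A curve on which `armU k` and `armV k` both vanish is contracted to the base point `k` in the
plane, so it contains only points lying over it. -/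
theorem armPoint_of_armV_mem {k : Fin 3} {V : Subalgebra ℂ K} (hR : R ∈ surface α c)
    (hu : armU k ∈ maxIdeal V) (hv : armV k ∈ maxIdeal V) (hle : R ≤ V) :
    ArmPoint (armU k) (armV k) (armKappa α c k) R := by
  rcases (mem_surface α c R).1 hR with ⟨a, b, rfl⟩ | ⟨m, h1, h2, rfl⟩ | ⟨l, h⟩
  · exact absurd hle (not_le_of_mem_maxIdeal (isChart_arm k).left_ne_zero
      (armU_inv_mem_affine k a b) hu)
  · exact absurd hle (not_le_of_mem_maxIdeal (isChart_arm k).right_ne_zero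
      (inv_armV_mem_linePoint h1 h2 k) hv)
  · by_cases hkl : l = k
    · exact hkl ▸ h
    · exact absurd ((h.le (isChart_arm l)).trans hle) (not_le_of_arm_ne hkl hv)

theorem armPoint_of_le_first {k : Fin 3} (hR : R ∈ surface α c)
    (hle : R ≤ boundary (armFirst k)) : ArmPoint (armU k) (armV k) (armKappa α c k) R :=
  armPoint_of_armV_mem hR (armU_mem_maxIdeal_first k) (armV_mem_maxIdeal_first k) hle

theorem armPoint_of_le_second {k : Fin 3} (hR : R ∈ surface α c)
    (hle : R ≤ boundary (armSecond k)) : ArmPoint (armU k) (armV k) (armKappa α c k) R :=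
  armPoint_of_armV_mem hR (armU_mem_maxIdeal_second k) (armV_mem_maxIdeal_second k) hle

theorem mem_line (hR : R ∈ surface α c) (hle : R ≤ boundary 0) :
    (∃ m, R = linePoint m) ∨ ∃ k, R = planePoint (armU k / armV k) (armV k) 0 0 := by
  obtain ⟨δ, hδ⟩ := exists_isInceField α c
  rcases (mem_surface α c R).1 hR with ⟨a, b, rfl⟩ | ⟨m, h1, h2, rfl⟩ | ⟨k, h⟩
  · exact absurd hle (not_affine_le_boundary a b 0)
  · exact Or.inl ⟨m, rfl⟩
  · obtain ⟨w, e, a₁, a₂, a₃, b₁, b₂, b₃, A⟩ := exists_isArm hδ k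
    exact Or.inr ⟨k, A.eq_corner₁ h hle⟩

theorem linePoint_le_line (m : ℂ) : linePoint m ≤ boundary 0 := by
  have h := isChart_line.sub_const m
  change _ ≤ planeCurve (1 / x) (y / x)
  rw [← isChart_line.planeCurve_sub_const m]
  exact h.planePoint_le_planeCurve

/-- The test function is `1 / x`. At the corners of the arms `y = ±x` it is the product of the two
coordinates. At the third corner `armU 2 / armV 2` equals `1 / x`, so there it is a local equation.
Hence only two of the three corners contribute. -/
theorem selfIntersection_line (α c : ℂ) :
    HasSelfIntersection (surface α c) (boundary 0) (-2) := by
  have hy := y_ne_zero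
  have hx := x_ne_zero
  have h : ∀ k, IsChart (armU k / armV k) (armV k) := fun k => (isChart_arm k).div_right
  have hcurve : ∀ k, boundary 0 = planeCurve (armU k / armV k) (armV k) := fun k => by
    rw [(isChart_arm k).planeCurve_div, ← boundary_line]
  have hcorner : ∀ k, armU k = 1 / x → ∃ s t, IsChart s t ∧
      planePoint (armU k / armV k) (armV k) 0 0 = planePoint s t 0 0 ∧
      planeCurve (1 / x) (y / x) = planeCurve s t ∧ 1 / x = s * t := fun k hk =>
    ⟨_, _, h k, rfl, hcurve k, by rw [div_mul_cancel₀ _ (h k).right_ne_zero, hk]⟩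
  refine hasSelfIntersection_of isChart_line (fun e => ?_) (hcorner 0 rfl) (hcorner 1 rfl)
    (armPoint_mem_surface .corner₁) (armPoint_mem_surface .corner₁) fun R hR hle => ?_
  · refine not_le_of_arm_ne (k := 1) (l := 0) (by decide)
      (armV_mem_maxIdeal (κ := 0) .corner₁) ?_
    rw [e]
    exact (isChart_arm 1).le_div_right
  · rcases mem_line hR hle with ⟨m, rfl⟩ | ⟨k, rfl⟩
    · refine Or.inr (Or.inr ?_)
      rw [← isChart_line.planeCurve_sub_const m]
      exact (isChart_line.sub_const m).isLocalEquation
    · fin_cases k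
      · exact Or.inl rfl
      · exact Or.inr (Or.inl rfl)
      · refine Or.inr (Or.inr ?_)
        have := (h 2).isLocalEquation
        rw [← hcurve 2] at this
        have e : armU 2 / armV 2 = 1 / x := by
          change (1 / y) / (x / y) = 1 / x
          field_simp
        nth_rewrite 2 [e] at this
        exact this

theorem adj_cases {i j : Fin 7} (hij : affineE6.Adj i j) :
    ∃ k, (i = 0 ∧ j = armFirst k) ∨ (j = 0 ∧ i = armFirst k) ∨
      (i = armFirst k ∧ j = armSecond k) ∨ (j = armFirst k ∧ i = armSecond k) := by
  simp only [affineE6, SimpleGraph.fromEdgeSet_adj, Set.mem_insert_iff,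
    Set.mem_singleton_iff] at hij
  revert i j
  decide

theorem isTypeE6_surface (α c : ℂ) : IsTypeE6 (surface α c) boundary := by
  obtain ⟨δ, hδ⟩ := exists_isInceField α c
  have strat : ∀ R ∈ surface α c, _ := fun R hR => hδ.stratification hR
  have hS : ∀ k R, ArmPoint (armU k) (armV k) (armKappa α c k) R → R ∈ surface α c :=
    fun k R => armPoint_mem_surface
  have h1 : ∀ k, ∀ R ∈ surface α c, R ≤ boundary (armFirst k) →
      ArmPoint (armU k) (armV k) (armKappa α c k) R := fun k R => armPoint_of_le_first
  have h2 : ∀ k, ∀ R ∈ surface α c, R ≤ boundary (armSecond k) →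
      ArmPoint (armU k) (armV k) (armKappa α c k) R := fun k R => armPoint_of_le_second
  refine ⟨fun i => ?_, fun i => ?_, fun i j hij => ?_, fun i j hij hadj R hR h => ?_, ?_⟩
  · have hcurve : ∀ {u v : K}, boundary i = planeCurve u v → IsChart u v →
        (∃ R ∈ surface α c, R ≤ boundary i) →
        IsSmoothRationalCurve (surface α c) (boundary i) := fun e h hne => by
      have h3 := fun R hR (hle : R ≤ boundary i) => exists_chart_of_le (strat R hR) hle
      rw [e] at hne h3 ⊢
      exact isSmoothRationalCurve_of h hne h3
    rcases eq_zero_or_arm i with rfl | ⟨k, rfl | rfl⟩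
    · exact hcurve rfl isChart_line ⟨linePoint 0, (mem_surface α c _).2
        (Or.inr (Or.inl ⟨0, by simp, by simp, rfl⟩)), linePoint_le_line 0⟩
    · have h := (isChart_arm k).div_left
      refine hcurve (boundary_first k) h ⟨_, hS k _ .corner₂, ?_⟩
      rw [boundary_first, ← h.planeCurve_div]
      exact h.div_right.planePoint_le_planeCurve
    · have h := (isChart_arm k).div_left
      refine hcurve (boundary_second k) h.div_left ⟨_, hS k _ .corner₂, ?_⟩
      rw [boundary_second, ← h.planeCurve_exchange]
      exact h.div_right.planePoint_le_planeCurve_right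
  · rcases eq_zero_or_arm i with rfl | ⟨k, rfl | rfl⟩
    · exact selfIntersection_line α c
    · obtain ⟨w, e, a₁, a₂, a₃, b₁, b₂, b₃, A⟩ := exists_isArm hδ k
      exact A.selfIntersection_first (hS k) (h1 k)
    · obtain ⟨w, e, a₁, a₂, a₃, b₁, b₂, b₃, A⟩ := exists_isArm hδ k
      exact A.selfIntersection_second (hS k) (h2 k)
  · have key : ∀ k, MeetOnceTransversally (surface α c) (boundary 0) (boundary (armFirst k)) ∧
        MeetOnceTransversally (surface α c) (boundary (armFirst k)) (boundary (armSecond k)) := by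
      intro k
      obtain ⟨w, e, a₁, a₂, a₃, b₁, b₂, b₃, A⟩ := exists_isArm hδ k
      exact ⟨A.meet_line_first (hS k) (h1 k), A.meet_first_second (hS k) (h1 k)⟩
    obtain ⟨k, ⟨rfl, rfl⟩ | ⟨rfl, rfl⟩ | ⟨rfl, rfl⟩ | ⟨rfl, rfl⟩⟩ := adj_cases hij
    · exact (key k).1
    · exact (key k).1.symm
    · exact (key k).2
    · exact (key k).2.symm
  · exact hadj (adj_of_le (strat R hR) hij h.1 h.2)
  · exact isAnticanonical_of_strata strat

/-! ## The four charts -/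

variable {α c : ℂ} {R : Subalgebra ℂ K}

/-- The second coordinate after the third blow-up. -/
def armW (α c : ℂ) (k : Fin 3) : K := (armV k / armU k / armU k - cst (armKappa α c k)) / armU k

theorem isChart_armW (α c : ℂ) (k : Fin 3) : IsChart (armU k) (armW α c k) :=
  ((isChart_arm k).div_left.div_left.sub_const _).div_left

theorem chart_one (α c : ℂ) : chart α c 1 = (armU 0, -armW α c 0) := by
  have hx := x_ne_zero
  have h2 : cst 2 = 2 := map_ofNat _ 2
  refine Prod.ext rfl ?_
  change -((y - x) * x - (cst α - 2 * cst c) / 2) * x =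
    -(((y / x - 1) / (1 / x) / (1 / x) - cst ((α - 2 * c) / 2)) / (1 / x))
  simp only [map_div₀, map_sub, map_mul, h2]
  field_simp

theorem chart_two (α c : ℂ) : chart α c 2 = (armU 1, -armW α c 1) := by
  have hx := x_ne_zero
  have h2 : cst 2 = 2 := map_ofNat _ 2
  refine Prod.ext rfl ?_
  change -((y + x) * x + (cst α + 2 * cst c) / 2) * x =
    -(((y / x + 1) / (1 / x) / (1 / x) - cst (-((α + 2 * c) / 2))) / (1 / x))
  simp only [map_div₀, map_add, map_mul, map_neg, h2]
  field_simp
  ring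

theorem chart_three (α c : ℂ) : chart α c 3 = (-armW α c 2, armU 2) := by
  have hy := y_ne_zero
  have h2 : cst 2 = 2 := map_ofNat _ 2
  refine Prod.ext ?_ rfl
  change -(x * y + 2 * cst c) * y = -(((x / y) / (1 / y) / (1 / y) - cst (-(2 * c))) / (1 / y))
  simp only [map_neg, map_mul, h2]
  field_simp
  ring

theorem isChart_chart (α c : ℂ) (j : Fin 4) : IsChart (chart α c j).1 (chart α c j).2 := by
  fin_cases j
  · exact isChart_xy
  · exact (chart_one α c).symm ▸ (isChart_armW α c 0).neg_right
  · exact (chart_two α c).symm ▸ (isChart_armW α c 1).neg_right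
  · exact (chart_three α c).symm ▸ (isChart_armW α c 2).neg_right.swap

theorem wedge_armW (α c : ℂ) (k : Fin 3) :
    wedge (armU k) (armW α c k) = (armU k)⁻¹ ^ 3 • wedge (armU k) (armV k) := by
  have hu := (isChart_arm k).left_ne_zero
  rw [armW, wedge_div_left hu, wedge_sub_const, wedge_div_left hu, wedge_div_left hu, smul_smul,
    smul_smul]
  congr 1
  ring

theorem wedge_chart (α c : ℂ) (j : Fin 4) :
    wedge (chart α c j).1 (chart α c j).2 = wedge x y := by
  have hx := x_ne_zero
  have hy := y_ne_zero
  have key : wedge (1 / x) (y / x) = -((1 / x) ^ 3 • wedge x y) := by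
    rw [wedge_line, map_neg, map_one, neg_smul, one_smul, neg_neg]
  have hx3 : (1 / x)⁻¹ ^ 3 * (1 / x) ^ 3 = 1 := by
    field_simp
  fin_cases j
  · rfl
  · refine (congrArg (fun p : K × K => wedge p.1 p.2) (chart_one α c)).trans ?_
    change wedge (armU 0) (-armW α c 0) = _
    rw [wedge_neg_right, wedge_armW]
    change -((1 / x)⁻¹ ^ 3 • wedge (1 / x) (y / x - 1)) = _
    rw [← map_one cst, wedge_sub_const, map_one, key, smul_neg, neg_neg, smul_smul, hx3, one_smul]
  · refine (congrArg (fun p : K × K => wedge p.1 p.2) (chart_two α c)).trans ?_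
    change wedge (armU 1) (-armW α c 1) = _
    rw [wedge_neg_right, wedge_armW]
    change -((1 / x)⁻¹ ^ 3 • wedge (1 / x) (y / x + 1)) = _
    have e : y / x + 1 = y / x - cst (-1) := by simp
    rw [e, wedge_sub_const, key, smul_neg, neg_neg, smul_smul, hx3, one_smul]
  · refine (congrArg (fun p : K × K => wedge p.1 p.2) (chart_three α c)).trans ?_
    change wedge (-armW α c 2) (armU 2) = _
    rw [wedge_swap (armU 2), wedge_neg_right, neg_neg, wedge_armW]
    change (1 / y)⁻¹ ^ 3 • wedge (1 / y) (x / y) = _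
    rw [wedge_inv_left, wedge_div_left hy, wedge_swap x y, smul_neg, smul_smul, ← neg_smul,
      smul_neg, ← neg_smul, smul_smul]
    nth_rewrite 2 [← one_smul K (wedge x y)]
    congr 1
    field_simp

/-! ## Points of the charts -/

/-- Domination fixes the values of `u` and `v` at the smaller ring, so on that side it is enough to
know that they are regular. -/
theorem IsChart.planePoint_eq_of_mem {u v u' v' : K} (h : IsChart u v) (h' : IsChart u' v')
    {a b a' b' : ℂ} (h1 : HasVal (planePoint u v a b) u' a')
    (h2 : HasVal (planePoint u v a b) v' b') (hu : u ∈ planePoint u' v' a' b')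
    (hv : v ∈ planePoint u' v' a' b') : planePoint u v a b = planePoint u' v' a' b' := by
  have hp := h.isPoint a b
  have hp' := h'.isPoint a' b'
  have hle := hp.planePoint_le h1 h2
  obtain ⟨z, hz⟩ := hp'.hasVal hu
  obtain ⟨z', hz'⟩ := hp'.hasVal hv
  obtain rfl := hp.unique (h.hasVal_left a b) (hz.of_le hp' hp hle)
  obtain rfl := hp.unique (h.hasVal_right a b) (hz'.of_le hp' hp hle)
  exact h.planePoint_eq h' h1 h2 hz hz'

theorem IsChart.planePoint_neg_right {u v : K} (h : IsChart u v) (a b : ℂ) :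
    planePoint u (-v) a b = planePoint u v a (-b) :=
  h.neg_right.planePoint_eq_of_mem h (h.neg_right.hasVal_left a b)
    (((h.neg_right.isPoint a b).neg (h.neg_right.hasVal_right a b)).congr (neg_neg v).symm rfl)
    (h.hasVal_left a _).mem (neg_mem (h.hasVal_right a _).mem)

theorem armW_point_zero (α c : ℂ) (k : Fin 3) (b : ℂ) :
    ArmPoint (armU k) (armV k) (armKappa α c k) (planePoint (armU k) (armW α c k) 0 b) := by
  rw [(isChart_armW α c k).planePoint_translate_zero]
  exact .side₃ b

theorem xy_mem (k : Fin 3) (hu : (armU k)⁻¹ ∈ R) (hv : armV k ∈ R) : x ∈ R ∧ y ∈ R := by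
  have hx := x_ne_zero
  have hy := y_ne_zero
  fin_cases k
  · change (1 / x)⁻¹ ∈ R at hu
    change y / x - 1 ∈ R at hv
    rw [one_div, inv_inv] at hu
    refine ⟨hu, ?_⟩
    convert mul_mem (add_mem hv (one_mem R)) hu using 1
    field_simp
    ring
  · change (1 / x)⁻¹ ∈ R at hu
    change y / x + 1 ∈ R at hv
    rw [one_div, inv_inv] at hu
    refine ⟨hu, ?_⟩
    convert mul_mem (sub_mem hv (one_mem R)) hu using 1
    field_simp
    ring
  · change (1 / y)⁻¹ ∈ R at hu
    change x / y ∈ R at hv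
    rw [one_div, inv_inv] at hu
    refine ⟨?_, hu⟩
    convert mul_mem hv hu using 1
    field_simp

theorem armV_mem (k : Fin 3) (hx : x ∈ R) (hy : y ∈ R) (hu : armU k ∈ R) : armV k ∈ R := by
  fin_cases k
  · change 1 / x ∈ R at hu
    change y / x - 1 ∈ R
    rw [div_eq_mul_one_div]
    exact sub_mem (mul_mem hy hu) (one_mem R)
  · change 1 / x ∈ R at hu
    change y / x + 1 ∈ R
    rw [div_eq_mul_one_div]
    exact add_mem (mul_mem hy hu) (one_mem R)
  · change 1 / y ∈ R at hu
    change x / y ∈ R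
    rw [div_eq_mul_one_div]
    exact mul_mem hx hu

/-- Where `u` does not vanish, `x` and `y` are regular, being polynomials in `u⁻¹` and `v`.
Conversely the chart functions are regular at the affine point so obtained: `u⁻¹` is regular there
and has the same nonzero value. -/
theorem armW_point_of_ne_zero (α c : ℂ) (k : Fin 3) {a : ℂ} (ha : a ≠ 0) (b : ℂ) :
    ∃ a' b', planePoint (armU k) (armW α c k) a b = planePoint x y a' b' := by
  have h := isChart_armW α c k
  have hu0 := h.left_ne_zero
  have hp := h.isPoint a b
  have hu := h.hasVal_left a b
  have hi := hp.inv hu ha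
  have hv : armV k ∈ planePoint (armU k) (armW α c k) a b := by
    -- This is `v = u² (u W + κ)`, the inverse of the three substitutions.
    have := mul_mem (mul_mem hu.mem hu.mem) (add_mem (mul_mem hu.mem (h.hasVal_right a b).mem)
      (Subalgebra.algebraMap_mem _ (armKappa α c k)))
    rwa [armW, mul_div_cancel₀ _ hu0, sub_add_cancel, mul_assoc, mul_div_cancel₀ _ hu0,
      mul_div_cancel₀ _ hu0] at this
  obtain ⟨hx, hy⟩ := xy_mem k hi.mem hv
  obtain ⟨a', ha'⟩ := hp.hasVal hx
  obtain ⟨b', hb'⟩ := hp.hasVal hy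
  have hp' := isPoint_affine a' b'
  have hx' := (isChart_xy.hasVal_left a' b').mem
  have hy' := (isChart_xy.hasVal_right a' b').mem
  have hi' := armU_inv_mem_affine k a' b'
  have hu' : armU k ∈ planePoint x y a' b' := by
    obtain ⟨z, hz⟩ := hp'.hasVal hi'
    have := hp.unique hi (hz.of_le hp' hp (hp.planePoint_le ha' hb'))
    rw [← inv_inv (armU k)]
    exact inv_mem_of_hasVal hp' hz (this ▸ inv_ne_zero ha)
  refine ⟨a', b', h.planePoint_eq_of_mem isChart_xy ha' hb' hu' ?_⟩
  rw [armW]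
  simp only [div_eq_mul_inv]
  exact mul_mem (sub_mem (mul_mem (mul_mem (armV_mem k hx' hy' hu') hi') hi')
    (Subalgebra.algebraMap_mem _ _)) hi'

theorem mem_affinePlane_chart (α c : ℂ) (k : Fin 3) (R : Subalgebra ℂ K) :
    R ∈ affinePlane (chart α c k.succ).1 (chart α c k.succ).2 ↔
      ∃ a b, R = planePoint (armU k) (armW α c k) a b := by
  have h := isChart_armW α c k
  have key : R ∈ affinePlane (armU k) (-armW α c k) ↔
      ∃ a b, R = planePoint (armU k) (armW α c k) a b := by
    refine ⟨?_, ?_⟩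
    · rintro ⟨a, b, rfl⟩
      exact ⟨a, -b, h.planePoint_neg_right a b⟩
    · rintro ⟨a, b, rfl⟩
      exact ⟨a, -b, by rw [h.planePoint_neg_right, neg_neg]⟩
  rw [← key]
  match k with
  | 0 =>
    change R ∈ affinePlane (chart α c 1).1 (chart α c 1).2 ↔ _
    rw [chart_one]
  | 1 =>
    change R ∈ affinePlane (chart α c 2).1 (chart α c 2).2 ↔ _
    rw [chart_two]
  | 2 =>
    change R ∈ affinePlane (chart α c 3).1 (chart α c 3).2 ↔ _
    rw [chart_three]
    refine ⟨?_, ?_⟩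
    · rintro ⟨a, b, rfl⟩
      exact ⟨b, a, h.neg_right.swap.planePoint_swap a b⟩
    · rintro ⟨a, b, rfl⟩
      exact ⟨b, a, h.neg_right.planePoint_swap a b⟩

theorem mem_phaseSpace (α c : ℂ) (R : Subalgebra ℂ K) : R ∈ phaseSpace α c ↔
    (∃ a b, R = planePoint x y a b) ∨
      ∃ k a b, R = planePoint (armU k) (armW α c k) a b := by
  rw [phaseSpace, Set.mem_iUnion, Fin.exists_fin_succ]
  simp only [mem_affinePlane_chart]
  rfl

/-- Points of the later charts with `u = 0` are the points of finite slope of the third blow-up, and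
those with `u ≠ 0` are affine. Every other point of the surface lies on a boundary curve by the
stratification. -/
theorem phaseSpace_eq (α c : ℂ) :
    phaseSpace α c = {R | R ∈ surface α c ∧ ∀ i, ¬ R ≤ boundary i} := by
  obtain ⟨δ, hδ⟩ := exists_isInceField α c
  ext R
  rw [mem_phaseSpace, Set.mem_ofPred_eq]
  constructor
  · have affine : ∀ a b, planePoint x y a b ∈ surface α c ∧
        ∀ i, ¬ planePoint x y a b ≤ boundary i := fun a b =>
      ⟨(mem_surface α c _).2 (Or.inl ⟨a, b, rfl⟩), not_affine_le_boundary a b⟩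
    rintro (⟨a, b, rfl⟩ | ⟨k, a, b, rfl⟩)
    · exact affine a b
    · rcases eq_or_ne a 0 with rfl | ha
      · refine ⟨armPoint_mem_surface (armW_point_zero α c k b), ?_⟩
        obtain ⟨w, e, a₁, a₂, a₃, b₁, b₂, b₃, A⟩ := exists_isArm hδ k
        obtain ⟨-, -, -, -, hk, -⟩ := A.side₃_isInterior b
        rwa [(isChart_armW α c k).planePoint_translate_zero]
      · obtain ⟨a', b', e⟩ := armW_point_of_ne_zero α c k ha b
        exact e ▸ affine a' b'
  · rintro ⟨hR, hi⟩
    rcases (mem_surface α c R).1 hR with h | ⟨m, h1, h2, rfl⟩ | ⟨k, h⟩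
    · exact Or.inl h
    · exact absurd (linePoint_le_line m) (hi 0)
    · obtain ⟨w, e, a₁, a₂, a₃, b₁, b₂, b₃, A⟩ := exists_isArm hδ k
      have smooth : ¬ IsSmoothBoundary boundary affineE6Mult δ R := fun h =>
        let ⟨i, h⟩ := h.exists_le
        hi i h
      have corner : ¬ IsCorner boundary affineE6Mult δ R := fun h =>
        let ⟨i, _, _, h, _⟩ := h.exists_le
        hi i h
      cases h with
      | corner₁ => exact (corner A.corner₁_isCorner).elim
      | side₁ m hm => exact (smooth (A.side₁_isSmoothBoundary hm)).elim
      | corner₂ => exact (corner A.corner₂_isCorner).elim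
      | side₂ m hm => exact (smooth (A.side₂_isSmoothBoundary hm)).elim
      | corner₃ => exact (smooth A.corner₃_isSmoothBoundary).elim
      | side₃ m =>
        exact Or.inr ⟨k, 0, m, ((isChart_armW α c k).planePoint_translate_zero m).symm⟩

/-! ## The Hamiltonian in the four charts -/

variable {α c : ℂ} {δ : Derivation ℂ K K}

/-- The Hamiltonian as a polynomial in the coordinates of the chart. -/
def hamiltonianPoly (α c : ℂ) : Fin 4 → MvPolynomial (Fin 2) ℂ :=
  let X₀ : MvPolynomial (Fin 2) ℂ := .X 0
  let X₁ : MvPolynomial (Fin 2) ℂ := .X 1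
  let g₁ : MvPolynomial (Fin 2) ℂ := .C ((α - 2 * c) / 2) - X₀ * X₁
  let g₂ : MvPolynomial (Fin 2) ℂ := .C ((α + 2 * c) / 2) + X₀ * X₁
  let g₃ : MvPolynomial (Fin 2) ℂ := .C (2 * c) + X₀ * X₁
  ![.C (1 / 2) * X₀ * X₁ ^ 2 - .C (1 / 2) * X₀ ^ 3 - .C (α / 2) * X₀ + .C c * X₁,
    -X₁ + .C (1 / 2) * X₀ * g₁ ^ 2 + .C c * X₀ * g₁,
    X₁ + .C (1 / 2) * X₀ * g₂ ^ 2 - .C c * X₀ * g₂,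
    -.C (1 / 2) * X₀ + .C (1 / 2) * X₁ ^ 3 * g₃ ^ 3 + .C (α / 2) * X₁ * g₃]

/-- In the charts `1, 2, 3` the auxiliary polynomials represent `g₁ = (y - x) x`, `g₂ = -(y + x) x`
and `g₃ = -x y`. Substituting them, the constants built into the charts cancel the negative powers
in the Hamiltonian; for instance `(g₁ - (α - 2c)/2) / x₁ = -y₁`. -/
theorem IsInceField.hamiltonian_chart (hδ : IsInceField α c δ) (j : Fin 4) :
    hamiltonian α c =
      MvPolynomial.aeval ![(chart α c j).1, (chart α c j).2] (hamiltonianPoly α c j) ∧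
    δ (chart α c j).1 = MvPolynomial.aeval
      ![(chart α c j).1, (chart α c j).2] (MvPolynomial.pderiv 1 (hamiltonianPoly α c j)) ∧
    δ (chart α c j).2 = -MvPolynomial.aeval
      ![(chart α c j).1, (chart α c j).2] (MvPolynomial.pderiv 0 (hamiltonianPoly α c j)) := by
  have hx := x_ne_zero
  have hy := y_ne_zero
  have h2 : cst 2 = 2 := map_ofNat _ 2
  obtain ⟨h3, h4⟩ := hδ
  have d1 : δ (1 : K) = 0 := δ.map_one_eq_zero
  have d2 : δ (2 : K) = 0 := h2 ▸ δ.map_algebraMap 2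
  have da : δ (cst α) = 0 := δ.map_algebraMap α
  have dc : δ (cst c) = 0 := δ.map_algebraMap c
  have p01 : MvPolynomial.pderiv (1 : Fin 2) (MvPolynomial.X 0 : MvPolynomial (Fin 2) ℂ) = 0 :=
    MvPolynomial.pderiv_X_of_ne (by decide)
  have p10 : MvPolynomial.pderiv (0 : Fin 2) (MvPolynomial.X 1 : MvPolynomial (Fin 2) ℂ) = 0 :=
    MvPolynomial.pderiv_X_of_ne (by decide)
  rw [map_div₀, h2] at h4
  fin_cases j <;>
  · simp only [hamiltonianPoly, chart, chartMap, Fin.mk_zero, Fin.mk_one, Fin.reduceFinMk,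
      Matrix.cons_val, hamiltonian, map_add, map_sub, map_mul, map_neg, map_pow, map_div₀, map_one,
      MvPolynomial.aeval_C, MvPolynomial.aeval_X, MvPolynomial.pderiv_C, MvPolynomial.pderiv_pow,
      MvPolynomial.pderiv_X_self, p01, p10, h2, map_zero,
      Derivation.leibniz, Derivation.leibniz_div, smul_eq_mul, h3, h4, d1, d2, da, dc, map_natCast]
    push_cast
    refine ⟨?_, ?_, ?_⟩ <;> first | trivial | (field_simp; ring)

/-! ## The symmetries -/

/-- The first two maps preserve `y - x` and `y + x` respectively, and the third preserves `x`. The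
denominator is thus known in the new coordinates, and the correction term can be undone. -/
theorem isChart_symMap (α c : ℂ) (i : Fin 3) :
    IsChart (symMap (cst α) (cst c) x y i).1 (symMap (cst α) (cst c) x y i).2 := by
  have h2 : ∀ k, cst k / 2 = cst (k / 2) := fun k => by rw [map_div₀, map_ofNat cst 2]
  have e1 : (cst α - 2 * cst c) / 2 = cst ((α - 2 * c) / 2) := by
    rw [← h2, map_sub, map_mul, map_ofNat cst 2]
  have e2 : (cst α + 2 * cst c) / 2 = cst ((α + 2 * c) / 2) := by
    rw [← h2, map_add, map_mul, map_ofNat cst 2]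
  have e3 : 2 * cst c = cst (2 * c) := by
    rw [map_mul, map_ofNat cst 2]
  match i with
  | 0 =>
    change IsChart (x - ((cst α - 2 * cst c) / 2) / (y - x))
      (y - ((cst α - 2 * cst c) / 2) / (y - x))
    rw [e1]
    set k := cst ((α - 2 * c) / 2) with hk
    set X := x - k / (y - x) with hX
    set Y := y - k / (y - x) with hY
    have hm := sub_mem (mem_adjoin_right X Y) (mem_adjoin_left X Y)
    rw [show Y - X = y - x by rw [hX, hY]; ring] at hm
    have hd := div_mem (IntermediateField.algebraMap_mem (IntermediateField.adjoin ℂ {X, Y})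
      ((α - 2 * c) / 2)) hm
    rw [← hk] at hd
    refine isChart_xy.of_mem ?_ ?_
    · have := add_mem (mem_adjoin_left X Y) hd
      rwa [show X + k / (y - x) = x by rw [hX]; ring] at this
    · have := add_mem (mem_adjoin_right X Y) hd
      rwa [show Y + k / (y - x) = y by rw [hY]; ring] at this
  | 1 =>
    change IsChart (x + ((cst α + 2 * cst c) / 2) / (y + x))
      (y - ((cst α + 2 * cst c) / 2) / (y + x))
    rw [e2]
    set k := cst ((α + 2 * c) / 2) with hk
    set X := x + k / (y + x) with hX
    set Y := y - k / (y + x) with hY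
    have hm := add_mem (mem_adjoin_right X Y) (mem_adjoin_left X Y)
    rw [show Y + X = y + x by rw [hX, hY]; ring] at hm
    have hd := div_mem (IntermediateField.algebraMap_mem (IntermediateField.adjoin ℂ {X, Y})
      ((α + 2 * c) / 2)) hm
    rw [← hk] at hd
    refine isChart_xy.of_mem ?_ ?_
    · have := sub_mem (mem_adjoin_left X Y) hd
      rwa [show X - k / (y + x) = x by rw [hX]; ring] at this
    · have := add_mem (mem_adjoin_right X Y) hd
      rwa [show Y + k / (y + x) = y by rw [hY]; ring] at this
  | 2 =>
    change IsChart x (y + 2 * cst c / x)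
    rw [e3]
    refine isChart_xy.of_mem (mem_adjoin_left _ _) ?_
    have := sub_mem (mem_adjoin_right x (y + cst (2 * c) / x))
      (div_mem (IntermediateField.algebraMap_mem
        (IntermediateField.adjoin ℂ {x, y + cst (2 * c) / x}) (2 * c)) (mem_adjoin_left _ _))
    rwa [add_sub_cancel_right] at this

theorem symRoot_sq {β : ℂ} (hc : c ^ 2 = -β) (i : Fin 3) :
    symRoot α c i ^ 2 = -symBeta α β c i := by
  obtain rfl : β = -c ^ 2 := by rw [hc, neg_neg]
  match i with
  | 0 =>
    change ((α + 2 * c) / 4) ^ 2 = -((-α ^ 2 - 4 * α * c + 4 * -c ^ 2) / 16)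
    ring
  | 1 =>
    change ((-α + 2 * c) / 4) ^ 2 = -((-α ^ 2 + 4 * α * c + 4 * -c ^ 2) / 16)
    ring
  | 2 =>
    change (-c) ^ 2 = - -c ^ 2
    ring

/-- Once the quotient rule has supplied the derivatives, what is left is a pointwise identity of
rational functions in the values `X t`, `Y t`. -/
theorem SolvesAt.symMap {X Y : ℂ → ℂ} {t : ℂ} (h : SolvesAt α c X Y t) (i : Fin 3)
    (hd : symDenom (X t) (Y t) i ≠ 0) :
    SolvesAt (symAlpha α c i) (symRoot α c i) (fun s => (symMap α c (X s) (Y s) i).1)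
      (fun s => (symMap α c (X s) (Y s) i).2) t := by
  obtain ⟨hX, hY⟩ := h
  match i with
  | 0 =>
    have hd' : Y t - X t ≠ 0 := hd
    have hq := (hasDerivAt_const t ((α - 2 * c) / 2)).fun_div (hY.fun_sub hX) hd'
    refine ⟨(hX.fun_sub hq).congr_deriv ?_, (hY.fun_sub hq).congr_deriv ?_⟩
    · change _ = (X t - ((α - 2 * c) / 2) / (Y t - X t)) * (Y t - ((α - 2 * c) / 2) / (Y t - X t)) +
        (α + 2 * c) / 4
      field_simp
      ring
    · change _ = 3 / 2 * (X t - ((α - 2 * c) / 2) / (Y t - X t)) ^ 2 -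
        1 / 2 * (Y t - ((α - 2 * c) / 2) / (Y t - X t)) ^ 2 + (-α + 6 * c) / 2 / 2
      field_simp
      ring
  | 1 =>
    have hd' : Y t + X t ≠ 0 := hd
    have hq := (hasDerivAt_const t ((α + 2 * c) / 2)).fun_div (hY.fun_add hX) hd'
    refine ⟨(hX.fun_add hq).congr_deriv ?_, (hY.fun_sub hq).congr_deriv ?_⟩
    · change _ = (X t + ((α + 2 * c) / 2) / (Y t + X t)) * (Y t - ((α + 2 * c) / 2) / (Y t + X t)) +
        (-α + 2 * c) / 4
      field_simp
      ring
    · change _ = 3 / 2 * (X t + ((α + 2 * c) / 2) / (Y t + X t)) ^ 2 -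
        1 / 2 * (Y t - ((α + 2 * c) / 2) / (Y t + X t)) ^ 2 + (-α - 6 * c) / 2 / 2
      field_simp
      ring
  | 2 =>
    have hd' : X t ≠ 0 := hd
    have hq := (hasDerivAt_const t (2 * c)).fun_div hX hd'
    refine ⟨hX.congr_deriv ?_, (hY.fun_add hq).congr_deriv ?_⟩
    · change _ = X t * (Y t + 2 * c / X t) + -c
      field_simp
      ring
    · change _ = 3 / 2 * X t ^ 2 - 1 / 2 * (Y t + 2 * c / X t) ^ 2 + α / 2
      field_simp
      ring

/-! ## Meromorphic solutions -/

section Meromorphic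

variable {α c : ℂ} {t₀ : ℂ}

theorem eq_of_eventually_eq_punctured {F G : ℂ → ℂ} (hF : ContinuousAt F t₀)
    (hG : ContinuousAt G t₀) (h : ∀ᶠ t in 𝓝[≠] t₀, F t = G t) : F t₀ = G t₀ :=
  tendsto_nhds_unique_of_eventuallyEq (hF.tendsto.mono_left nhdsWithin_le_nhds)
    (hG.tendsto.mono_left nhdsWithin_le_nhds) h

theorem exists_eq_sub_mul {f : ℂ → ℂ} (hf : AnalyticAt ℂ f t₀) (h0 : f t₀ = 0) :
    ∃ g, AnalyticAt ℂ g t₀ ∧ ∀ᶠ t in 𝓝 t₀, f t = (t - t₀) * g t := by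
  have h1 : ((1 : ℕ) : ℕ∞) ≤ analyticOrderAt f t₀ := by
    rw [Nat.cast_one, Order.one_le_iff_ne_zero]
    exact hf.analyticOrderAt_ne_zero.2 h0
  obtain ⟨g, hg, h⟩ := (natCast_le_analyticOrderAt hf).1 h1
  exact ⟨g, hg, by simpa using h⟩

theorem eventually_deriv_sub_mul {f g : ℂ → ℂ} (hg : AnalyticAt ℂ g t₀)
    (h : ∀ᶠ t in 𝓝 t₀, f t = (t - t₀) * g t) :
    ∀ᶠ t in 𝓝 t₀, deriv f t = g t + (t - t₀) * deriv g t := by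
  filter_upwards [eventually_eventually_nhds.2 h, hg.eventually_analyticAt] with t ht hgt
  have := (((hasDerivAt_id' t).sub_const t₀).fun_mul hgt.differentiableAt.hasDerivAt)
  rw [EventuallyEq.deriv_eq ht, this.deriv, one_mul]

/-- The regular solution of a linear equation with a resonance-free singular point. -/
theorem exists_eq_sub_mul_of_deriv {W B : ℂ → ℂ} {k : ℂ} (hW : AnalyticAt ℂ W t₀)
    (hB : AnalyticAt ℂ B t₀) (hB2 : B t₀ = 2)
    (h : ∀ᶠ t in 𝓝[≠] t₀, (t - t₀) * deriv W t = B t * W t + k * (t - t₀)) :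
    ∃ A, AnalyticAt ℂ A t₀ ∧ A t₀ = -k ∧ ∀ᶠ t in 𝓝 t₀, W t = (t - t₀) * A t := by
  have hs : AnalyticAt ℂ (fun t => t - t₀) t₀ := analyticAt_id.fun_sub analyticAt_const
  have h0 : W t₀ = 0 := by
    have := eq_of_eventually_eq_punctured (hs.fun_mul hW.deriv).continuousAt
      ((hB.fun_mul hW).fun_add (analyticAt_const.fun_mul hs)).continuousAt h
    simpa [hB2] using this
  obtain ⟨A, hA, hWA⟩ := exists_eq_sub_mul hW h0
  refine ⟨A, hA, ?_, hWA⟩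
  -- After cancelling one factor `t - t₀`, the equation reads `A = 2 A + k` at `t₀`, which
  -- determines `A t₀`.
  have h1 : ∀ᶠ t in 𝓝[≠] t₀, A t + (t - t₀) * deriv A t = B t * A t + k := by
    filter_upwards [h, nhdsWithin_le_nhds hWA,
      nhdsWithin_le_nhds (eventually_deriv_sub_mul hA hWA), self_mem_nhdsWithin]
      with t h1 h2 h3 hne
    rw [h2, h3] at h1
    exact mul_left_cancel₀ (sub_ne_zero.2 hne) (by linear_combination h1)
  have := eq_of_eventually_eq_punctured (hA.fun_add (hs.fun_mul hA.deriv)).continuousAt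
    ((hB.fun_mul hA).fun_add analyticAt_const).continuousAt h1
  simp only [sub_self, zero_mul, add_zero, hB2] at this
  linear_combination -this

/-- Solutions of the system with a pole, multiplied with a power of `t - t₀`. -/
theorem exists_pole_equations {X Y : ℂ → ℂ} (hX : MeromorphicAt X t₀) (hY : MeromorphicAt Y t₀)
    (h : ∀ᶠ t in 𝓝[≠] t₀, SolvesAt α c X Y t) :
    ∃ f g : ℂ → ℂ, AnalyticAt ℂ f t₀ ∧ AnalyticAt ℂ g t₀ ∧
      ((∀ᶠ t in 𝓝[≠] t₀, X t = f t ∧ Y t = g t) ∨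
      ((f t₀ ≠ 0 ∨ g t₀ ≠ 0) ∧
        (∀ᶠ t in 𝓝[≠] t₀, X t = f t / (t - t₀) ∧ Y t = g t / (t - t₀)) ∧
        ∀ᶠ t in 𝓝[≠] t₀, (t - t₀) * deriv f t = f t + f t * g t + c * (t - t₀) ^ 2 ∧
          (t - t₀) * deriv g t =
            g t + 3 / 2 * f t ^ 2 - 1 / 2 * g t ^ 2 + α / 2 * (t - t₀) ^ 2)) := by
  classical
  have hs : AnalyticAt ℂ (fun t => t - t₀) t₀ := analyticAt_id.fun_sub analyticAt_const
  -- The least `N` clearing both denominators is the larger of the two pole orders. By minimality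
  -- the cleared functions do not both vanish at `t₀`.
  let P : ℕ → Prop := fun N => ∃ f g : ℂ → ℂ, AnalyticAt ℂ f t₀ ∧ AnalyticAt ℂ g t₀ ∧
    ∀ᶠ t in 𝓝[≠] t₀, f t = (t - t₀) ^ N * X t ∧ g t = (t - t₀) ^ N * Y t
  have hP : ∃ N, P N := by
    obtain ⟨n, hn⟩ := hX
    obtain ⟨m, hm⟩ := hY
    refine ⟨m + n, _, _, (hs.fun_pow m).fun_mul hn, (hs.fun_pow n).fun_mul hm,
      Eventually.of_forall fun t => ⟨?_, ?_⟩⟩ <;>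
    · simp only [smul_eq_mul]
      ring
  obtain ⟨f, g, hf, hg, hfg⟩ := Nat.find_spec hP
  have hmin : ∀ n < Nat.find hP, ¬ P n := fun n => Nat.find_min hP
  generalize Nat.find hP = N at hfg hmin
  refine ⟨f, g, hf, hg, ?_⟩
  rcases N with _ | n
  · left
    filter_upwards [hfg] with t ht
    simpa [eq_comm] using ht
  right
  have h0 : f t₀ ≠ 0 ∨ g t₀ ≠ 0 := by
    by_contra! h0
    obtain ⟨f₁, hf₁, e₁⟩ := exists_eq_sub_mul hf h0.1
    obtain ⟨g₁, hg₁, e₂⟩ := exists_eq_sub_mul hg h0.2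
    refine hmin n n.lt_succ_self ⟨f₁, g₁, hf₁, hg₁, ?_⟩
    filter_upwards [hfg, nhdsWithin_le_nhds e₁, nhdsWithin_le_nhds e₂, self_mem_nhdsWithin]
      with t h1 h2 h3 hne
    have hne' := sub_ne_zero.2 hne
    exact ⟨mul_left_cancel₀ hne' (by rw [← h2, h1.1]; ring),
      mul_left_cancel₀ hne' (by rw [← h3, h1.2]; ring)⟩
  have heq : ∀ᶠ t in 𝓝[≠] t₀,
      (t - t₀) ^ (n + 1) * deriv f t =
        (n + 1) * (t - t₀) ^ n * f t + f t * g t + c * (t - t₀) ^ (2 * (n + 1)) ∧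
      (t - t₀) ^ (n + 1) * deriv g t = (n + 1) * (t - t₀) ^ n * g t + 3 / 2 * f t ^ 2 -
        1 / 2 * g t ^ 2 + α / 2 * (t - t₀) ^ (2 * (n + 1)) := by
    filter_upwards [hfg, eventually_eventually_nhdsWithin.2 hfg, h, self_mem_nhdsWithin]
      with t h1 h2 h3 hne
    rw [(isOpen_compl_singleton (x := t₀)).nhdsWithin_eq hne] at h2
    have hpow := ((hasDerivAt_id' t).sub_const t₀).fun_pow (n + 1)
    have d1 := (hpow.fun_mul h3.1).congr_of_eventuallyEq (h2.mono fun t ht => ht.1)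
    have d2 := (hpow.fun_mul h3.2).congr_of_eventuallyEq (h2.mono fun t ht => ht.2)
    rw [d1.deriv, d2.deriv, h1.1, h1.2]
    simp only [Nat.add_sub_cancel]
    push_cast
    constructor <;> ring
  -- For a pole of order at least two only the quadratic terms survive at `t₀`: `f g = 0` and `3 f²
  -- = g²`. Both leading coefficients would then be zero.
  obtain rfl : n = 0 := by
    by_contra hn
    have hpow : ∀ m : ℕ, m ≠ 0 → (t₀ - t₀) ^ m = 0 := fun m hm => by rw [sub_self, zero_pow hm]
    have e1 := eq_of_eventually_eq_punctured ((hs.fun_pow _).fun_mul hf.deriv).continuousAt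
      (((((analyticAt_const (v := (n + 1 : ℂ))).fun_mul (hs.fun_pow n)).fun_mul hf).fun_add
        (hf.fun_mul hg)).fun_add (analyticAt_const.fun_mul (hs.fun_pow _))).continuousAt
      (heq.mono fun t ht => ht.1)
    have e2 := eq_of_eventually_eq_punctured ((hs.fun_pow _).fun_mul hg.deriv).continuousAt
      (((((analyticAt_const (v := (n + 1 : ℂ))).fun_mul (hs.fun_pow n)).fun_mul hg).fun_add
        (analyticAt_const.fun_mul (hf.fun_pow 2))).fun_sub
        (analyticAt_const.fun_mul (hg.fun_pow 2)) |>.fun_add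
        (analyticAt_const.fun_mul (hs.fun_pow _))).continuousAt
      (heq.mono fun t ht => ht.2)
    simp only [hpow n hn, hpow (n + 1) (by simp), hpow (2 * (n + 1)) (by simp), zero_mul,
      mul_zero, zero_add, add_zero] at e1 e2
    rcases mul_eq_zero.1 e1.symm with h1 | h1
    · rw [h1] at e2
      exact absurd ⟨h1, by simpa using e2⟩ (not_and_or.2 h0)
    · rw [h1] at e2
      exact absurd ⟨by simpa using e2, h1⟩ (not_and_or.2 h0)
  refine ⟨h0, ?_, ?_⟩
  · filter_upwards [hfg, self_mem_nhdsWithin] with t h1 hne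
    have hne' : t - t₀ ≠ 0 := sub_ne_zero.2 hne
    rw [h1.1, h1.2, zero_add, pow_one]
    exact ⟨(mul_div_cancel_left₀ _ hne').symm, (mul_div_cancel_left₀ _ hne').symm⟩
  · filter_upwards [heq] with t ht
    simpa using ht

/-- The quadratic part of the sum of the equations factors as `(f + g)(3 f - g) / 2`. Hence `W = (f
+ g) / (t - t₀)` satisfies `(t - t₀) W' = (2 f - (t - t₀) W / 2) W + (a + b)(t - t₀)`, and the
coefficient of `W` is `2` at `t₀`. -/
theorem exists_add_eq_sq_mul {f g : ℂ → ℂ} {a b : ℂ} (hf : AnalyticAt ℂ f t₀)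
    (hg : AnalyticAt ℂ g t₀) (hf0 : f t₀ = 1) (hg0 : g t₀ = -1)
    (h : ∀ᶠ t in 𝓝[≠] t₀, (t - t₀) * deriv f t = f t + f t * g t + b * (t - t₀) ^ 2 ∧
      (t - t₀) * deriv g t = g t + 3 / 2 * f t ^ 2 - 1 / 2 * g t ^ 2 + a * (t - t₀) ^ 2) :
    ∃ A, AnalyticAt ℂ A t₀ ∧ A t₀ = -(a + b) ∧
      ∀ᶠ t in 𝓝[≠] t₀, f t + g t = (t - t₀) ^ 2 * A t := by
  have hs : AnalyticAt ℂ (fun t => t - t₀) t₀ := analyticAt_id.fun_sub analyticAt_const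
  obtain ⟨W, hW, e⟩ := exists_eq_sub_mul (hf.fun_add hg) (by rw [hf0, hg0, add_neg_cancel])
  obtain ⟨A, hA, hA0, hWA⟩ := exists_eq_sub_mul_of_deriv (k := a + b)
    (B := fun t => 2 * f t - 1 / 2 * ((t - t₀) * W t)) hW
    ((analyticAt_const.fun_mul hf).fun_sub (analyticAt_const.fun_mul (hs.fun_mul hW)))
    (by simp [hf0]) (by
      filter_upwards [h, nhdsWithin_le_nhds e,
        nhdsWithin_le_nhds (eventually_deriv_sub_mul hW e),
        nhdsWithin_le_nhds hf.eventually_analyticAt, nhdsWithin_le_nhds hg.eventually_analyticAt,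
        self_mem_nhdsWithin] with t h1 h2 h3 hft hgt hne
      rw [deriv_fun_add hft.differentiableAt hgt.differentiableAt] at h3
      obtain ⟨h4, h5⟩ := h1
      refine mul_left_cancel₀ (sub_ne_zero.2 hne) ?_
      have hgt : g t = (t - t₀) * W t - f t := by rw [← h2]; ring
      rw [hgt] at h4 h5
      linear_combination h4 + h5 - (t - t₀) * h3)
  refine ⟨A, hA, hA0, ?_⟩
  filter_upwards [nhdsWithin_le_nhds e, nhdsWithin_le_nhds hWA] with t h1 h2
  rw [h1, h2]
  ring

/-- At a pole the leading coefficients satisfy `f (1 + g) = 0` and `g + (3/2) f² - (1/2) g² = 0`.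
The nonzero solutions are `(0, 2)`, `(1, -1)` and `(-1, -1)`, leading to the charts `3`, `2`, `1`.
In each case the next forced coefficient is the one that makes the bracket in the chart formula
vanish at `t₀`, which cancels the remaining pole. -/
theorem exists_chart_of_meromorphic {X Y : ℂ → ℂ} (hX : MeromorphicAt X t₀)
    (hY : MeromorphicAt Y t₀) (h : ∀ᶠ t in 𝓝[≠] t₀, SolvesAt α c X Y t) :
    ∃ (j : Fin 4) (ξ η : ℂ → ℂ), AnalyticAt ℂ ξ t₀ ∧ AnalyticAt ℂ η t₀ ∧
      ∀ᶠ t in 𝓝[≠] t₀, chartDenom (X t) (Y t) j ≠ 0 ∧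
        chartMap α c (X t) (Y t) j = (ξ t, η t) := by
  have hs : AnalyticAt ℂ (fun t => t - t₀) t₀ := analyticAt_id.fun_sub analyticAt_const
  obtain ⟨f, g, hf, hg, h0 | ⟨h0, hXY, heq⟩⟩ := exists_pole_equations hX hY h
  · refine ⟨0, f, g, hf, hg, ?_⟩
    filter_upwards [h0] with t ht
    exact ⟨one_ne_zero, Prod.ext ht.1 ht.2⟩
  have e1 : f t₀ * (1 + g t₀) = 0 := by
    have := eq_of_eventually_eq_punctured (hs.fun_mul hf.deriv).continuousAt
      ((hf.fun_add (hf.fun_mul hg)).fun_add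
        (analyticAt_const.fun_mul (hs.fun_pow 2))).continuousAt (heq.mono fun t ht => ht.1)
    simp only [sub_self] at this
    linear_combination -this
  have e2 : g t₀ + 3 / 2 * f t₀ ^ 2 - 1 / 2 * g t₀ ^ 2 = 0 := by
    have := eq_of_eventually_eq_punctured (hs.fun_mul hg.deriv).continuousAt
      (((hg.fun_add (analyticAt_const.fun_mul (hf.fun_pow 2))).fun_sub
        (analyticAt_const.fun_mul (hg.fun_pow 2))).fun_add
        (analyticAt_const.fun_mul (hs.fun_pow 2))).continuousAt (heq.mono fun t ht => ht.2)
    simp only [sub_self] at this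
    linear_combination -this
  rcases mul_eq_zero.1 e1 with hf0 | hg0
  · have hg0 : g t₀ = 2 := by
      have hne : g t₀ ≠ 0 := h0.resolve_left (not_not.2 hf0)
      rw [hf0] at e2
      exact mul_left_cancel₀ hne (by linear_combination -2 * e2)
    obtain ⟨φ, hφ, e⟩ := exists_eq_sub_mul hf hf0
    obtain ⟨A, hA, hA0, hφA⟩ := exists_eq_sub_mul_of_deriv (k := c) hφ hg hg0 (by
      filter_upwards [heq, nhdsWithin_le_nhds e,
        nhdsWithin_le_nhds (eventually_deriv_sub_mul hφ e), self_mem_nhdsWithin]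
        with t h1 h2 h3 hne
      obtain ⟨h4, -⟩ := h1
      rw [h3, h2] at h4
      exact mul_left_cancel₀ (sub_ne_zero.2 hne) (by linear_combination h4))
    -- Here `x y = A g`, with value `(-c) · 2` at `t₀`. So `x y + 2 c` is divisible by `t - t₀`,
    -- which compensates the pole of the factor `y`.
    obtain ⟨B, hB, hAB⟩ := exists_eq_sub_mul ((hA.fun_mul hg).fun_add
      (analyticAt_const (v := 2 * c))) (by rw [hA0, hg0]; ring)
    refine ⟨3, fun t => -(B t * g t), fun t => (t - t₀) / g t, (hB.fun_mul hg).fun_neg,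
      hs.fun_div hg (by rw [hg0]; norm_num), ?_⟩
    filter_upwards [hXY, nhdsWithin_le_nhds e, nhdsWithin_le_nhds hφA, nhdsWithin_le_nhds hAB,
      nhdsWithin_le_nhds (hg.continuousAt.eventually_ne (by rw [hg0]; norm_num : g t₀ ≠ 0)),
      self_mem_nhdsWithin] with t h1 h2 h3 h4 h5 hne
    have hne' : t - t₀ ≠ 0 := sub_ne_zero.2 hne
    change Y t ≠ 0 ∧ (-(X t * Y t + 2 * c) * Y t, 1 / Y t) = _
    rw [h1.1, h1.2, h2, h3]
    refine ⟨div_ne_zero h5 hne', Prod.ext ?_ (one_div_div _ _)⟩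
    change -((t - t₀) * ((t - t₀) * A t) / (t - t₀) * (g t / (t - t₀)) + 2 * c) *
      (g t / (t - t₀)) = -(B t * g t)
    field_simp
    linear_combination -h4
  · have hg0 : g t₀ = -1 := by linear_combination hg0
    have hf1 : (f t₀ - 1) * (f t₀ + 1) = 0 := by
      rw [hg0] at e2
      linear_combination 2 / 3 * e2
    have hfne : f t₀ ≠ 0 := by
      rintro h
      rw [h] at hf1
      norm_num at hf1
    have hx : AnalyticAt ℂ (fun t => (t - t₀) / f t) t₀ := hs.fun_div hf hfne
    rcases mul_eq_zero.1 hf1 with hf1 | hf1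
    · obtain ⟨A, hA, hA0, hfg⟩ := exists_add_eq_sq_mul hf hg (sub_eq_zero.1 hf1) hg0 heq
      -- Here `(y + x) x = A f`, with value `-(α/2 + c)` at `t₀`, so the bracket in the formula for
      -- `y₂` vanishes there.
      obtain ⟨B, hB, hAB⟩ := exists_eq_sub_mul ((hA.fun_mul hf).fun_add
        (analyticAt_const (v := α / 2 + c))) (by rw [hA0, sub_eq_zero.1 hf1]; ring)
      refine ⟨2, _, fun t => -(B t * f t), hx, (hB.fun_mul hf).fun_neg, ?_⟩
      filter_upwards [hXY, hfg, nhdsWithin_le_nhds hAB,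
        nhdsWithin_le_nhds (hf.continuousAt.eventually_ne hfne), self_mem_nhdsWithin]
        with t h1 h2 h3 h4 hne
      have hne' : t - t₀ ≠ 0 := sub_ne_zero.2 hne
      change X t ≠ 0 ∧ (1 / X t, -((Y t + X t) * X t + (α + 2 * c) / 2) * X t) = _
      have h5 : Y t + X t = (t - t₀) * A t := by
        rw [h1.1, h1.2, ← add_div, add_comm, h2]
        field_simp
      rw [h5, h1.1]
      refine ⟨div_ne_zero h4 hne', Prod.ext (one_div_div _ _) ?_⟩
      change -((t - t₀) * A t * (f t / (t - t₀)) + (α + 2 * c) / 2) * (f t / (t - t₀)) =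
        -(B t * f t)
      field_simp
      linear_combination -2 * h3
    · have hf1 : f t₀ = -1 := by linear_combination hf1
      -- The reflection `(x, c) ↦ (-x, -c)` preserves the system and reduces this case to the
      -- previous one.
      obtain ⟨A, hA, hA0, hfg⟩ := exists_add_eq_sq_mul (a := α / 2) (b := -c) hf.fun_neg hg
        (by rw [hf1, neg_neg]) hg0 (by
          filter_upwards [heq] with t ht
          rw [deriv.fun_neg]
          exact ⟨by linear_combination -ht.1, by linear_combination ht.2⟩)
      obtain ⟨B, hB, hAB⟩ := exists_eq_sub_mul ((hA.fun_mul hf).fun_sub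
        (analyticAt_const (v := α / 2 - c))) (by rw [hA0, hf1]; ring)
      refine ⟨1, _, fun t => -(B t * f t), hx, (hB.fun_mul hf).fun_neg, ?_⟩
      filter_upwards [hXY, hfg, nhdsWithin_le_nhds hAB,
        nhdsWithin_le_nhds (hf.continuousAt.eventually_ne hfne), self_mem_nhdsWithin]
        with t h1 h2 h3 h4 hne
      have hne' : t - t₀ ≠ 0 := sub_ne_zero.2 hne
      change X t ≠ 0 ∧ (1 / X t, -((Y t - X t) * X t - (α - 2 * c) / 2) * X t) = _
      have h5 : Y t - X t = (t - t₀) * A t := by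
        rw [h1.1, h1.2, ← sub_div, show g t - f t = -f t + g t by ring, h2]
        field_simp
      rw [h5, h1.1]
      refine ⟨div_ne_zero h4 hne', Prod.ext (one_div_div _ _) ?_⟩
      change -((t - t₀) * A t * (f t / (t - t₀)) - (α - 2 * c) / 2) * (f t / (t - t₀)) =
        -(B t * f t)
      field_simp
      linear_combination -2 * h3

end Meromorphic

end Ince

end

/-! ### Phase space and symmetries together -/

theorem mainTheorem10 (α β c : ℂ) (hc : c ^ 2 = -β) :
    -- the four coordinate systems are birational and symplectic
    (∀ j, IntermediateField.adjoin ℂ {(Ince.chart α c j).1, (Ince.chart α c j).2} = ⊤ ∧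
      Ince.wedge (Ince.chart α c j).1 (Ince.chart α c j).2 = Ince.wedge Ince.x Ince.y) ∧
    -- the blow-ups: each centre is a point of the surface constructed before
    (∀ (k : ℕ) (hk : k < (Ince.centres α c).length), (Ince.centres α c)[k] ∈
      Ince.blowUps Ince.projectivePlane ((Ince.centres α c).take k)) ∧
    -- the resulting rational surface is of type `E₆⁽¹⁾`
    Ince.IsTypeE6 (Ince.surface α c) Ince.boundary ∧
    -- the four charts glue to the complement of the seven `(-2)`-curves
    Ince.phaseSpace α c = {R | R ∈ Ince.surface α c ∧ ∀ i, ¬ R ≤ Ince.boundary i} ∧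
    -- this is the phase space of the system
    (∃ δ : Derivation ℂ Ince.K Ince.K, Ince.IsInceField α c δ ∧
      (∀ j, ∃ P : MvPolynomial (Fin 2) ℂ,
        Ince.hamiltonian α c =
          MvPolynomial.aeval ![(Ince.chart α c j).1, (Ince.chart α c j).2] P ∧
        δ (Ince.chart α c j).1 = MvPolynomial.aeval
          ![(Ince.chart α c j).1, (Ince.chart α c j).2] (MvPolynomial.pderiv 1 P) ∧
        δ (Ince.chart α c j).2 = -MvPolynomial.aeval
          ![(Ince.chart α c j).1, (Ince.chart α c j).2] (MvPolynomial.pderiv 0 P)) ∧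
      (∀ R ∈ Ince.surface α c, R ∈ Ince.phaseSpace α c ↔ Ince.IsRegularAt δ R) ∧
      Ince.HasLogPoles δ (Ince.surface α c) Ince.boundary ∧
      ∀ R, ¬ Ince.IsAccessible δ (Ince.surface α c) Ince.boundary R) ∧
    (∀ (X Y : ℂ → ℂ) (t₀ : ℂ), MeromorphicAt X t₀ → MeromorphicAt Y t₀ →
      (∀ᶠ t in 𝓝[≠] t₀, Ince.SolvesAt α c X Y t) →
      ∃ (j : Fin 4) (ξ η : ℂ → ℂ), AnalyticAt ℂ ξ t₀ ∧ AnalyticAt ℂ η t₀ ∧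
        ∀ᶠ t in 𝓝[≠] t₀, Ince.chartDenom (X t) (Y t) j ≠ 0 ∧
          Ince.chartMap α c (X t) (Y t) j = (ξ t, η t)) ∧
    -- the system is invariant under `s₀`, `s₁`, `s₂`
    (∀ i : Fin 3,
      IntermediateField.adjoin ℂ
        {(Ince.symMap (algebraMap ℂ Ince.K α) (algebraMap ℂ Ince.K c) Ince.x Ince.y i).1,
          (Ince.symMap (algebraMap ℂ Ince.K α) (algebraMap ℂ Ince.K c) Ince.x Ince.y i).2} = ⊤ ∧
      Ince.symRoot α c i ^ 2 = -Ince.symBeta α β c i ∧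
      ∀ (U : Set ℂ) (X Y : ℂ → ℂ), IsOpen U →
        (∀ t ∈ U, Ince.SolvesAt α c X Y t) →
        (∀ t ∈ U, Ince.symDenom (X t) (Y t) i ≠ 0) →
        ∀ t ∈ U, Ince.SolvesAt (Ince.symAlpha α c i) (Ince.symRoot α c i)
          (fun s => (Ince.symMap α c (X s) (Y s) i).1)
          (fun s => (Ince.symMap α c (X s) (Y s) i).2) t) := by
  obtain ⟨δ, hδ⟩ := Ince.exists_isInceField α c
  have strat : ∀ R ∈ Ince.surface α c, _ := fun R hR => hδ.stratification hR
  refine ⟨fun j => ⟨Ince.isChart_chart α c j, Ince.wedge_chart α c j⟩,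
    Ince.areCentres_centres α c, Ince.isTypeE6_surface α c, Ince.phaseSpace_eq α c,
    ⟨δ, hδ, fun j => ⟨Ince.hamiltonianPoly α c j, hδ.hamiltonian_chart j⟩, fun R hR => ?_,
      Ince.hasLogPoles_of_strata strat, Ince.not_isAccessible_of_strata strat⟩,
    fun X Y t₀ hX hY h => Ince.exists_chart_of_meromorphic hX hY h,
    fun i => ⟨Ince.isChart_symMap α c i, Ince.symRoot_sq hc i,
      fun U X Y _ h hd t ht => (h t ht).symMap i (hd t ht)⟩⟩
  -- Regularity of the field at a point of the surface and membership in the glued surface are both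
  -- equivalent to lying on none of the boundary curves.
  rw [Ince.isRegularAt_iff_of_strata (strat R hR), Ince.phaseSpace_eq]
  exact ⟨fun h => h.2, fun h => ⟨hR, h⟩⟩
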